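/- Let $D=(0,1)$, $H=L^2(D;\mathbb R)$, $e_i(x)=\sqrt2\sin(i\pi x)$, $\lambda_i=\pi^2i^2$ ($i\ge 1$), and let $A=-\Delta$ be the negative Dirichlet Laplacian, so that $Ae_i=\lambda_ie_i$. For $\gamma\in\mathbb R$ put $\|v\|_{\gamma}=\|A^{\gamma/2}v\|=\big(\sum_{i}\lambda_i^{\gamma}\langle v,e_i\rangle^2\big)^{1/2}$, the norm of $\dot H^{\gamma}$, and let $\|\cdot\|_V$ be the supremum norm of $V=C(D,\mathbb R)$. Let $P_Nv=\sum_{i=1}^N\langle v,e_i\rangle e_i$ and $E_N(t)=e^{-tAP_N}$ on $P_NH$. Let $F(v)(x)=f(v(x))$ with $f(v)=a_3v^3+a_2v^2+a_1v+a_0$, $a_3<0$, $a_2,a_1,a_0\in\mathbb R$, and $F_N=P_NF$. Let $T>0$, let $(\Omega,\mathcal F,\mathbb P)$ be a probability space with a normal filtration $(\mathcal F_t)_{t\in[0,T]}$, let $W(t)=\sum_{n}\beta_n(t)e_n$, $t\in[0,T]$, be a cylindrical $I$-Wiener process with respect to it (the $\beta_n$ being independent standard real Brownian motions), and let $X_0:\Omega\to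 H$ be $\mathcal F_0$-measurable. For $M,N\in\mathbb N=\{1,2,\dots\}$ let $\tau=T/M$, $t_m=m\tau$, and let $Y^{M,N}_{t_m}$ be given by the nonlinearity-tamed accelerated exponential Euler scheme $Y^{M,N}_{0}=P_NX_0$, $$Y^{M,N}_{t_{m+1}}=E_N(\tau)Y^{M,N}_{t_m}+\int_{t_m}^{t_{m+1}}\frac{E_N(t_{m+1}-r)F_N(Y^{M,N}_{t_m})}{1+\tau\|F_N(Y^{M,N}_{t_m})\|}\,dr+\int_{t_m}^{t_{m+1}}E_N(t_{m+1}-r)P_N\,dW(r),$$ with continuous-time interpolant $$Y^{M,N}_t=E_N(t)P_NX_0+\int_0^t\frac{E_N(t-r)F_N(Y^{M,N}_{\lfloor r\rfloor})}{1+\tau\|F_N(Y^{M,N}_{\lfloor r\rfloor})\|}\,dr+\int_0^tE_N(t-r)P_N\,dW(r),\qquad t\in[0,T],$$ where $\lfloor r\rfloor=t_i$ for $r\in[t_i,t_{i+1})$. Then for every $p\in[2,\infty)$ and every $\beta$ with $-\tfrac12<\beta<\tfrac12$ there is $p_0\in\mathbb N$, depending only on $p$ and $\beta$, such that the following holds.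 If $\mathbb E\|X_0\|_{\gamma}^{p_0}<\infty$ for every $\gamma<\tfrac12$, $\mathbb E\|X_0\|_V^{p_0}<\infty$ and $\sup_{N}\|P_NX_0\|_{L^{p_0}(\Omega,V)}<\infty$, then there is a constant $C$, independent of $M$, $N$, $s$ and $t$, such that for all $M,N\in\mathbb N$ the random variable $Y^{M,N}_t-Y^{M,N}_s$ satisfies $$\|Y^{M,N}_t-Y^{M,N}_s\|_{L^p(\Omega,\dot H^{-\beta})}\le C\,(t-s)^{\beta},\qquad 0\le s<t\le T.$$ -/

import Mathlib

open MeasureTheory ProbabilityTheory Filter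
open scoped ENNReal NNReal Topology

noncomputable section

namespace AllenCahn

/-! ### The space `H = L²(0,1)`, the Dirichlet Laplacian and its functional calculus -/

/-- Lebesgue measure on `D = (0,1)`. -/
abbrev μD : Measure ℝ := volume.restrict (Set.Ioo (0 : ℝ) 1)

/-- `H = L²((0,1); ℝ)`. -/
abbrev H : Type := Lp ℝ 2 μD

/-- The eigenfunctions `√2 sin(iπx)` of the Dirichlet Laplacian, with `i = n + 1`, `n = 0, 1, …`. -/
def eigenfunction (n : ℕ) (x : ℝ) : ℝ := √2 * Real.sin ((n + 1) * Real.pi * x)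

/-- The eigenvalues `λ_i = π² i²` of `A = -Δ`, with `i = n + 1`. -/
def eigenvalue (n : ℕ) : ℝ := Real.pi ^ 2 * ((n : ℝ) + 1) ^ 2

/-- The eigenfunctions solve the Dirichlet eigenvalue problem `-u'' = λ u`, `u(0) = u(1) = 0`. -/
theorem eigenfunction_spec (n : ℕ) :
    eigenfunction n 0 = 0 ∧ eigenfunction n 1 = 0 ∧
      ∀ x, -(deriv (deriv (eigenfunction n)) x) = eigenvalue n * eigenfunction n x := by
  refine ⟨by simp [eigenfunction], ?_, fun x => ?_⟩
  · have h := Real.sin_nat_mul_pi (n + 1)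
    push_cast at h
    simp [eigenfunction, h]
  · have h1 : ∀ x, HasDerivAt (eigenfunction n)
        (√2 * (Real.cos ((n + 1) * Real.pi * x) * ((n + 1) * Real.pi))) x := fun x => by
      have := ((hasDerivAt_id' x).const_mul ((n + 1) * Real.pi)).sin.const_mul √2
      rw [mul_one] at this
      exact this
    have h2 : HasDerivAt (deriv (eigenfunction n))
        (√2 * (-Real.sin ((n + 1) * Real.pi * x) * ((n + 1) * Real.pi) * ((n + 1) * Real.pi)))
        x := by
      rw [funext fun y => (h1 y).deriv]
      have := (((hasDerivAt_id x).const_mul ((n + 1) * Real.pi)).cos.mul_const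
        ((n + 1) * Real.pi)).const_mul √2
      simpa using this
    rw [h2.deriv, eigenfunction, eigenvalue]
    ring

theorem memLp_eigenfunction (n : ℕ) : MemLp (eigenfunction n) 2 μD := by
  refine MemLp.of_bound (C := √2) ?_ (ae_of_all _ fun x => ?_)
  · have : Continuous (eigenfunction n) := by unfold eigenfunction; fun_prop
    exact this.aestronglyMeasurable
  · rw [eigenfunction, norm_mul, Real.norm_of_nonneg (Real.sqrt_nonneg 2)]
    exact mul_le_of_le_one_right (Real.sqrt_nonneg 2) (Real.abs_sin_le_one _)

/-- The orthonormal basis of `H` formed by the eigenfunctions. -/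
def e (n : ℕ) : H := (memLp_eigenfunction n).toLp (eigenfunction n)

/-- The spectral norm `‖v‖_γ = ‖A^{γ/2} v‖ = (∑ λ_n^γ ⟨v, e_n⟩²)^{1/2}` of `Ḣ^γ`, for any real
order `γ`; the value is `∞` when `v` does not belong to `Ḣ^γ`. -/
def sobolevENorm (γ : ℝ) (v : H) : ℝ≥0∞ :=
  (∑' n, ENNReal.ofReal (eigenvalue n ^ γ * (inner ℝ (e n) v) ^ 2)) ^ (1 / 2 : ℝ)

/-- The norm of `V = C(D, ℝ)`: the supremum over `D` of the continuous representative of `v`, and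
`∞` when there is no continuous representative (or it is unbounded). -/
def supENorm (v : H) : ℝ≥0∞ :=
  ⨅ (g : ℝ → ℝ) (_ : ContinuousOn g (Set.Ioo 0 1)) (_ : v =ᵐ[μD] g), ⨆ x ∈ Set.Ioo (0 : ℝ) 1, ‖g x‖ₑ

/-- The spectral Galerkin projection `P_N` onto `span {e_1, …, e_N}`. -/
def galerkinProj (N : ℕ) (v : H) : H := ∑ n ∈ Finset.range N, inner ℝ (e n) v • e n

/-- `E_N(t) P_N = e^{-t A_N} P_N`. -/
def galerkinSemigroup (N : ℕ) (t : ℝ) (v : H) : H :=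
  ∑ n ∈ Finset.range N, (Real.exp (-(eigenvalue n * t)) * inner ℝ (e n) v) • e n

/-! ### The cubic nonlinearity -/

/-- `f(x) = a₃ x³ + a₂ x² + a₁ x + a₀`. -/
def cubic (a₀ a₁ a₂ a₃ x : ℝ) : ℝ := a₃ * x ^ 3 + a₂ * x ^ 2 + a₁ * x + a₀

open Classical in
/-- The Nemytskii operator `F(v)(x) = f(v(x))`. It has its true value as soon as `f ∘ v ∈ L²(D)`,
in particular on all of `L⁶(D)`; elsewhere it is given the value `0`. -/
def nemytskii (a₀ a₁ a₂ a₃ : ℝ) (v : H) : H :=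
  if h : MemLp (fun x => cubic a₀ a₁ a₂ a₃ (v x)) 2 μD then h.toLp _ else 0

/-- `F` maps `L⁶(D)` to `H` by `F(v)(x) = f(v(x))`. -/
theorem nemytskii_of_memLp (a₀ a₁ a₂ a₃ : ℝ) (v : H) (hv : MemLp v 6 μD) :
    nemytskii a₀ a₁ a₂ a₃ v =ᵐ[μD] fun x => cubic a₀ a₁ a₂ a₃ (v x) := by
  have h3 : MemLp (fun x => v x ^ 3) 2 μD := by
    have hp : (6 : ℝ≥0∞) / (3 : ℝ≥0∞) = 2 := by
      exact ((ENNReal.eq_div_iff (by simp) (by simp)).2 (by norm_num)).symm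
    have h := hv.norm_rpow_div 3
    rw [hp] at h
    refine h.mono (hv.1.pow 3) (ae_of_all _ fun x => ?_)
    simp
  have h2 : MemLp (fun x => v x ^ 2) 2 μD := by
    have hp : (4 : ℝ≥0∞) / (2 : ℝ≥0∞) = 2 := by
      exact ((ENNReal.eq_div_iff (by simp) (by simp)).2 (by norm_num)).symm
    have h4 : MemLp v 4 μD := hv.mono_exponent (by norm_num)
    have h := h4.norm_rpow_div 2
    rw [hp] at h
    refine h.mono (hv.1.pow 2) (ae_of_all _ fun x => ?_)
    simp
  have h : MemLp (fun x => cubic a₀ a₁ a₂ a₃ (v x)) 2 μD := by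
    unfold cubic
    exact (((h3.const_mul a₃).add (h2.const_mul a₂)).add ((Lp.memLp v).const_mul a₁)).add
      (memLp_const a₀)
  rw [nemytskii, dif_pos h]
  exact h.coeFn_toLp

/-! ### The noise -/

variable {Ω : Type*} {mΩ : MeasurableSpace Ω}

/-- `ℱ` is a normal filtration on `[0,T]`: `ℱ 0` contains all null events and `ℱ` is
right-continuous. Only the times in `[0,T]` matter. -/
structure IsNormalFiltration (P : Measure Ω) (T : ℝ) (ℱ : Filtration ℝ mΩ) : Prop where
  null_mem : ∀ S : Set Ω, MeasurableSet S → P S = 0 → MeasurableSet[ℱ 0] S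
  right_cont : ∀ t ∈ Set.Ico 0 T, (⨅ u ∈ Set.Ioc t T, ℱ u) = ℱ t

/-- The formal series `W(t) = ∑ β_n(t) e_n` is a cylindrical `I`-Wiener process on `[0,T]` with
respect to `ℱ`: the `β_n` are independent standard real Brownian motions on `[0,T]`, adapted to `ℱ`,
whose increments after a time `s` are jointly independent of `ℱ s`. Only the times in `[0,T]`
matter. -/
structure IsCylindricalWiener (P : Measure Ω) (T : ℝ) (ℱ : Filtration ℝ mΩ)
    (B : ℕ → ℝ → Ω → ℝ) : Prop where
  adapted : ∀ n, ∀ t ∈ Set.Icc 0 T, Measurable[ℱ t] (B n t)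
  start_zero : ∀ n, ∀ᵐ ω ∂P, B n 0 ω = 0
  continuous_paths : ∀ n, ∀ᵐ ω ∂P, ContinuousOn (fun t => B n t ω) (Set.Icc 0 T)
  increment_law : ∀ n, ∀ s t : ℝ, 0 ≤ s → s ≤ t → t ≤ T →
    P.map (fun ω => B n t ω - B n s ω) = gaussianReal 0 (t - s).toNNReal
  increment_indep : ∀ s t : ℝ, 0 ≤ s → s ≤ t → t ≤ T →
    Indep (MeasurableSpace.comap (fun ω n => B n t ω - B n s ω) MeasurableSpace.pi) (ℱ s) P
  indep : iIndepFun (fun n ω (t : Set.Icc (0 : ℝ) T) => B n t ω) P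

/-- The left-endpoint sum of `g dβ` over the uniform partition of `[a,b]` into `k` pieces. -/
def itoSum (β : ℝ → Ω → ℝ) (g : ℝ → ℝ) (a b : ℝ) (k : ℕ) (ω : Ω) : ℝ :=
  ∑ j ∈ Finset.range k, g (a + j * ((b - a) / k)) *
    (β (a + (j + 1) * ((b - a) / k)) ω - β (a + j * ((b - a) / k)) ω)

/-- `I` is (a version of) the Wiener integral `∫_a^b g(r) dβ(r)` of a continuous deterministic
integrand `g`: the limit in `L²(Ω)` of the left-endpoint sums. -/
def IsWienerIntegral (P : Measure Ω) (β : ℝ → Ω → ℝ) (g : ℝ → ℝ) (a b : ℝ) (I : Ω → ℝ) : Prop :=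
  MemLp I 2 P ∧ Tendsto (fun k => eLpNorm (itoSum β g a b k - I) 2 P) atTop (𝓝 0)

open Classical in
/-- The Wiener integral `∫_a^b g(r) dβ(r)` of a continuous deterministic integrand (a version of
the `L²(Ω)`-limit, which is unique up to null events). -/
def wienerIntegral (P : Measure Ω) (β : ℝ → Ω → ℝ) (g : ℝ → ℝ) (a b : ℝ) : Ω → ℝ :=
  if h : ∃ I, IsWienerIntegral P β g a b I then h.choose else 0

/-- The stochastic integral `∫_a^b E_N(b - r) P_N dW(r)`. As `E_N(b - r) P_N` maps `e_n` to
`e^{-λ_n (b - r)} e_n` for the first `N` basis vectors and to `0` for the others, this is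
`∑_{n ≤ N} (∫_a^b e^{-λ_n (b - r)} dβ_n(r)) e_n`. -/
def stochConv (P : Measure Ω) (B : ℕ → ℝ → Ω → ℝ) (N : ℕ) (a b : ℝ) (ω : Ω) : H :=
  ∑ n ∈ Finset.range N,
    wienerIntegral P (B n) (fun r => Real.exp (-(eigenvalue n * (b - r)))) a b ω • e n

/-! ### The numerical scheme -/

/-- The tamed drift `F_N(y) / (1 + τ ‖F_N(y)‖)`, where `F_N = P_N F`. -/
def tamedDrift (a₀ a₁ a₂ a₃ : ℝ) (N : ℕ) (τ : ℝ) (y : H) : H :=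
  (1 + τ * ‖galerkinProj N (nemytskii a₀ a₁ a₂ a₃ y)‖)⁻¹ •
    galerkinProj N (nemytskii a₀ a₁ a₂ a₃ y)

/-- The values `Y_{t_m}`, `t_m = m τ`, of the tamed accelerated exponential Euler scheme
with step size `τ`: `Y_{t_0} = P_N X₀` and
`Y_{t_{m+1}} = E_N(τ) Y_{t_m} + ∫_{t_m}^{t_{m+1}} E_N(t_{m+1} - r) F_N(Y_{t_m}) / (1 + τ ‖F_N(Y_{t_m})‖) dr
  + ∫_{t_m}^{t_{m+1}} E_N(t_{m+1} - r) P_N dW(r)`. -/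
def scheme (P : Measure Ω) (B : ℕ → ℝ → Ω → ℝ) (a₀ a₁ a₂ a₃ : ℝ) (X₀ : Ω → H) (N : ℕ) (τ : ℝ) :
    ℕ → Ω → H
  | 0, ω => galerkinProj N (X₀ ω)
  | m + 1, ω =>
      galerkinSemigroup N τ (scheme P B a₀ a₁ a₂ a₃ X₀ N τ m ω)
      + (∫ r in (m * τ)..((m + 1) * τ), galerkinSemigroup N ((m + 1) * τ - r)
          (tamedDrift a₀ a₁ a₂ a₃ N τ (scheme P B a₀ a₁ a₂ a₃ X₀ N τ m ω)))
      + stochConv P B N (m * τ) ((m + 1) * τ) ω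

/-- The continuous-time interpolant
`Y_t = E_N(t) Y_0 + ∫_0^t E_N(t - r) F_N(Y_⌊r⌋) / (1 + τ ‖F_N(Y_⌊r⌋)‖) dr + ∫_0^t E_N(t - r) P_N dW(r)`,
where `⌊r⌋ = t_i` for `r ∈ [t_i, t_{i+1})`. -/
def interpolant (P : Measure Ω) (B : ℕ → ℝ → Ω → ℝ) (a₀ a₁ a₂ a₃ : ℝ) (X₀ : Ω → H) (N : ℕ) (τ : ℝ)
    (t : ℝ) (ω : Ω) : H :=
  galerkinSemigroup N t (scheme P B a₀ a₁ a₂ a₃ X₀ N τ 0 ω)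
  + (∫ r in (0 : ℝ)..t, galerkinSemigroup N (t - r)
      (tamedDrift a₀ a₁ a₂ a₃ N τ (scheme P B a₀ a₁ a₂ a₃ X₀ N τ ⌊r / τ⌋₊ ω)))
  + stochConv P B N 0 t ω

end AllenCahn

end

noncomputable section

namespace AllenCahn

/-! In the sine basis the scheme is a system of scalar recursions, and coordinate `n` of `Y_t - Y_s`
is a sum of three increments: that of the initial term `e^{-λt}⟨e_n, X₀⟩`, that of the drift
convolution, and that of the Wiener integral `∫ e^{-λ(t-r)} dβ_n`, with `λ = λ_n`. Put `δ = t - s`.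
The last two increments are controlled by the same number `incVar`, which is at most `2 λ⁻¹ (λδ)^θ`
for every `θ ∈ [0,1]` (`incVar_le`). For the noise this is a Gaussian variance bound. For the drift
it is Cauchy-Schwarz in time against `Φ = ∑ τ ‖f(Y_{t_m})‖²_{L¹}`, since `|e_n| ≤ √2` bounds all
drift coefficients by the `L¹` norm. Taking `θ = |β| + β` turns the weight `λ^{-β}` of `Ḣ^{-β}` into
`λ^{|β|-1} δ^θ`, summable over `n` because `|β| < 1/2`. The initial term costs `δ^θ ‖X₀‖²_{|β|}`.
Finally `δ^θ ≤ T^{|β|-β} δ^{2β}`, and a square root gives the rate `β`.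

What remains is a moment bound for `Φ`, uniform in `M` and `N` (`exists_eLpNorm_sum_driftL1_sq_le`).
Write `Y = z + o` at the grid points, `o` being the accumulated noise. Then `z` solves a noise-free
recursion, and an energy estimate for `‖z‖² + (τ/2)‖z‖²_{Ḣ¹}` holds for each `ω`. The cubic
dissipates `‖z‖⁴_{L⁴}` up to `‖o‖⁶_{L⁶}`. The taming gives `τ ‖tamed drift‖ ≤ 1`, so the quadratic
error `τ² ‖tamed drift‖²` of an explicit step becomes linear in `‖P_N F(Y)‖`, and `drift_coercive`
absorbs it into the quartic dissipation and a small multiple of `‖z‖²_{Ḣ¹}`. No Gronwall argument is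
needed. The result bounds `sup ‖z‖²` and `∑ τ ‖z‖²_{Ḣ¹}` by data and noise, and `‖z‖³_{L³} ≤ ‖z‖_∞
‖z‖²` with `‖z‖²_∞ ≲ ‖z‖²_{Ḣ¹}` then bounds `Φ` by a cubic polynomial in these quantities
(`sum_driftL1_sq_le`). The moments of `∫ o⁶` come from pointwise Gaussianity and Tonelli.

The Wiener integrals are given as `L²` limits of left-endpoint sums. They are identified almost
surely with a pathwise integral obtained by partial integration, which supplies the flow property;
the Gaussian bounds for the sums pass to the limit by Fatou. -/

theorem eigenvalue_pos (n : ℕ) : 0 < eigenvalue n := by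
  unfold eigenvalue; positivity

/-! ### Gaussian laws of sums of Brownian increments -/

section Gaussian

variable {Ω : Type*} {mΩ : MeasurableSpace Ω} {P : Measure Ω}

theorem map_sum_gaussianReal_of_iIndepFun [IsProbabilityMeasure P] {X : ℕ → Ω → ℝ} {v : ℕ → ℝ≥0}
    (hind : iIndepFun X P) (hX : ∀ n, Measurable (X n))
    (hlaw : ∀ n, P.map (X n) = gaussianReal 0 (v n)) (N : ℕ) :
    P.map (∑ n ∈ Finset.range N, X n) = gaussianReal 0 (∑ n ∈ Finset.range N, v n) := by
  induction N with
  | zero => simp [show (0 : Ω → ℝ) = fun _ => (0 : ℝ) from rfl, Measure.map_const]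
  | succ N ih =>
    rw [Finset.sum_range_succ, Finset.sum_range_succ]
    have h : IndepFun (∑ n ∈ Finset.range N, X n) (X N) P :=
      hind.indepFun_finsetSum_of_notMem hX Finset.notMem_range_self
    simpa using gaussianReal_add_gaussianReal_of_indepFun h ih (hlaw N)

theorem map_const_mul_gaussianReal {X : Ω → ℝ} {v : ℝ≥0} (hX : Measurable X)
    (hlaw : P.map X = gaussianReal 0 v) (c : ℝ) :
    P.map (fun ω => c * X ω) = gaussianReal 0 (.mk (c ^ 2) (sq_nonneg c) * v) := by
  have := (gaussianReal_const_mul (P := P) ⟨hX.aemeasurable, hlaw⟩ c).map_eq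
  simpa using this

/-- The `L^q` norm of a standard Gaussian variable. -/
def gaussianMoment (q : ℝ≥0∞) : ℝ≥0∞ := eLpNorm id q (gaussianReal 0 1)

theorem gaussianMoment_lt_top {q : ℝ≥0∞} (hq : q ≠ ∞) : gaussianMoment q < ∞ :=
  (memLp_id_gaussianReal' q hq).2

/-- A centred Gaussian of variance `v` is `√v` times a standard one in law. Every moment bound on
the noise thereby reduces to a variance bound. -/
theorem eLpNorm_of_map_eq_gaussianReal {X : Ω → ℝ} {v : ℝ≥0} (hX : AEMeasurable X P)
    (hlaw : P.map X = gaussianReal 0 v) (q : ℝ≥0∞) :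
    eLpNorm X q P = ENNReal.ofReal (√v) * gaussianMoment q := by
  have h1 : eLpNorm X q P = eLpNorm id q (gaussianReal 0 v) := by
    rw [← hlaw, eLpNorm_map_measure aestronglyMeasurable_id hX]; rfl
  have h2 : gaussianReal 0 v = (gaussianReal 0 1).map (fun x => √v * x) := by
    rw [gaussianReal_map_const_mul]
    congr 1
    · simp
    · ext; simp
  rw [h1, h2, eLpNorm_map_measure aestronglyMeasurable_id (by fun_prop)]
  rw [gaussianMoment, show (id ∘ fun x : ℝ => √v * x) = (√v : ℝ) • (id : ℝ → ℝ) by ext; simp,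
    eLpNorm_const_smul]
  congr 1
  rw [Real.enorm_eq_ofReal (Real.sqrt_nonneg _)]

variable {T : ℝ} {ℱ : Filtration ℝ mΩ} {B : ℕ → ℝ → Ω → ℝ}

theorem IsCylindricalWiener.measurable (hW : IsCylindricalWiener P T ℱ B) (n : ℕ) {t : ℝ}
    (ht : t ∈ Set.Icc 0 T) : Measurable (B n t) :=
  (hW.adapted n t ht).mono (ℱ.le t) le_rfl

theorem IsCylindricalWiener.map_sum_increments [IsProbabilityMeasure P]
    (hW : IsCylindricalWiener P T ℱ B)
    (c : ℕ → ℝ) (N : ℕ) {s t : ℝ} (hs : 0 ≤ s) (hst : s ≤ t) (ht : t ≤ T) :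
    P.map (fun ω => ∑ n ∈ Finset.range N, c n * (B n t ω - B n s ω)) =
      gaussianReal 0 ((∑ n ∈ Finset.range N, c n ^ 2) * (t - s)).toNNReal := by
  have hsT : s ∈ Set.Icc 0 T := ⟨hs, hst.trans ht⟩
  have htT : t ∈ Set.Icc 0 T := ⟨hs.trans hst, ht⟩
  have hind : iIndepFun (fun n ω => c n * (B n t ω - B n s ω)) P :=
    hW.indep.comp (fun n (w : Set.Icc (0 : ℝ) T → ℝ) => c n * (w ⟨t, htT⟩ - w ⟨s, hsT⟩))
      fun n => by fun_prop
  have hm : ∀ n, Measurable (fun ω => B n t ω - B n s ω) := fun n =>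
    (hW.measurable n htT).sub (hW.measurable n hsT)
  have h := map_sum_gaussianReal_of_iIndepFun hind (fun n => (hm n).const_mul (c n))
    (fun n => map_const_mul_gaussianReal (hm n) (hW.increment_law n s t hs hst ht) (c n)) N
  rw [show (fun ω => ∑ n ∈ Finset.range N, c n * (B n t ω - B n s ω)) =
    ∑ n ∈ Finset.range N, fun ω => c n * (B n t ω - B n s ω) by ext; simp, h]
  congr 1
  ext
  have h0 : 0 ≤ t - s := by linarith
  rw [Real.coe_toNNReal _ (mul_nonneg (Finset.sum_nonneg fun _ _ => sq_nonneg _) h0)]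
  simp [Finset.sum_mul, h0]

/-- Sums of Brownian increments over a partition, with deterministic coefficients, are Gaussian. -/
theorem IsCylindricalWiener.map_sum_sum_increments [IsProbabilityMeasure P]
    (hW : IsCylindricalWiener P T ℱ B)
    (c : ℕ → ℕ → ℝ) (N : ℕ) {r : ℕ → ℝ} (hr0 : 0 ≤ r 0) (hr : Monotone r) (k : ℕ) (hrk : r k ≤ T) :
    P.map (fun ω => ∑ j ∈ Finset.range k, ∑ n ∈ Finset.range N,
        c j n * (B n (r (j + 1)) ω - B n (r j) ω)) =
      gaussianReal 0 (∑ j ∈ Finset.range k, (∑ n ∈ Finset.range N, c j n ^ 2) *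
        (r (j + 1) - r j)).toNNReal := by
  have hnn : ∀ j, 0 ≤ (∑ n ∈ Finset.range N, c j n ^ 2) * (r (j + 1) - r j) := fun j =>
    mul_nonneg (Finset.sum_nonneg fun _ _ => sq_nonneg _) (sub_nonneg.2 (hr (Nat.le_succ j)))
  induction k with
  | zero => simp [Measure.map_const]
  | succ k ih =>
    have hk0 : 0 ≤ r k := hr0.trans (hr (Nat.zero_le k))
    have hkT : r k ≤ T := (hr (Nat.le_succ k)).trans hrk
    set S : Ω → ℝ := fun ω => ∑ j ∈ Finset.range k, ∑ n ∈ Finset.range N,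
        c j n * (B n (r (j + 1)) ω - B n (r j) ω)
    set U : Ω → ℝ := fun ω => ∑ n ∈ Finset.range N, c k n * (B n (r (k + 1)) ω - B n (r k) ω)
    have hS : Measurable[ℱ (r k)] S := by
      refine Finset.measurable_fun_sum _ fun j hj => Finset.measurable_fun_sum _ fun n _ => ?_
      have hj : j < k := Finset.mem_range.1 hj
      have hm : ∀ i, i ≤ k → Measurable[ℱ (r k)] (B n (r i)) := fun i hi =>
        (hW.adapted n (r i) ⟨hr0.trans (hr (Nat.zero_le i)), (hr hi).trans hkT⟩).mono
          (ℱ.mono (hr hi)) le_rfl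
      exact ((hm (j + 1) hj).sub (hm j hj.le)).const_mul _
    -- `S` depends on the past up to `r k`, and `U` is a function of the whole vector of increments
    -- after `r k`, which is jointly independent of `ℱ (r k)`.
    have hind : IndepFun S U P := by
      rw [IndepFun_iff_Indep]
      refine (indep_of_indep_of_le (hW.increment_indep (r k) (r (k + 1)) hk0 (hr (Nat.le_succ k))
        hrk) ?_ hS.comap_le).symm
      have : U = (fun w : ℕ → ℝ => ∑ n ∈ Finset.range N, c k n * w n) ∘
        (fun ω n => B n (r (k + 1)) ω - B n (r k) ω) := rfl
      rw [this, ← MeasurableSpace.comap_comp]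
      refine MeasurableSpace.comap_mono (Measurable.comap_le ?_)
      fun_prop
    have := gaussianReal_add_gaussianReal_of_indepFun hind (ih hkT)
      (hW.map_sum_increments (c k) N hk0 (hr (Nat.le_succ k)) hrk)
    simp only [Finset.sum_range_succ]
    rw [Real.toNNReal_add (Finset.sum_nonneg fun j _ => hnn j) (hnn k)]
    rw [add_zero] at this
    exact this

end Gaussian

/-! ### Wiener integrals of smooth deterministic integrands -/

section Path

/-- The pathwise Wiener integral `∫_a^b g dβ`, by partial integration. -/
def pathIntegral (β g g' : ℝ → ℝ) (a b : ℝ) : ℝ :=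
  g b * β b - g a * β a - ∫ r in a..b, β r * g' r

/-- Summation by parts: the differences move from the rough path to the smooth integrand. -/
theorem sum_range_mul_sub_eq (u v : ℕ → ℝ) (k : ℕ) :
    ∑ j ∈ Finset.range k, u j * (v (j + 1) - v j) =
      u k * v k - u 0 * v 0 - ∑ j ∈ Finset.range k, v (j + 1) * (u (j + 1) - u j) := by
  induction k with
  | zero => simp
  | succ k ih => rw [Finset.sum_range_succ, Finset.sum_range_succ, ih]; ring

/-- After summation by parts only continuity of `β` matters: on each cell the error comes from
replacing `β x` by its value at the right endpoint, and uniform continuity makes this small. -/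
theorem tendsto_sum_pathIntegral {β g g' : ℝ → ℝ} {a b : ℝ} (hab : a ≤ b)
    (hβ : ContinuousOn β (Set.Icc a b)) (hg : ∀ x, HasDerivAt g (g' x) x) (hg' : Continuous g') :
    Tendsto (fun k : ℕ => ∑ j ∈ Finset.range k, g (a + j * ((b - a) / k)) *
      (β (a + (j + 1) * ((b - a) / k)) - β (a + j * ((b - a) / k)))) atTop
      (𝓝 (pathIntegral β g g' a b)) := by
  obtain ⟨K, hK⟩ := isCompact_Icc.exists_bound_of_continuousOn (s := Set.Icc a b) hg'.continuousOn
  have hK0 : 0 ≤ K := (norm_nonneg _).trans (hK a ⟨le_rfl, hab⟩)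
  have hunif := isCompact_Icc.uniformContinuousOn_of_continuous hβ
  rw [Metric.uniformContinuousOn_iff] at hunif
  rw [Metric.tendsto_atTop]
  intro ε hε
  -- With `K` a bound for `g'`, an oscillation of `ε / (K (b - a) + 1)` per cell sums to less than
  -- `ε`; the `+ 1` covers `K (b - a) = 0`.
  have hden : 0 < K * (b - a) + 1 := by
    have := mul_nonneg hK0 (sub_nonneg.2 hab); linarith
  obtain ⟨δ, hδ, hβδ⟩ := hunif (ε / (K * (b - a) + 1)) (div_pos hε hden)
  obtain ⟨k₀, hk₀⟩ := exists_nat_gt ((b - a) / δ)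
  refine ⟨k₀ + 1, fun k hk => ?_⟩
  have hkpos : 0 < (k : ℝ) := by exact_mod_cast (Nat.succ_pos k₀).trans_le hk
  set h := (b - a) / k with hh
  have hh0 : 0 ≤ h := div_nonneg (sub_nonneg.2 hab) hkpos.le
  have hkh : k * h = b - a := by rw [hh]; field_simp
  have hhδ : h < δ := by
    rw [hh, div_lt_iff₀ hkpos]
    rw [div_lt_iff₀ hδ] at hk₀
    have : (k₀ : ℝ) ≤ k := by exact_mod_cast (Nat.le_succ k₀).trans hk
    nlinarith
  set r : ℕ → ℝ := fun j => a + j * h with hr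
  have hmem : ∀ j, j ≤ k → r j ∈ Set.Icc a b := fun j hj => by
    have : (j : ℝ) ≤ k := by exact_mod_cast hj
    refine ⟨by simp only [hr]; nlinarith [mul_nonneg (Nat.cast_nonneg (α := ℝ) j) hh0], ?_⟩
    simp only [hr]; nlinarith
  have hrstep : ∀ j, r (j + 1) = r j + h := fun j => by simp only [hr]; push_cast; ring
  have hr0 : r 0 = a := by simp [hr]
  have hrk : r k = b := by simp only [hr]; linarith
  have hint : ∀ j, j < k → IntervalIntegrable (fun x => β x * g' x) volume (r j) (r (j + 1)) := by
    intro j hj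
    refine ContinuousOn.intervalIntegrable_of_Icc (by rw [hrstep]; linarith) ?_
    exact (hβ.mono (Set.Icc_subset_Icc (hmem j hj.le).1 (hmem (j + 1) hj).2)).mul hg'.continuousOn
  have hsum : ∑ j ∈ Finset.range k, g (a + j * h) * (β (a + (j + 1) * h) - β (a + j * h)) =
      g b * β b - g a * β a - ∑ j ∈ Finset.range k, β (r (j + 1)) * (g (r (j + 1)) - g (r j)) := by
    have := sum_range_mul_sub_eq (fun j => g (r j)) (fun j => β (r j)) k
    rw [hr0, hrk] at this
    rw [← this]
    simp [hr]
  have hI : ∫ x in a..b, β x * g' x =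
      ∑ j ∈ Finset.range k, ∫ x in (r j)..(r (j + 1)), β x * g' x := by
    rw [intervalIntegral.sum_integral_adjacent_intervals hint, hr0, hrk]
  rw [hsum, pathIntegral, hI, Real.dist_eq, sub_sub_sub_cancel_left, ← Finset.sum_sub_distrib]
  have hterm : ∀ j ∈ Finset.range k, |(∫ x in (r j)..(r (j + 1)), β x * g' x) -
      β (r (j + 1)) * (g (r (j + 1)) - g (r j))| ≤ ε / (K * (b - a) + 1) * K * h := by
    intro j hj
    have hj := Finset.mem_range.1 hj
    have hle : r j ≤ r (j + 1) := by rw [hrstep]; linarith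
    rw [← intervalIntegral.integral_eq_sub_of_hasDerivAt (fun x _ => hg x)
      (hg'.intervalIntegrable _ _), ← intervalIntegral.integral_const_mul,
      ← intervalIntegral.integral_sub (hint j hj) ((hg'.intervalIntegrable _ _).const_mul _),
      ← Real.norm_eq_abs]
    refine (intervalIntegral.norm_integral_le_of_norm_le_const (C := ε / (K * (b - a) + 1) * K)
      fun x hx => ?_).trans ?_
    · rw [Set.uIoc_of_le hle] at hx
      have hxm : x ∈ Set.Icc a b := ⟨(hmem j hj.le).1.trans hx.1.le, hx.2.trans (hmem (j + 1) hj).2⟩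
      rw [← sub_mul, norm_mul]
      have hd := (hβδ x hxm (r (j + 1)) (hmem (j + 1) hj) (by
        rw [Real.dist_eq, abs_sub_comm, abs_of_nonneg (by linarith [hx.2])]
        linarith [hx.1, hrstep j])).le
      rw [Real.dist_eq] at hd
      exact mul_le_mul hd (hK x hxm) (norm_nonneg _) (div_pos hε hden).le
    · rw [hrstep, add_sub_cancel_left, abs_of_nonneg hh0]
  refine (Finset.abs_sum_le_sum_abs _ _).trans_lt ((Finset.sum_le_sum hterm).trans_lt ?_)
  rw [Finset.sum_const, Finset.card_range, nsmul_eq_mul]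
  calc k * (ε / (K * (b - a) + 1) * K * h) = ε * (K * (k * h)) / (K * (b - a) + 1) := by ring
    _ = ε * ((K * (b - a)) / (K * (b - a) + 1)) := by rw [hkh]; ring
    _ < ε * 1 := by
        refine mul_lt_mul_of_pos_left ?_ hε
        rw [div_lt_one hden]; linarith
    _ = ε := mul_one ε

end Path

/-! ### The coefficients of the stochastic convolution: pathwise form, Gaussian moments, flow
property. -/

section WienerIntegral

variable {Ω : Type*} {mΩ : MeasurableSpace Ω} {P : Measure Ω} {T : ℝ} {ℱ : Filtration ℝ mΩ}
  {B : ℕ → ℝ → Ω → ℝ}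

/-- Where `|f| ≥ K` one has `|f| ≤ |f|² / K`, so the `L²` norm of the tail is at most `‖f‖₄² / K`;
the choice `K = C² / ε + 1` makes it at most `ε`. -/
theorem unifIntegrable_two_of_eLpNorm_four_le {f : ℕ → Ω → ℝ}
    (hf : ∀ i, AEStronglyMeasurable (f i) P) {C : ℝ≥0∞} (hC : C ≠ ∞)
    (hfC : ∀ i, eLpNorm (f i) 4 P ≤ C) : UnifIntegrable f 2 P := by
  refine unifIntegrable_of (by norm_num) (by norm_num) hf fun ε hε => ?_
  lift C to ℝ≥0 using hC
  have hK : 0 < (C : ℝ) ^ 2 / ε + 1 := by positivity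
  refine ⟨⟨(C : ℝ) ^ 2 / ε + 1, hK.le⟩, fun i => ?_⟩
  set K : ℝ≥0 := ⟨(C : ℝ) ^ 2 / ε + 1, hK.le⟩
  have hKK : (K : ℝ) = (C : ℝ) ^ 2 / ε + 1 := rfl
  have h1 : eLpNorm ({x | K ≤ ‖f i x‖₊}.indicator (f i)) 2 P ≤
      eLpNorm ((K : ℝ)⁻¹ • fun x => ‖f i x‖ ^ (2 : ℝ)) 2 P := by
    refine eLpNorm_mono_real fun x => ?_
    have hKpos : 0 < (K : ℝ) := hKK ▸ hK
    have hR : ((K : ℝ)⁻¹ • fun x => ‖f i x‖ ^ (2 : ℝ)) x = (K : ℝ)⁻¹ * ‖f i x‖ ^ 2 := by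
      simp
    rw [hR]
    by_cases hx : K ≤ ‖f i x‖₊
    · have hx' : (K : ℝ) ≤ ‖f i x‖ := by exact_mod_cast hx
      rw [Set.indicator_of_mem (by exact hx), inv_mul_eq_div, le_div_iff₀ hKpos]
      nlinarith [norm_nonneg (f i x)]
    · rw [Set.indicator_of_notMem (by exact hx), norm_zero]
      positivity
  refine h1.trans ?_
  rw [eLpNorm_const_smul, eLpNorm_norm_rpow _ (by norm_num)]
  have h4 : (2 : ℝ≥0∞) * ENNReal.ofReal 2 = 4 := by
    rw [show ENNReal.ofReal 2 = 2 by simp]; norm_num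
  rw [h4]
  calc ‖(K : ℝ)⁻¹‖ₑ * eLpNorm (f i) 4 P ^ (2 : ℝ) ≤ ‖(K : ℝ)⁻¹‖ₑ * (C : ℝ≥0∞) ^ (2 : ℝ) := by
        gcongr; exact hfC i
    _ = ENNReal.ofReal ((K : ℝ)⁻¹ * (C : ℝ) ^ 2) := by
        rw [ENNReal.ofReal_mul (by positivity), Real.enorm_eq_ofReal (by positivity),
          ENNReal.ofReal_pow (by positivity)]
        simp
    _ ≤ ENNReal.ofReal ε := by
        refine ENNReal.ofReal_le_ofReal ?_
        rw [inv_mul_eq_div, div_le_iff₀ (hKK ▸ hK), hKK, mul_add, mul_div_cancel₀ _ hε.ne']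
        linarith

/-- The integrand `e^{-λ(b - r)}` of the stochastic convolution. -/
def expKernel (l b r : ℝ) : ℝ := Real.exp (-(l * (b - r)))

theorem hasDerivAt_expKernel (l b r : ℝ) : HasDerivAt (expKernel l b) (l * expKernel l b r) r := by
  have h := (((hasDerivAt_id r).const_sub b).const_mul l).neg.exp
  simp only [id, mul_neg, mul_one, neg_neg] at h
  rw [mul_comm] at h
  exact h

theorem continuous_expKernel (l b : ℝ) : Continuous (expKernel l b) := by
  unfold expKernel; fun_prop

theorem expKernel_le_one {l b r : ℝ} (hl : 0 ≤ l) (hr : r ≤ b) : expKernel l b r ≤ 1 := by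
  refine Real.exp_le_one_iff.2 ?_
  nlinarith [mul_nonneg hl (sub_nonneg.2 hr)]

theorem expKernel_nonneg (l b r : ℝ) : 0 ≤ expKernel l b r := (Real.exp_pos _).le

/-- The bound `min (1/(2λ)) (b-a)` for the variance `∫_a^b e^{-2λ(b-r)} dr`. -/
def convVar (l a b : ℝ) : ℝ := min (1 / (2 * l)) (b - a)

theorem convVar_nonneg {l a b : ℝ} (hl : 0 < l) (hab : a ≤ b) : 0 ≤ convVar l a b :=
  le_min (by positivity) (sub_nonneg.2 hab)

/-- The squared kernel increases in `r`, so left-endpoint sums lie below the integral and the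
variance bound holds for every partition, not only in the limit. -/
theorem sum_expKernel_sq_le {l a b : ℝ} (hl : 0 < l) (hab : a ≤ b) (k : ℕ) :
    ∑ j ∈ Finset.range k, expKernel l b (a + j * ((b - a) / k)) ^ 2 * ((b - a) / k) ≤
      convVar l a b := by
  rcases Nat.eq_zero_or_pos k with rfl | hk
  · simpa using convVar_nonneg hl hab
  have hkpos : 0 < (k : ℝ) := by exact_mod_cast hk
  set h := (b - a) / k with hh
  have hh0 : 0 ≤ h := div_nonneg (sub_nonneg.2 hab) hkpos.le
  have hkh : k * h = b - a := by rw [hh]; field_simp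
  refine le_min ?_ ?_
  -- From one node to the next the squared kernel gains the factor `e^{2lh} ≥ 1 + 2lh`, which makes
  -- the sum telescope.
  · have hstep : ∀ j : ℕ, expKernel l b (a + j * h) ^ 2 * h ≤
        1 / (2 * l) * (expKernel l b (a + (j + 1 : ℕ) * h) ^ 2 - expKernel l b (a + j * h) ^ 2) := by
      intro j
      have he : expKernel l b (a + (j + 1 : ℕ) * h) ^ 2 =
          expKernel l b (a + j * h) ^ 2 * Real.exp (2 * l * h) := by
        unfold expKernel
        rw [← Real.exp_nat_mul, ← Real.exp_nat_mul, ← Real.exp_add]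
        congr 1; push_cast; ring
      rw [he, div_mul_eq_mul_div, one_mul, le_div_iff₀ (by positivity)]
      have h1 := Real.add_one_le_exp (2 * l * h)
      nlinarith [sq_nonneg (expKernel l b (a + j * h))]
    refine (Finset.sum_le_sum fun j _ => hstep j).trans ?_
    rw [← Finset.mul_sum, Finset.sum_range_sub (fun j : ℕ => expKernel l b (a + j * h) ^ 2)]
    have h1 : expKernel l b (a + k * h) = 1 := by
      unfold expKernel; rw [hkh]; simp
    rw [h1]
    refine mul_le_of_le_one_right (by positivity) ?_
    nlinarith [sq_nonneg (expKernel l b (a + (0 : ℕ) * h))]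
  · calc ∑ j ∈ Finset.range k, expKernel l b (a + j * h) ^ 2 * h
        ≤ ∑ j ∈ Finset.range k, h := by
          refine Finset.sum_le_sum fun j hj => ?_
          have hj : (j : ℝ) ≤ k := by exact_mod_cast (Finset.mem_range.1 hj).le
          refine mul_le_of_le_one_left hh0 (pow_le_one₀ (expKernel_nonneg _ _ _) ?_)
          exact expKernel_le_one hl.le (by nlinarith)
      _ = b - a := by simp [hkh]

theorem measurable_itoSum (hW : IsCylindricalWiener P T ℱ B) (n : ℕ) (g : ℝ → ℝ) {a b : ℝ}
    (ha : 0 ≤ a) (hab : a ≤ b) (hb : b ≤ T) (k : ℕ) : Measurable (itoSum (B n) g a b k) := by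
  refine Finset.measurable_fun_sum _ fun j hj => ?_
  have hkpos : 0 < (k : ℝ) := by exact_mod_cast (Nat.zero_le j).trans_lt (Finset.mem_range.1 hj)
  have hh0 : 0 ≤ (b - a) / k := div_nonneg (sub_nonneg.2 hab) hkpos.le
  have hkh : k * ((b - a) / k) = b - a := by field_simp
  have hj : (j : ℝ) + 1 ≤ k := by exact_mod_cast Finset.mem_range.1 hj
  have hj0 : (0 : ℝ) ≤ j := Nat.cast_nonneg j
  refine ((hW.measurable n ⟨?_, ?_⟩).sub (hW.measurable n ⟨?_, ?_⟩)).const_mul _ <;> nlinarith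

/-- With the sums over modes and cells exchanged, the left side is a single centred Gaussian. The
bound is uniform in `k`, as Fatou and Vitali require below. -/
theorem eLpNorm_sum_itoSum_le [IsProbabilityMeasure P] (hW : IsCylindricalWiener P T ℱ B)
    (c : ℕ → ℝ) (N : ℕ) {a b : ℝ} (ha : 0 ≤ a) (hab : a ≤ b) (hb : b ≤ T) (k : ℕ) (q : ℝ≥0∞) :
    eLpNorm (fun ω => ∑ n ∈ Finset.range N,
        c n * itoSum (B n) (expKernel (eigenvalue n) b) a b k ω) q P ≤
      ENNReal.ofReal (√(∑ n ∈ Finset.range N, c n ^ 2 * convVar (eigenvalue n) a b)) *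
        gaussianMoment q := by
  set h := (b - a) / k with hh
  have hh0 : 0 ≤ h := div_nonneg (sub_nonneg.2 hab) (Nat.cast_nonneg k)
  set r : ℕ → ℝ := fun j => a + j * h with hr
  have hmono : Monotone r := fun i j hij => by
    have : (i : ℝ) ≤ j := by exact_mod_cast hij
    simp only [hr]; nlinarith
  have hrk : r k ≤ T := by
    rcases Nat.eq_zero_or_pos k with h0 | hk
    · simp only [hr, h0]; simp; linarith
    · have hkpos : 0 < (k : ℝ) := by exact_mod_cast hk
      have hkh : k * h = b - a := by rw [hh]; field_simp
      simp only [hr]; linarith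
  have hlaw := hW.map_sum_sum_increments
    (fun j n => c n * expKernel (eigenvalue n) b (r j)) N (r := r) (by simp [hr, ha]) hmono k hrk
  have hfun : (fun ω => ∑ n ∈ Finset.range N,
        c n * itoSum (B n) (expKernel (eigenvalue n) b) a b k ω) =
      fun ω => ∑ j ∈ Finset.range k, ∑ n ∈ Finset.range N,
        c n * expKernel (eigenvalue n) b (r j) * (B n (r (j + 1)) ω - B n (r j) ω) := by
    ext ω
    rw [Finset.sum_comm]
    refine Finset.sum_congr rfl fun n _ => ?_
    rw [itoSum, Finset.mul_sum]
    refine Finset.sum_congr rfl fun j _ => ?_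
    simp only [hr]; push_cast; ring
  have hmeas : AEMeasurable (fun ω => ∑ n ∈ Finset.range N,
        c n * itoSum (B n) (expKernel (eigenvalue n) b) a b k ω) P :=
    (Finset.measurable_fun_sum _ fun n _ =>
      (measurable_itoSum hW n _ ha hab hb k).const_mul _).aemeasurable
  rw [eLpNorm_of_map_eq_gaussianReal hmeas (by rw [hfun]; exact hlaw)]
  gcongr
  have hnn : ∀ n, 0 ≤ c n ^ 2 * convVar (eigenvalue n) a b := fun n =>
    mul_nonneg (sq_nonneg _) (convVar_nonneg (eigenvalue_pos n) hab)
  rw [Real.coe_toNNReal']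
  refine max_le ?_ (Finset.sum_nonneg fun n _ => hnn n)
  calc ∑ j ∈ Finset.range k, (∑ n ∈ Finset.range N, (c n * expKernel (eigenvalue n) b (r j)) ^ 2) *
        (r (j + 1) - r j)
      = ∑ n ∈ Finset.range N, c n ^ 2 *
          ∑ j ∈ Finset.range k, expKernel (eigenvalue n) b (a + j * h) ^ 2 * h := by
        simp_rw [Finset.sum_mul, Finset.mul_sum]
        rw [Finset.sum_comm]
        refine Finset.sum_congr rfl fun n _ => Finset.sum_congr rfl fun j _ => ?_
        simp only [hr]; push_cast; ring
    _ ≤ _ := Finset.sum_le_sum fun n _ => mul_le_mul_of_nonneg_left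
        (sum_expKernel_sq_le (eigenvalue_pos n) hab k) (sq_nonneg _)

/-- The Wiener integral `∫_a^b e^{-λ(b-r)} dβ(r)` defined pathwise. -/
def pathConv (l : ℝ) (β : ℝ → Ω → ℝ) (a b : ℝ) (ω : Ω) : ℝ :=
  pathIntegral (fun t => β t ω) (expKernel l b) (fun r => l * expKernel l b r) a b

theorem tendsto_itoSum (hW : IsCylindricalWiener P T ℱ B) (n : ℕ) (l : ℝ) {a b : ℝ}
    (ha : 0 ≤ a) (hab : a ≤ b) (hb : b ≤ T) :
    ∀ᵐ ω ∂P, Tendsto (fun k => itoSum (B n) (expKernel l b) a b k ω) atTop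
      (𝓝 (pathConv l (B n) a b ω)) := by
  filter_upwards [hW.continuous_paths n] with ω hω
  exact tendsto_sum_pathIntegral hab (hω.mono (Set.Icc_subset_Icc ha hb))
    (hasDerivAt_expKernel l b) ((continuous_expKernel l b).const_mul l)

theorem aestronglyMeasurable_pathConv (hW : IsCylindricalWiener P T ℱ B) (n : ℕ) (l : ℝ) {a b : ℝ}
    (ha : 0 ≤ a) (hab : a ≤ b) (hb : b ≤ T) : AEStronglyMeasurable (pathConv l (B n) a b) P :=
  aestronglyMeasurable_of_tendsto_ae atTop
    (fun k => (measurable_itoSum hW n _ ha hab hb k).aestronglyMeasurable)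
    (tendsto_itoSum hW n l ha hab hb)

/-- Fatou's lemma along the almost surely convergent left-endpoint sums. -/
theorem eLpNorm_sum_pathConv_le [IsProbabilityMeasure P] (hW : IsCylindricalWiener P T ℱ B)
    (c : ℕ → ℝ) (N : ℕ) {a b : ℝ} (ha : 0 ≤ a) (hab : a ≤ b) (hb : b ≤ T) (q : ℝ≥0∞) :
    eLpNorm (fun ω => ∑ n ∈ Finset.range N, c n * pathConv (eigenvalue n) (B n) a b ω) q P ≤
      ENNReal.ofReal (√(∑ n ∈ Finset.range N, c n ^ 2 * convVar (eigenvalue n) a b)) *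
        gaussianMoment q := by
  refine Lp.eLpNorm_le_of_ae_tendsto (u := atTop)
    (Eventually.of_forall fun k => eLpNorm_sum_itoSum_le hW c N ha hab hb k q)
    (fun k => (Finset.measurable_fun_sum _ fun n _ =>
      (measurable_itoSum hW n _ ha hab hb k).const_mul _).aestronglyMeasurable) ?_
  filter_upwards [ae_all_iff.2 fun n => tendsto_itoSum hW n (eigenvalue n) ha hab hb] with ω hω
  exact tendsto_finsetSum _ fun n _ => (hω n).const_mul _

theorem eLpNorm_pathConv_le [IsProbabilityMeasure P] (hW : IsCylindricalWiener P T ℱ B)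
    (n : ℕ) {a b : ℝ} (ha : 0 ≤ a) (hab : a ≤ b) (hb : b ≤ T) (q : ℝ≥0∞) :
    eLpNorm (pathConv (eigenvalue n) (B n) a b) q P ≤
      ENNReal.ofReal (√(convVar (eigenvalue n) a b)) * gaussianMoment q := by
  simpa using eLpNorm_sum_pathConv_le hW (fun i => if i = n then 1 else 0) (n + 1) ha hab hb q

/-- Vitali's theorem: the sums converge almost surely, and their `L⁴` norms are bounded uniformly in
`k`, so they converge in `L²`. -/
theorem isWienerIntegral_pathConv [IsProbabilityMeasure P] (hW : IsCylindricalWiener P T ℱ B)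
    (n : ℕ) {a b : ℝ} (ha : 0 ≤ a) (hab : a ≤ b) (hb : b ≤ T) :
    IsWienerIntegral P (B n) (expKernel (eigenvalue n) b) a b
      (pathConv (eigenvalue n) (B n) a b) := by
  have hfin : ∀ q : ℝ≥0∞, q ≠ ∞ →
      ENNReal.ofReal (√(convVar (eigenvalue n) a b)) * gaussianMoment q ≠ ∞ := fun q hq =>
    ENNReal.mul_ne_top ENNReal.ofReal_ne_top (gaussianMoment_lt_top hq).ne
  have hmem : MemLp (pathConv (eigenvalue n) (B n) a b) 2 P :=
    ⟨aestronglyMeasurable_pathConv hW n _ ha hab hb,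
      (eLpNorm_pathConv_le hW n ha hab hb 2).trans_lt (hfin 2 (by norm_num)).lt_top⟩
  have hmeas := fun k => (measurable_itoSum hW n (expKernel (eigenvalue n) b) ha hab hb
    k).aestronglyMeasurable (μ := P)
  refine ⟨hmem, tendsto_Lp_finite_of_tendsto_ae (by norm_num) (by norm_num) hmeas hmem ?_
    (tendsto_itoSum hW n _ ha hab hb)⟩
  refine unifIntegrable_two_of_eLpNorm_four_le hmeas (hfin 4 (by norm_num)) fun k => ?_
  simpa using eLpNorm_sum_itoSum_le hW (fun i => if i = n then 1 else 0) (n + 1) ha hab hb k 4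

/-- Limits in measure are unique up to null events, so the version selected by choice agrees almost
surely with any explicit one. -/
theorem wienerIntegral_ae_eq {β : ℝ → Ω → ℝ} {g : ℝ → ℝ} {a b : ℝ} {I : Ω → ℝ}
    (hmeas : ∀ k, AEStronglyMeasurable (itoSum β g a b k) P)
    (hI : IsWienerIntegral P β g a b I) : wienerIntegral P β g a b =ᵐ[P] I := by
  have hex : ∃ I, IsWienerIntegral P β g a b I := ⟨I, hI⟩
  have hJ : IsWienerIntegral P β g a b (wienerIntegral P β g a b) := by
    rw [wienerIntegral, dif_pos hex]; exact hex.choose_spec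
  exact tendstoInMeasure_ae_unique
    (tendstoInMeasure_of_tendsto_eLpNorm (by norm_num) hmeas hJ.1.1 hJ.2)
    (tendstoInMeasure_of_tendsto_eLpNorm (by norm_num) hmeas hI.1.1 hI.2)

/-- The `n`-th coefficient of the stochastic convolution over `[a,b]`. -/
def noiseCoef (P : Measure Ω) (B : ℕ → ℝ → Ω → ℝ) (n : ℕ) (a b : ℝ) : Ω → ℝ :=
  wienerIntegral P (B n) (fun r => Real.exp (-(eigenvalue n * (b - r)))) a b

theorem noiseCoef_ae_eq [IsProbabilityMeasure P] (hW : IsCylindricalWiener P T ℱ B)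
    (n : ℕ) {a b : ℝ} (ha : 0 ≤ a) (hab : a ≤ b) (hb : b ≤ T) :
    noiseCoef P B n a b =ᵐ[P] pathConv (eigenvalue n) (B n) a b :=
  wienerIntegral_ae_eq (fun k => (measurable_itoSum hW n _ ha hab hb k).aestronglyMeasurable)
    (isWienerIntegral_pathConv hW n ha hab hb)

theorem eLpNorm_sum_noiseCoef_le [IsProbabilityMeasure P] (hW : IsCylindricalWiener P T ℱ B)
    (c : ℕ → ℝ) (N : ℕ) {a b : ℝ} (ha : 0 ≤ a) (hab : a ≤ b) (hb : b ≤ T) (q : ℝ≥0∞) :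
    eLpNorm (fun ω => ∑ n ∈ Finset.range N, c n * noiseCoef P B n a b ω) q P ≤
      ENNReal.ofReal (√(∑ n ∈ Finset.range N, c n ^ 2 * convVar (eigenvalue n) a b)) *
        gaussianMoment q := by
  refine le_of_eq_of_le (eLpNorm_congr_ae ?_) (eLpNorm_sum_pathConv_le hW c N ha hab hb q)
  filter_upwards [ae_all_iff.2 fun n => noiseCoef_ae_eq hW n ha hab hb] with ω hω
  exact Finset.sum_congr rfl fun n _ => by rw [hω n]

theorem eLpNorm_noiseCoef_le [IsProbabilityMeasure P] (hW : IsCylindricalWiener P T ℱ B)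
    (n : ℕ) {a b : ℝ} (ha : 0 ≤ a) (hab : a ≤ b) (hb : b ≤ T) (q : ℝ≥0∞) :
    eLpNorm (noiseCoef P B n a b) q P ≤
      ENNReal.ofReal (√(convVar (eigenvalue n) a b)) * gaussianMoment q :=
  (eLpNorm_congr_ae (noiseCoef_ae_eq hW n ha hab hb)).trans_le
    (eLpNorm_pathConv_le hW n ha hab hb q)

theorem aestronglyMeasurable_noiseCoef (n : ℕ) (a b : ℝ) :
    AEStronglyMeasurable (noiseCoef P B n a b) P := by
  unfold noiseCoef wienerIntegral
  split_ifs with h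
  · exact h.choose_spec.1.1
  · exact aestronglyMeasurable_zero

theorem expKernel_trans (l s t r : ℝ) :
    expKernel l t r = Real.exp (-(l * (t - s))) * expKernel l s r := by
  unfold expKernel; rw [← Real.exp_add]; congr 1; ring

/-- The flow property of the stochastic convolution. -/
theorem noiseCoef_trans [IsProbabilityMeasure P] (hW : IsCylindricalWiener P T ℱ B)
    (n : ℕ) {a s t : ℝ} (ha : 0 ≤ a) (has : a ≤ s) (hst : s ≤ t) (ht : t ≤ T) :
    noiseCoef P B n a t =ᵐ[P] fun ω =>
      Real.exp (-(eigenvalue n * (t - s))) * noiseCoef P B n a s ω + noiseCoef P B n s t ω := by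
  filter_upwards [noiseCoef_ae_eq hW n ha (has.trans hst) ht,
    noiseCoef_ae_eq hW n ha has (hst.trans ht), noiseCoef_ae_eq hW n (ha.trans has) hst ht,
    hW.continuous_paths n] with ω h1 h2 h3 hc
  rw [h1, h2, h3]
  set l := eigenvalue n
  have hint : ∀ u v, a ≤ u → u ≤ v → v ≤ t →
      IntervalIntegrable (fun r => B n r ω * (l * expKernel l t r)) volume u v := fun u v hu huv hv =>
    ((hc.mono (Set.Icc_subset_Icc (ha.trans hu) (hv.trans ht))).mul
      ((continuous_expKernel l t).const_mul l).continuousOn).intervalIntegrable_of_Icc huv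
  have hI : ∫ r in a..s, B n r ω * (l * expKernel l t r) =
      Real.exp (-(l * (t - s))) * ∫ r in a..s, B n r ω * (l * expKernel l s r) := by
    rw [← intervalIntegral.integral_const_mul]
    congr 1; ext r; rw [expKernel_trans l s t r]; ring
  simp only [pathConv, pathIntegral]
  rw [← intervalIntegral.integral_add_adjacent_intervals (hint a s le_rfl has hst)
    (hint s t has hst le_rfl), hI, expKernel_trans l s t a, expKernel_trans l s t s]
  ring

end WienerIntegral

/-! ### Sine polynomials -/

section SinePolynomials

instance : IsProbabilityMeasure μD := ⟨by simp [μD]⟩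

theorem integrable_of_continuous {f : ℝ → ℝ} (hf : Continuous f) : Integrable f μD :=
  (hf.continuousOn.integrableOn_compact isCompact_Icc).mono_set Set.Ioo_subset_Icc_self

theorem integral_μD (f : ℝ → ℝ) : ∫ x, f x ∂μD = ∫ x in (0 : ℝ)..1, f x := by
  rw [intervalIntegral.integral_of_le zero_le_one, integral_Ioc_eq_integral_Ioo]

@[fun_prop]
theorem continuous_eigenfunction (n : ℕ) : Continuous (eigenfunction n) := by
  unfold eigenfunction; fun_prop

theorem abs_eigenfunction_le (n : ℕ) (x : ℝ) : |eigenfunction n x| ≤ √2 := by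
  rw [eigenfunction, abs_mul, abs_of_nonneg (Real.sqrt_nonneg 2)]
  exact mul_le_of_le_one_right (Real.sqrt_nonneg 2) (Real.abs_sin_le_one _)

theorem eigenfunction_sq_le (n : ℕ) (x : ℝ) : eigenfunction n x ^ 2 ≤ 2 := by
  have := pow_le_pow_left₀ (abs_nonneg _) (abs_eigenfunction_le n x) 2
  rwa [sq_abs, Real.sq_sqrt (by norm_num)] at this

theorem integral_cos_int_mul_pi (k : ℤ) :
    ∫ x in (0 : ℝ)..1, Real.cos (k * Real.pi * x) = if k = 0 then 1 else 0 := by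
  split_ifs with hk
  · simp [hk]
  · have h : (k : ℝ) * Real.pi ≠ 0 := mul_ne_zero (by exact_mod_cast hk) Real.pi_ne_zero
    rw [intervalIntegral.integral_comp_mul_left (fun x => Real.cos x) h]
    simp [Real.sin_int_mul_pi]

theorem integral_eigenfunction_mul (n m : ℕ) :
    ∫ x, eigenfunction n x * eigenfunction m x ∂μD = if n = m then 1 else 0 := by
  have h : ∀ x, eigenfunction n x * eigenfunction m x =
      Real.cos (((n : ℤ) - m : ℤ) * Real.pi * x) -
        Real.cos (((n : ℤ) + m + 2 : ℤ) * Real.pi * x) := by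
    intro x
    have h1 : (((n : ℤ) - m : ℤ) : ℝ) * Real.pi * x =
        (n + 1) * Real.pi * x - (m + 1) * Real.pi * x := by push_cast; ring
    have h2 : (((n : ℤ) + m + 2 : ℤ) : ℝ) * Real.pi * x =
        (n + 1) * Real.pi * x + (m + 1) * Real.pi * x := by push_cast; ring
    rw [h1, h2, Real.cos_sub, Real.cos_add, eigenfunction, eigenfunction]
    have := Real.mul_self_sqrt (show (0 : ℝ) ≤ 2 by norm_num)
    linear_combination Real.sin ((n + 1) * Real.pi * x) * Real.sin ((m + 1) * Real.pi * x) * this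
  have hc : ∀ k : ℤ, IntervalIntegrable (fun x => Real.cos (k * Real.pi * x)) volume 0 1 :=
    fun k => Continuous.intervalIntegrable (by fun_prop) _ _
  rw [integral_μD, funext h, intervalIntegral.integral_sub (hc _) (hc _), integral_cos_int_mul_pi,
    integral_cos_int_mul_pi, if_neg (show ¬((n : ℤ) + m + 2 = 0) by omega), sub_zero]
  exact if_congr (by omega) rfl rfl

/-- The sine polynomial `∑_{n < N} c_n e_n`. -/
def sinePoly (N : ℕ) (c : ℕ → ℝ) (x : ℝ) : ℝ := ∑ n ∈ Finset.range N, c n * eigenfunction n x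

@[fun_prop]
theorem continuous_sinePoly (N : ℕ) (c : ℕ → ℝ) : Continuous (sinePoly N c) := by
  unfold sinePoly; fun_prop

theorem sinePoly_add (N : ℕ) (c d : ℕ → ℝ) (x : ℝ) :
    sinePoly N (fun n => c n + d n) x = sinePoly N c x + sinePoly N d x := by
  simp [sinePoly, add_mul, Finset.sum_add_distrib]

theorem sinePoly_sq_le (N : ℕ) (c : ℕ → ℝ) (x : ℝ) :
    sinePoly N c x ^ 2 ≤ 2 * (∑ n ∈ Finset.range N, |c n|) ^ 2 := by
  have h : |sinePoly N c x| ≤ √2 * ∑ n ∈ Finset.range N, |c n| := by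
    rw [Finset.mul_sum]
    refine (Finset.abs_sum_le_sum_abs _ _).trans (Finset.sum_le_sum fun n _ => ?_)
    rw [abs_mul, mul_comm]
    exact mul_le_mul_of_nonneg_right (abs_eigenfunction_le n x) (abs_nonneg _)
  have := pow_le_pow_left₀ (abs_nonneg _) h 2
  rwa [sq_abs, mul_pow, Real.sq_sqrt (by norm_num)] at this

theorem integral_mul_sinePoly {h : ℝ → ℝ} (hh : Continuous h) (N : ℕ) (c : ℕ → ℝ) :
    ∫ x, h x * sinePoly N c x ∂μD =
      ∑ n ∈ Finset.range N, c n * ∫ x, h x * eigenfunction n x ∂μD := by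
  simp_rw [sinePoly, Finset.mul_sum]
  rw [integral_finsetSum _ fun n _ => integrable_of_continuous (by fun_prop)]
  refine Finset.sum_congr rfl fun n _ => ?_
  rw [← integral_const_mul]
  congr 1; ext x; ring

theorem integral_sinePoly_mul_eigenfunction (N : ℕ) (c : ℕ → ℝ) {n : ℕ} (hn : n < N) :
    ∫ x, sinePoly N c x * eigenfunction n x ∂μD = c n := by
  simp_rw [mul_comm (sinePoly N c _)]
  rw [integral_mul_sinePoly (continuous_eigenfunction n)]
  simp [integral_eigenfunction_mul, hn]

theorem integral_sinePoly_sq (N : ℕ) (c : ℕ → ℝ) :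
    ∫ x, sinePoly N c x ^ 2 ∂μD = ∑ n ∈ Finset.range N, c n ^ 2 := by
  simp_rw [sq (sinePoly N c _)]
  rw [integral_mul_sinePoly (continuous_sinePoly N c)]
  refine Finset.sum_congr rfl fun n hn => ?_
  rw [integral_sinePoly_mul_eigenfunction N c (Finset.mem_range.1 hn), sq]

/-- Bessel's inequality. -/
theorem sum_sq_integral_mul_eigenfunction_le {h : ℝ → ℝ} (hh : Continuous h) (N : ℕ) :
    ∑ n ∈ Finset.range N, (∫ x, h x * eigenfunction n x ∂μD) ^ 2 ≤ ∫ x, h x ^ 2 ∂μD := by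
  set c : ℕ → ℝ := fun n => ∫ x, h x * eigenfunction n x ∂μD with hc
  have h1 : 0 ≤ ∫ x, (h x - sinePoly N c x) ^ 2 ∂μD := integral_nonneg fun x => sq_nonneg _
  have h2 : ∀ x, (h x - sinePoly N c x) ^ 2 =
      h x ^ 2 + sinePoly N c x ^ 2 - 2 * (h x * sinePoly N c x) := fun x => by ring
  rw [funext h2, integral_sub (integrable_of_continuous (by fun_prop))
    (integrable_of_continuous (by fun_prop)), integral_add (integrable_of_continuous (by fun_prop))
    (integrable_of_continuous (by fun_prop)), integral_const_mul, integral_sinePoly_sq,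
    integral_mul_sinePoly hh] at h1
  have h3 : ∑ n ∈ Finset.range N, c n * (∫ x, h x * eigenfunction n x ∂μD) =
      ∑ n ∈ Finset.range N, c n ^ 2 := Finset.sum_congr rfl fun n _ => by rw [sq]
  rw [h3] at h1
  linarith

theorem sq_integral_le {h : ℝ → ℝ} (hh : Continuous h) :
    (∫ x, h x ∂μD) ^ 2 ≤ ∫ x, h x ^ 2 ∂μD := by
  set m := ∫ x, h x ∂μD
  have h1 : 0 ≤ ∫ x, (h x - m) ^ 2 ∂μD := integral_nonneg fun x => sq_nonneg _
  have h2 : ∀ x, (h x - m) ^ 2 = h x ^ 2 + m ^ 2 - 2 * m * h x := fun x => by ring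
  rw [funext h2, integral_sub (integrable_of_continuous (by fun_prop))
    (integrable_of_continuous (by fun_prop)), integral_add (integrable_of_continuous (by fun_prop))
    (integrable_of_continuous (by fun_prop)), integral_const_mul] at h1
  simp only [integral_const, probReal_univ, smul_eq_mul, one_mul] at h1
  change 0 ≤ _ + m ^ 2 - 2 * m * m at h1
  nlinarith

theorem le_eigenvalue (n : ℕ) : ((n : ℝ) + 1) ^ 2 ≤ eigenvalue n := by
  unfold eigenvalue
  have h : (1 : ℝ) ≤ Real.pi ^ 2 := by nlinarith [Real.pi_gt_three]
  nlinarith [sq_nonneg ((n : ℝ) + 1)]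

theorem one_le_eigenvalue (n : ℕ) : 1 ≤ eigenvalue n := by
  have := le_eigenvalue n
  have : (0 : ℝ) ≤ n := Nat.cast_nonneg n
  nlinarith

/-- Comparison with `∑ (n + 1)^{2s}`. This threshold is the source of the restriction `|β| < 1/2`,
through the exponent `|β| - 1`. -/
theorem summable_eigenvalue_rpow {s : ℝ} (hs : s < -(1 / 2)) :
    Summable fun n => eigenvalue n ^ s := by
  have h : Summable fun n : ℕ => ((n + 1 : ℕ) : ℝ) ^ (2 * s) :=
    (summable_nat_add_iff 1).2 (Real.summable_nat_rpow.2 (by linarith))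
  refine h.of_nonneg_of_le (fun n => Real.rpow_nonneg (eigenvalue_pos n).le _) fun n => ?_
  have h1 : (0 : ℝ) < (n : ℝ) + 1 := by positivity
  rw [Real.rpow_mul (by positivity), Real.rpow_two]
  push_cast
  exact Real.rpow_le_rpow_of_nonpos (by positivity) (le_eigenvalue n) (by linarith)

/-- Squared norm of a sine polynomial in `H`. -/
def normSq (N : ℕ) (c : ℕ → ℝ) : ℝ := ∑ n ∈ Finset.range N, c n ^ 2

/-- Squared norm of a sine polynomial in `Ḣ¹`. -/
def gradSq (N : ℕ) (c : ℕ → ℝ) : ℝ := ∑ n ∈ Finset.range N, eigenvalue n * c n ^ 2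

theorem normSq_nonneg (N : ℕ) (c : ℕ → ℝ) : 0 ≤ normSq N c :=
  Finset.sum_nonneg fun _ _ => sq_nonneg _

theorem gradSq_nonneg (N : ℕ) (c : ℕ → ℝ) : 0 ≤ gradSq N c :=
  Finset.sum_nonneg fun n _ => mul_nonneg (eigenvalue_pos n).le (sq_nonneg _)

theorem normSq_le_gradSq (N : ℕ) (c : ℕ → ℝ) : normSq N c ≤ gradSq N c :=
  Finset.sum_le_sum fun n _ => le_mul_of_one_le_left (sq_nonneg _) (one_le_eigenvalue n)

/-- With `y = x^{1/4}`: if `εy ≥ 1` then `y³ ≤ εy⁴`, and otherwise `y³ ≤ ε⁻³`. -/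
theorem rpow_three_quarters_le {x ε : ℝ} (hx : 0 < x) (hε : 0 < ε) :
    x ^ (3 / 4 : ℝ) ≤ ε * x + (ε ^ 3)⁻¹ := by
  set y := x ^ (1 / 4 : ℝ) with hy
  have hy0 : 0 < y := Real.rpow_pos_of_pos hx _
  have h4 : y ^ 4 = x := by
    rw [hy, ← Real.rpow_natCast, ← Real.rpow_mul hx.le]; norm_num
  have h3 : x ^ (3 / 4 : ℝ) = y ^ 3 := by
    rw [hy, ← Real.rpow_natCast, ← Real.rpow_mul hx.le]; norm_num
  rw [h3, ← h4]
  rcases le_total (ε * y) 1 with h | h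
  · have : y ^ 3 ≤ (ε ^ 3)⁻¹ := by
      rw [← inv_pow]
      refine pow_le_pow_left₀ hy0.le ?_ 3
      rw [← one_div, le_div_iff₀ hε]; linarith
    have : 0 ≤ ε * y ^ 4 := by positivity
    linarith
  · have h1 : y ^ 3 ≤ ε * y ^ 4 := by
      have := mul_le_mul_of_nonneg_right h (pow_nonneg hy0.le 3)
      linarith [show ε * y * y ^ 3 = ε * y ^ 4 by ring]
    have : 0 ≤ (ε ^ 3)⁻¹ := by positivity
    linarith

/-- Interpolation between the sup norm and the norms of `H` and `Ḣ¹`, with arbitrarily small weight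
on the latter. -/
theorem exists_sq_sum_abs_le {ε : ℝ} (hε : 0 < ε) : ∃ C, 0 ≤ C ∧ ∀ (N : ℕ) (c : ℕ → ℝ),
    2 * (∑ n ∈ Finset.range N, |c n|) ^ 2 ≤ ε * gradSq N c + C * normSq N c := by
  have hs := summable_eigenvalue_rpow (s := -(3 / 4)) (by norm_num)
  set A := ∑' n, eigenvalue n ^ (-(3 / 4) : ℝ) with hA
  have hA0 : 0 ≤ A := tsum_nonneg fun n => Real.rpow_nonneg (eigenvalue_pos n).le _
  set δ := ε / (2 * A + 1) with hδ
  have hδ0 : 0 < δ := by positivity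
  refine ⟨2 * A * (δ ^ 3)⁻¹, by positivity, fun N c => ?_⟩
  -- Cauchy-Schwarz with the weights `λ^{∓3/4}`: `-3/4` lies below the summability threshold `-1/2`,
  -- while `3/4 < 1` leaves room for a small factor in front of `gradSq`.
  have h1 : (∑ n ∈ Finset.range N, |c n|) ^ 2 ≤
      (∑ n ∈ Finset.range N, eigenvalue n ^ (-(3 / 4) : ℝ)) *
        ∑ n ∈ Finset.range N, eigenvalue n ^ (3 / 4 : ℝ) * c n ^ 2 := by
    refine Finset.sum_sq_le_sum_mul_sum_of_sq_le_mul _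
      (fun n _ => Real.rpow_nonneg (eigenvalue_pos n).le _)
      (fun n _ => mul_nonneg (Real.rpow_nonneg (eigenvalue_pos n).le _) (sq_nonneg _))
      fun n _ => ?_
    rw [sq_abs, ← mul_assoc, ← Real.rpow_add (eigenvalue_pos n)]
    simp
  have h2 : ∑ n ∈ Finset.range N, eigenvalue n ^ (-(3 / 4) : ℝ) ≤ A :=
    hs.sum_le_tsum _ fun n _ => Real.rpow_nonneg (eigenvalue_pos n).le _
  have h3 : ∑ n ∈ Finset.range N, eigenvalue n ^ (3 / 4 : ℝ) * c n ^ 2 ≤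
      δ * gradSq N c + (δ ^ 3)⁻¹ * normSq N c := by
    rw [gradSq, normSq, Finset.mul_sum, Finset.mul_sum, ← Finset.sum_add_distrib]
    refine Finset.sum_le_sum fun n _ => ?_
    have := mul_le_mul_of_nonneg_right (rpow_three_quarters_le (eigenvalue_pos n) hδ0)
      (sq_nonneg (c n))
    linarith
  have h4 : (∑ n ∈ Finset.range N, |c n|) ^ 2 ≤ A * (δ * gradSq N c + (δ ^ 3)⁻¹ * normSq N c) :=
    h1.trans (mul_le_mul h2 h3 (Finset.sum_nonneg fun n _ =>
      mul_nonneg (Real.rpow_nonneg (eigenvalue_pos n).le _) (sq_nonneg _)) hA0)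
  have h5 : 2 * A * δ ≤ ε := by
    rw [hδ, mul_div_assoc', div_le_iff₀ (by positivity)]; nlinarith
  have h6 := mul_le_mul_of_nonneg_right h5 (gradSq_nonneg N c)
  linarith

theorem exists_sq_sum_abs_le_gradSq : ∃ C, 0 ≤ C ∧ ∀ (N : ℕ) (c : ℕ → ℝ),
    2 * (∑ n ∈ Finset.range N, |c n|) ^ 2 ≤ C * gradSq N c := by
  obtain ⟨C, hC, h⟩ := exists_sq_sum_abs_le zero_lt_one
  refine ⟨1 + C, by linarith, fun N c => (h N c).trans ?_⟩
  have := mul_le_mul_of_nonneg_left (normSq_le_gradSq N c) hC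
  linarith

end SinePolynomials

/-! ### The energy estimate for the tamed scheme -/

section Energy

theorem continuous_cubic (a₀ a₁ a₂ a₃ : ℝ) : Continuous (cubic a₀ a₁ a₂ a₃) := by
  unfold cubic; fun_prop

theorem abs_cubic_add_le (a₀ a₁ a₂ a₃ : ℝ) : ∃ C, 0 ≤ C ∧ ∀ z o : ℝ,
    |cubic a₀ a₁ a₂ a₃ (z + o)| ≤ C * (1 + |z| ^ 3 + |o| ^ 3) := by
  -- With `m = max(|z|, |o|, 1)` every power `|z + o|^i`, `i ≤ 3`, is at most `(2m)³ = 8m³`.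
  refine ⟨8 * (|a₃| + |a₂| + |a₁| + |a₀|), by positivity, fun z o => ?_⟩
  set m := max (max |z| |o|) 1 with hm
  have hz : |z| ≤ m := (le_max_left _ _).trans (le_max_left _ _)
  have ho : |o| ≤ m := (le_max_right _ _).trans (le_max_left _ _)
  have h1 : 1 ≤ m := le_max_right _ _
  have hs : |z + o| ≤ 2 * m := (abs_add_le z o).trans (by linarith)
  have hm3 : m ^ 3 ≤ 1 + |z| ^ 3 + |o| ^ 3 := by
    have := pow_nonneg (abs_nonneg z) 3
    have := pow_nonneg (abs_nonneg o) 3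
    rcases max_choice (max |z| |o|) 1 with h | h <;> rw [hm, h]
    · rcases max_choice |z| |o| with h | h <;> rw [h] <;> linarith
    · linarith
  have hp : ∀ i, i ≤ 3 → |z + o| ^ i ≤ 8 * m ^ 3 := fun i hi =>
    calc |z + o| ^ i ≤ (2 * m) ^ i := pow_le_pow_left₀ (abs_nonneg _) hs i
      _ ≤ (2 * m) ^ 3 := pow_le_pow_right₀ (by linarith) hi
      _ = 8 * m ^ 3 := by ring
  have h3 := mul_le_mul_of_nonneg_left (hp 3 (by norm_num)) (abs_nonneg a₃)
  have h2 := mul_le_mul_of_nonneg_left (hp 2 (by norm_num)) (abs_nonneg a₂)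
  have h1 := mul_le_mul_of_nonneg_left (hp 1 (by norm_num)) (abs_nonneg a₁)
  have h0 := mul_le_mul_of_nonneg_left (hp 0 (by norm_num)) (abs_nonneg a₀)
  rw [pow_one] at h1
  rw [pow_zero, mul_one] at h0
  have hc : |cubic a₀ a₁ a₂ a₃ (z + o)| ≤
      |a₃| * |z + o| ^ 3 + |a₂| * |z + o| ^ 2 + |a₁| * |z + o| + |a₀| := by
    unfold cubic
    refine (abs_add_le _ _).trans (add_le_add_left ((abs_add_le _ _).trans ?_) _)
    refine add_le_add ((abs_add_le _ _).trans ?_) (abs_mul _ _).le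
    rw [abs_mul, abs_mul, abs_pow, abs_pow]
  have hA : 0 ≤ 8 * (|a₃| + |a₂| + |a₁| + |a₀|) := by positivity
  have := mul_le_mul_of_nonneg_left hm3 hA
  linarith

theorem cubic_add_sq_le (a₀ a₁ a₂ a₃ : ℝ) : ∃ C, 0 ≤ C ∧ ∀ z o : ℝ,
    cubic a₀ a₁ a₂ a₃ (z + o) ^ 2 ≤ C * (1 + z ^ 6 + o ^ 6) := by
  obtain ⟨C, hC, h⟩ := abs_cubic_add_le a₀ a₁ a₂ a₃
  refine ⟨3 * C ^ 2, by positivity, fun z o => ?_⟩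
  have h1 := pow_le_pow_left₀ (abs_nonneg _) (h z o) 2
  rw [sq_abs, mul_pow] at h1
  have h2 : (1 + |z| ^ 3 + |o| ^ 3) ^ 2 ≤ 3 * (1 + (|z| ^ 3) ^ 2 + (|o| ^ 3) ^ 2) := by
    nlinarith [sq_nonneg (1 - |z| ^ 3), sq_nonneg (1 - |o| ^ 3), sq_nonneg (|z| ^ 3 - |o| ^ 3)]
  have hz : (|z| ^ 3) ^ 2 = z ^ 6 := by rw [← pow_mul, pow_mul |z| 2 3, sq_abs]; ring
  have ho : (|o| ^ 3) ^ 2 = o ^ 6 := by rw [← pow_mul, pow_mul |o| 2 3, sq_abs]; ring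
  rw [hz, ho] at h2
  have := mul_le_mul_of_nonneg_left h2 (sq_nonneg C)
  linarith

/-- Once `2a₃z⁴` is removed, each quartic term left carries a factor `o`, bounded by `w`, and the
other terms have total degree at most three. With `m` dominating `|z|` and `|o|`, everything is of
size `w m³`. -/
theorem cubic_add_mul_sub_le (a₀ a₁ a₂ a₃ : ℝ) {z o w m : ℝ} (hw1 : 1 ≤ w) (hwm : w ≤ m)
    (hom : |o| ≤ w) (hzm : |z| ≤ m) :
    2 * (cubic a₀ a₁ a₂ a₃ (z + o) * z) - 2 * a₃ * z ^ 4 ≤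
      48 * (1 + |a₃| + |a₂| + |a₁| + |a₀|) * (w * m ^ 3) := by
  have hm1 : 1 ≤ m := hw1.trans hwm
  have hm0 : 0 ≤ m := by linarith
  have e : 2 * (cubic a₀ a₁ a₂ a₃ (z + o) * z) - 2 * a₃ * z ^ 4 =
      a₃ * (2 * (o * (3 * z ^ 3 + 3 * z ^ 2 * o + z * o ^ 2))) + a₂ * (2 * ((z + o) ^ 2 * z))
        + a₁ * (2 * ((z + o) * z)) + a₀ * (2 * z) := by
    unfold cubic; ring
  have hom' : |o| ≤ m := hom.trans hwm
  have hzo : |z + o| ≤ 2 * m := (abs_add_le _ _).trans (by linarith)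
  have hm23 : m ^ 2 ≤ m ^ 3 := pow_le_pow_right₀ hm1 (by norm_num)
  have hm13 : m ≤ m ^ 3 := le_self_pow₀ hm1 (by norm_num)
  have hm3 : 0 ≤ m ^ 3 := by positivity
  have hwm3 : m ^ 3 ≤ w * m ^ 3 := le_mul_of_one_le_left hm3 hw1
  have b3 : |2 * (o * (3 * z ^ 3 + 3 * z ^ 2 * o + z * o ^ 2))| ≤ 14 * (w * m ^ 3) := by
    have : |3 * z ^ 3 + 3 * z ^ 2 * o + z * o ^ 2| ≤ 7 * m ^ 3 := by
      refine (abs_add_three _ _ _).trans ?_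
      simp only [abs_mul, abs_pow, Nat.abs_ofNat]
      have t1 : |z| ^ 3 ≤ m ^ 3 := pow_le_pow_left₀ (abs_nonneg _) hzm 3
      have t2 : |z| ^ 2 * |o| ≤ m ^ 2 * m :=
        mul_le_mul (pow_le_pow_left₀ (abs_nonneg _) hzm 2) hom' (abs_nonneg _) (by positivity)
      have t3 : |z| * |o| ^ 2 ≤ m * m ^ 2 :=
        mul_le_mul hzm (pow_le_pow_left₀ (abs_nonneg _) hom' 2) (by positivity) hm0
      nlinarith
    rw [abs_mul, abs_mul, Nat.abs_ofNat]
    have := mul_le_mul hom this (abs_nonneg _) (by linarith)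
    linarith
  have b2 : |2 * ((z + o) ^ 2 * z)| ≤ 8 * m ^ 3 := by
    rw [abs_mul, abs_mul, abs_pow, Nat.abs_ofNat]
    have := mul_le_mul (pow_le_pow_left₀ (abs_nonneg _) hzo 2) hzm (abs_nonneg _) (by positivity)
    nlinarith
  have b1 : |2 * ((z + o) * z)| ≤ 4 * m ^ 3 := by
    rw [abs_mul, abs_mul, Nat.abs_ofNat]
    have := mul_le_mul hzo hzm (abs_nonneg _) (by positivity)
    nlinarith
  have b0 : |2 * z| ≤ 2 * m ^ 3 := by
    rw [abs_mul, Nat.abs_ofNat]; linarith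
  have key : ∀ a x c : ℝ, |x| ≤ c → a * x ≤ |a| * c := fun a x c h =>
    (le_abs_self _).trans (by rw [abs_mul]; exact mul_le_mul_of_nonneg_left h (abs_nonneg a))
  rw [e]
  have r3 := key a₃ _ _ (b3.trans (show 14 * (w * m ^ 3) ≤ 48 * (w * m ^ 3) by linarith))
  have r2 := key a₂ _ _ (b2.trans (show 8 * m ^ 3 ≤ 48 * (w * m ^ 3) by linarith))
  have r1 := key a₁ _ _ (b1.trans (show 4 * m ^ 3 ≤ 48 * (w * m ^ 3) by linarith))
  have r0 := key a₀ _ _ (b0.trans (show 2 * m ^ 3 ≤ 48 * (w * m ^ 3) by linarith))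
  have : 0 ≤ 48 * (w * m ^ 3) := by positivity
  have e' : 48 * (1 + |a₃| + |a₂| + |a₁| + |a₀|) * (w * m ^ 3) = 48 * (w * m ^ 3) + |a₃| * (48 * (w * m ^ 3)) +
      |a₂| * (48 * (w * m ^ 3)) + |a₁| * (48 * (w * m ^ 3)) + |a₀| * (48 * (w * m ^ 3)) := by
    ring
  linarith

/-- One-sided growth of the cubic: the leading coefficient dissipates. -/
theorem cubic_add_mul_le (a₀ a₁ a₂ : ℝ) {a₃ : ℝ} (ha : a₃ < 0) : ∃ C, 0 ≤ C ∧ ∀ z o : ℝ,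
    2 * (cubic a₀ a₁ a₂ a₃ (z + o) * z) ≤ a₃ * z ^ 4 + C * (1 + o ^ 6) := by
  obtain ⟨A, hA⟩ : ∃ A, A = 1 + |a₃| + |a₂| + |a₁| + |a₀| := ⟨_, rfl⟩
  have hA0 : 0 < A := by rw [hA]; positivity
  -- Threshold between two regimes. For `|z| ≥ K w` the remainder `48 A w |z|³` is absorbed by one
  -- of the two copies of `a₃z⁴`; for `|z| ≤ K w` it is at most a multiple of `w⁴ ≤ 16 (1 + o⁶)`.
  obtain ⟨K, hK⟩ : ∃ K, K = 1 + 48 * A / (-a₃) := ⟨_, rfl⟩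
  have hK1 : 1 ≤ K := by
    have : 0 ≤ 48 * A / (-a₃) := div_nonneg (by positivity) (by linarith)
    linarith
  refine ⟨48 * A * K ^ 3 * 16, by positivity, fun z o => ?_⟩
  set w := 1 + |o| with hw
  have hw1 : 1 ≤ w := by linarith [abs_nonneg o]
  set y := |z| with hy
  have hy0 : 0 ≤ y := abs_nonneg z
  set m := max y w with hm
  have hm1 : 1 ≤ m := hw1.trans (le_max_right _ _)
  have hm0 : 0 ≤ m := by linarith
  have hzm : |z| ≤ m := le_max_left _ _
  have hom : |o| ≤ w := by linarith
  have hwm : w ≤ m := le_max_right _ _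
  have hlow : 2 * (cubic a₀ a₁ a₂ a₃ (z + o) * z) - 2 * a₃ * z ^ 4 ≤ 48 * A * (w * m ^ 3) :=
    hA ▸ cubic_add_mul_sub_le a₀ a₁ a₂ a₃ hw1 hwm hom hzm
  have hz4 : z ^ 4 = y ^ 4 := by rw [hy, pow_abs, abs_of_nonneg (by positivity)]
  have hw4 : w ^ 4 ≤ 16 * (1 + o ^ 6) := by
    have ho6 : o ^ 6 = |o| ^ 6 := by rw [pow_abs, abs_of_nonneg (by positivity)]
    rw [ho6, hw]
    rcases le_total |o| 1 with h | h
    · have : (1 + |o|) ^ 4 ≤ 2 ^ 4 := pow_le_pow_left₀ (by positivity) (by linarith) 4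
      have : 0 ≤ |o| ^ 6 := by positivity
      linarith
    · have h1 : (1 + |o|) ^ 4 ≤ (2 * |o|) ^ 4 := pow_le_pow_left₀ (by positivity) (by linarith) 4
      have h2 : |o| ^ 4 ≤ |o| ^ 6 := pow_le_pow_right₀ h (by norm_num)
      rw [mul_pow] at h1
      linarith
  have hCw : 48 * A * K ^ 3 * w ^ 4 ≤ 48 * A * K ^ 3 * 16 * (1 + o ^ 6) := by
    have := mul_le_mul_of_nonneg_left hw4 (show 0 ≤ 48 * A * K ^ 3 by positivity)
    linarith
  rcases le_total (K * w) y with h | h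
  · have hmy : m = y := max_eq_left ((le_mul_of_one_le_left (by linarith) hK1).trans h)
    have h1 : 48 * A * w ≤ -a₃ * y := by
      have : 48 * A / (-a₃) * w ≤ y := by
        have e : K * w = w + 48 * A / (-a₃) * w := by rw [hK]; ring
        linarith
      rw [div_mul_eq_mul_div, div_le_iff₀ (by linarith)] at this
      linarith
    have h2 := mul_le_mul_of_nonneg_right h1 (pow_nonneg hy0 3)
    have h3 : 0 ≤ 48 * A * K ^ 3 * 16 * (1 + o ^ 6) := by positivity
    rw [hmy] at hlow
    rw [hz4] at hlow ⊢
    linarith [show 48 * A * w * y ^ 3 = 48 * A * (w * y ^ 3) by ring,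
      show -a₃ * y * y ^ 3 = -(a₃ * y ^ 4) by ring]
  · have hmw : m ≤ K * w := max_le h (le_mul_of_one_le_left (by linarith) hK1)
    have h1 : m ^ 3 ≤ (K * w) ^ 3 := pow_le_pow_left₀ hm0 hmw 3
    have h2 : 48 * A * (w * m ^ 3) ≤ 48 * A * K ^ 3 * w ^ 4 := by
      have : w * m ^ 3 ≤ w * (K * w) ^ 3 := mul_le_mul_of_nonneg_left h1 (by linarith)
      have := mul_le_mul_of_nonneg_left this (show 0 ≤ 48 * A by positivity)
      linarith [show 48 * A * (w * (K * w) ^ 3) = 48 * A * K ^ 3 * w ^ 4 by ring]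
    have h3 : a₃ * z ^ 4 ≤ 0 := mul_nonpos_of_nonpos_of_nonneg ha.le (by positivity)
    linarith

/-- The coefficients `⟨f(u), e_n⟩` for the sine polynomial `u` with coefficients `y`. -/
def driftCoef (a₀ a₁ a₂ a₃ : ℝ) (N : ℕ) (y : ℕ → ℝ) (n : ℕ) : ℝ :=
  ∫ x, cubic a₀ a₁ a₂ a₃ (sinePoly N y x) * eigenfunction n x ∂μD

/-- The norm of `P_N F(u)` for the sine polynomial `u` with coefficients `y`. -/
def driftNorm (a₀ a₁ a₂ a₃ : ℝ) (N : ℕ) (y : ℕ → ℝ) : ℝ :=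
  √(normSq N (driftCoef a₀ a₁ a₂ a₃ N y))

/-- Write `S = 2 (∑ |z n|)²`, a bound for `‖z‖²_∞`, and let `Q`, `R` be the two integrals. Bessel
and cubic growth give `‖P_N F‖² ≤ C₀ (1 + S Q + R)`. The product `S Q` appears as a cross term in
the square of `η Q + C (1 + S + R)`, so taking roots leaves an arbitrarily small multiple of `Q`. -/
theorem mul_driftNorm_le (a₀ a₁ a₂ a₃ : ℝ) {K η : ℝ} (hη : 0 < η) :
    ∃ C, 0 ≤ C ∧ ∀ (N : ℕ) (z o : ℕ → ℝ),
      K * driftNorm a₀ a₁ a₂ a₃ N (fun n => z n + o n) ≤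
        η * ∫ x, sinePoly N z x ^ 4 ∂μD + C * (1 + 2 * (∑ n ∈ Finset.range N, |z n|) ^ 2 +
          ∫ x, sinePoly N o x ^ 6 ∂μD) := by
  obtain ⟨C₀, hC₀, hf⟩ := cubic_add_sq_le a₀ a₁ a₂ a₃
  have hc := continuous_cubic a₀ a₁ a₂ a₃
  -- The last summand pays for the cross term `2ηC S Q`, the middle one for `1 + R`, and the `1`
  -- ensures `x ≤ x²` for `x = C (1 + S + R)`.
  set C := 1 + K ^ 2 * C₀ + K ^ 2 * C₀ / (2 * η) with hC
  have hC1 : 1 ≤ C := by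
    have : 0 ≤ K ^ 2 * C₀ / (2 * η) := by positivity
    have : 0 ≤ K ^ 2 * C₀ := by positivity
    linarith
  refine ⟨C, by linarith, fun N z o => ?_⟩
  set Q := ∫ x, sinePoly N z x ^ 4 ∂μD
  set R := ∫ x, sinePoly N o x ^ 6 ∂μD
  set S := 2 * (∑ n ∈ Finset.range N, |z n|) ^ 2
  have hQ : 0 ≤ Q := integral_nonneg fun x => by positivity
  have hR : 0 ≤ R := integral_nonneg fun x => by positivity
  have hS : 0 ≤ S := by positivity
  have h1 : normSq N (driftCoef a₀ a₁ a₂ a₃ N fun n => z n + o n) ≤ C₀ * (1 + S * Q + R) := by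
    refine (sum_sq_integral_mul_eigenfunction_le (hc.comp (continuous_sinePoly N _)) N).trans ?_
    calc ∫ x, cubic a₀ a₁ a₂ a₃ (sinePoly N (fun n => z n + o n) x) ^ 2 ∂μD
        ≤ ∫ x, C₀ * (1 + S * sinePoly N z x ^ 4 + sinePoly N o x ^ 6) ∂μD := by
          refine integral_mono (integrable_of_continuous (by fun_prop))
            (integrable_of_continuous (by fun_prop)) fun x => ?_
          dsimp only
          rw [sinePoly_add]
          refine (hf _ _).trans (mul_le_mul_of_nonneg_left ?_ hC₀)
          have := mul_le_mul_of_nonneg_right (sinePoly_sq_le N z x)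
            (show 0 ≤ sinePoly N z x ^ 4 by positivity)
          have e : sinePoly N z x ^ 2 * sinePoly N z x ^ 4 = sinePoly N z x ^ 6 := by ring
          linarith
      _ = C₀ * (1 + S * Q + R) := by
          rw [integral_const_mul, integral_add (integrable_of_continuous (by fun_prop))
            (integrable_of_continuous (by fun_prop)),
            integral_add (integrable_of_continuous (by fun_prop))
            (integrable_of_continuous (by fun_prop)), integral_const_mul]
          simp [Q, R]
  have hrhs : 0 ≤ η * Q + C * (1 + S + R) := by positivity
  refine abs_le_of_sq_le_sq' (a := K * _) ?_ hrhs |>.2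
  rw [driftNorm, mul_pow, Real.sq_sqrt (normSq_nonneg _ _)]
  have h2 := mul_le_mul_of_nonneg_left h1 (sq_nonneg K)
  have hCη : K ^ 2 * C₀ ≤ 2 * η * C := by
    have : K ^ 2 * C₀ / (2 * η) ≤ C := by
      have : 0 ≤ K ^ 2 * C₀ := by positivity
      linarith
    rw [div_le_iff₀ (by positivity)] at this
    linarith
  have hCK : K ^ 2 * C₀ ≤ C := by
    have : 0 ≤ K ^ 2 * C₀ / (2 * η) := by positivity
    linarith
  have h3 := mul_le_mul_of_nonneg_right hCη (mul_nonneg hS hQ)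
  have h4 := mul_le_mul_of_nonneg_right hCK (show 0 ≤ 1 + R by linarith)
  have h5 : C * (1 + R) ≤ (C * (1 + S + R)) ^ 2 := by
    have h : C * (1 + R) ≤ C * (1 + S + R) :=
      mul_le_mul_of_nonneg_left (by linarith) (by linarith)
    exact h.trans (le_self_pow₀ (one_le_mul_of_one_le_of_one_le hC1 (by linarith)) (by norm_num))
  have h6 : 0 ≤ 2 * η * C * Q * (1 + R) := by positivity
  have h7 : (η * Q + C * (1 + S + R)) ^ 2 = (η * Q) ^ 2 + (C * (1 + S + R)) ^ 2 +
      (2 * η * C * (S * Q) + 2 * η * C * Q * (1 + R)) := by ring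
  rw [h7]
  linarith [sq_nonneg (η * Q)]

/-- Coercivity of the drift, with the norm of the projected drift on the left. -/
theorem drift_coercive (a₀ a₁ a₂ : ℝ) {a₃ : ℝ} (ha : a₃ < 0) {K ε : ℝ} (hε : 0 < ε) :
    ∃ C, 0 ≤ C ∧ ∀ (N : ℕ) (z o : ℕ → ℝ),
      2 * ∑ n ∈ Finset.range N, z n * driftCoef a₀ a₁ a₂ a₃ N (fun n => z n + o n) n +
          K * driftNorm a₀ a₁ a₂ a₃ N (fun n => z n + o n) ≤
        ε * gradSq N z + C * (1 + ∫ x, sinePoly N o x ^ 6 ∂μD) := by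
  obtain ⟨C₁, hC₁, h₁⟩ := cubic_add_mul_le a₀ a₁ a₂ ha
  obtain ⟨C₂, hC₂, h₂⟩ := mul_driftNorm_le a₀ a₁ a₂ a₃ (K := K) (show 0 < -a₃ / 2 by linarith)
  obtain ⟨C₃, hC₃, h₃⟩ := exists_sq_sum_abs_le (show 0 < ε / (C₂ + 1) by positivity)
  have hc := continuous_cubic a₀ a₁ a₂ a₃
  -- The quartic dissipation is spent in two halves: one on the `η Q` of `mul_driftNorm_le`, the
  -- other on `C₂ C₃ ‖z‖² ≤ C₂ C₃ (δ Q + 1/(4δ))`, which needs `C₂ C₃ δ ≤ -a₃ / 2`.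
  set δ := -a₃ / (2 * (C₂ * C₃ + 1)) with hδ
  have hδ0 : 0 < δ := div_pos (by linarith) (by positivity)
  have hδ' : C₂ * C₃ * δ ≤ -a₃ / 2 := by
    rw [hδ, mul_div_assoc', div_le_div_iff₀ (by positivity) (by norm_num)]
    nlinarith [mul_nonneg hC₂ hC₃]
  refine ⟨C₁ + C₂ + C₂ * C₃ / (4 * δ), by positivity, fun N z o => ?_⟩
  set Q := ∫ x, sinePoly N z x ^ 4 ∂μD
  set R := ∫ x, sinePoly N o x ^ 6 ∂μD
  have hQ : 0 ≤ Q := integral_nonneg fun x => by positivity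
  have hR : 0 ≤ R := integral_nonneg fun x => by positivity
  have hsum : 2 * ∑ n ∈ Finset.range N, z n * driftCoef a₀ a₁ a₂ a₃ N (fun n => z n + o n) n ≤
      a₃ * Q + C₁ * (1 + R) := by
    have := integral_mul_sinePoly (hc.comp (continuous_sinePoly N fun n => z n + o n)) N z
    simp only [driftCoef]
    simp only [Function.comp] at this
    rw [← this, ← integral_const_mul]
    calc ∫ x, 2 * (cubic a₀ a₁ a₂ a₃ (sinePoly N (fun n => z n + o n) x) * sinePoly N z x) ∂μD
        ≤ ∫ x, (a₃ * sinePoly N z x ^ 4 + C₁ * (1 + sinePoly N o x ^ 6)) ∂μD := by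
          refine integral_mono (integrable_of_continuous (by fun_prop))
            (integrable_of_continuous (by fun_prop)) fun x => ?_
          dsimp only
          rw [sinePoly_add]
          exact h₁ _ _
      _ = a₃ * Q + C₁ * (1 + R) := by
          rw [integral_add (integrable_of_continuous (by fun_prop))
            (integrable_of_continuous (by fun_prop)), integral_const_mul, integral_const_mul,
            integral_add (integrable_of_continuous (by fun_prop))
            (integrable_of_continuous (by fun_prop))]
          simp [Q, R]
  have hn : normSq N z ≤ δ * Q + 1 / (4 * δ) := by
    rw [normSq, ← integral_sinePoly_sq]
    calc ∫ x, sinePoly N z x ^ 2 ∂μD ≤ ∫ x, (δ * sinePoly N z x ^ 4 + 1 / (4 * δ)) ∂μD := by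
          refine integral_mono (integrable_of_continuous (by fun_prop))
            (integrable_of_continuous (by fun_prop)) fun x => ?_
          dsimp only
          set t := sinePoly N z x ^ 2
          have e : sinePoly N z x ^ 4 = t ^ 2 := by ring
          have : 0 ≤ δ * (t - 1 / (2 * δ)) ^ 2 := by positivity
          have e2 : δ * (t - 1 / (2 * δ)) ^ 2 = δ * t ^ 2 - t + 1 / (4 * δ) := by
            field_simp; ring
          rw [e]; linarith
      _ = δ * Q + 1 / (4 * δ) := by
          rw [integral_add (integrable_of_continuous (by fun_prop))
            (integrable_of_continuous (by fun_prop)), integral_const_mul]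
          simp [Q]
  have hS := mul_le_mul_of_nonneg_left (h₃ N z) hC₂
  have hn' := mul_le_mul_of_nonneg_left hn (mul_nonneg hC₂ hC₃)
  have hδQ := mul_le_mul_of_nonneg_right hδ' hQ
  have hεg : C₂ * (ε / (C₂ + 1) * gradSq N z) ≤ ε * gradSq N z := by
    rw [← mul_assoc]
    refine mul_le_mul_of_nonneg_right ?_ (gradSq_nonneg N z)
    rw [mul_div_assoc', div_le_iff₀ (by positivity)]
    nlinarith
  have hlast : 0 ≤ C₂ * C₃ / (4 * δ) * R := by positivity
  have := h₂ N z o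
  have e : C₂ * C₃ * (1 / (4 * δ)) = C₂ * C₃ / (4 * δ) := by ring
  linarith

end Energy

/-! ### Energy balance of the exponential integrator and the pathwise bound for the drift. -/

section EnergyStep

/-- One step of the exponential integrator for a single mode. -/
def expStep (l τ z g : ℝ) : ℝ := Real.exp (-(l * τ)) * z + (1 - Real.exp (-(l * τ))) / l * g

theorem one_sub_exp_neg_le {x : ℝ} : 1 - Real.exp (-x) ≤ x := by
  have := Real.add_one_le_exp (-x); linarith

/-- Put `a = e^{-lτ}` and `ψ = (1 - a)/l`. All bounds follow from `e^x ≥ 1 + x` and hold for every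
size of `lτ`, so no coupling between time step and dimension arises. The last one multiplies two
estimates of the defect `τ - aψ`, by `τ` and by `2lτ²`. -/
theorem mode_bounds {l τ : ℝ} (hl : 0 < l) (hτ : 0 < τ) :
    (0 ≤ Real.exp (-(l * τ)) ∧ Real.exp (-(l * τ)) ≤ 1) ∧
      (0 ≤ (1 - Real.exp (-(l * τ))) / l ∧ (1 - Real.exp (-(l * τ))) / l ≤ τ) ∧
      l * ((1 - Real.exp (-(l * τ))) / l) ^ 2 ≤ τ ∧
      τ * l * Real.exp (-(l * τ)) ^ 2 ≤ 1 - Real.exp (-(l * τ)) ^ 2 ∧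
      (τ - Real.exp (-(l * τ)) * ((1 - Real.exp (-(l * τ))) / l)) ^ 2 ≤ 2 * τ ^ 2 * (l * τ) := by
  have hx : 0 < l * τ := mul_pos hl hτ
  have ha0 : 0 ≤ Real.exp (-(l * τ)) := (Real.exp_pos _).le
  have ha1 : Real.exp (-(l * τ)) ≤ 1 := Real.exp_le_one_iff.2 (by linarith)
  have ha2 : 1 - Real.exp (-(l * τ)) ≤ l * τ := one_sub_exp_neg_le
  have hea : Real.exp (l * τ) * Real.exp (-(l * τ)) = 1 := by rw [← Real.exp_add]; simp
  have he1 := Real.add_one_le_exp (l * τ)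
  set a := Real.exp (-(l * τ)) with ha
  have hψ : l * ((1 - a) / l) = 1 - a := by field_simp
  set ψ := (1 - a) / l with hψd
  have hψ0 : 0 ≤ ψ := div_nonneg (by linarith) hl.le
  have hψτ : ψ ≤ τ := by rw [hψd, div_le_iff₀ hl]; linarith
  refine ⟨⟨ha0, ha1⟩, ⟨hψ0, hψτ⟩, ?_, ?_, ?_⟩
  · calc l * ψ ^ 2 = (1 - a) * ψ := by rw [← hψ]; ring
      _ ≤ 1 * τ := mul_le_mul (by linarith) hψτ hψ0 (by norm_num)
      _ = τ := one_mul τ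
  · have h1 : l * τ * a ≤ 1 - a := by
      have := mul_le_mul_of_nonneg_right he1 ha0
      linarith
    have h2 := mul_le_mul_of_nonneg_right h1 ha0
    nlinarith
  · have h1 : 0 ≤ τ - a * ψ := by
      have := mul_le_mul ha1 hψτ hψ0 zero_le_one
      linarith
    have h2 : τ - a * ψ ≤ τ := by have := mul_nonneg ha0 hψ0; linarith
    have h3 : l * (τ - a * ψ) ≤ 2 * (l * τ) * (l * τ) := by
      have e : l * (τ - a * ψ) = l * τ - a * (l * ψ) := by ring
      rw [e, hψ]
      -- `x - a (1 - a) ≤ 2 x²` with `a = e^{-x}`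
      have h4 : a * (l * τ - (1 - a)) ≤ 1 * (l * τ - (1 - a)) :=
        mul_le_mul_of_nonneg_right ha1 (by linarith)
      have h5 : l * τ - (1 - a) ≤ (l * τ) ^ 2 := by
        have : l * τ * a ≤ 1 - a := by
          have := mul_le_mul_of_nonneg_right he1 ha0
          linarith
        nlinarith
      nlinarith
    have h4 : τ - a * ψ ≤ 2 * τ * (l * τ) := by
      refine le_of_mul_le_mul_left (h3.trans (le_of_eq ?_)) hl; ring
    calc (τ - a * ψ) ^ 2 = (τ - a * ψ) * (τ - a * ψ) := sq _
      _ ≤ τ * (2 * τ * (l * τ)) := mul_le_mul h2 h4 h1 hτ.le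
      _ = 2 * τ ^ 2 * (l * τ) := by ring

/-- In the square of `az + ψg` the cross term is replaced by `2τzg`, at the price of the defect `τ -
aψ`. The contraction `1 - a² ≥ τ l a²` pays for the dissipation term on the left. The constant is
`18 = 16 + 1 + 1`: defect, `ψ²g²`, and the share of `g` in the dissipation term. -/
theorem expStep_energy {l τ : ℝ} (hl : 0 < l) (hτ : 0 < τ) (z g : ℝ) :
    expStep l τ z g ^ 2 + τ / 2 * (l * expStep l τ z g ^ 2) ≤
      z ^ 2 + 2 * τ * (z * g) + τ / 8 * (l * z ^ 2) + 18 * τ ^ 2 * g ^ 2 := by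
  obtain ⟨⟨ha0, ha1⟩, ⟨hψ0, hψτ⟩, hlψ, hla, hdef⟩ := mode_bounds hl hτ
  rw [expStep]
  set a := Real.exp (-(l * τ))
  set ψ := (1 - a) / l
  -- Young's inequality multiplied through by `τl`: the square `(τlz + 8(τ - aψ)g)²` is nonnegative,
  -- and the defect bound makes its last term divisible by `τl`.
  have h1 : -(2 * (τ - a * ψ) * (z * g)) ≤ τ / 8 * (l * z ^ 2) + 16 * τ ^ 2 * g ^ 2 := by
    have hτl : 0 < τ * l := mul_pos hτ hl
    have h2 : 0 ≤ (τ * l * z + 8 * (τ - a * ψ) * g) ^ 2 := sq_nonneg _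
    have h3 := mul_le_mul_of_nonneg_right hdef (show 0 ≤ 64 * g ^ 2 by positivity)
    have h4 : 0 ≤ τ * l * (τ * l * z ^ 2 + 16 * (τ - a * ψ) * (z * g) + 128 * τ ^ 2 * g ^ 2) := by
      linarith [show (τ * l * z + 8 * (τ - a * ψ) * g) ^ 2 = τ * l * (τ * l * z ^ 2) +
        τ * l * (16 * (τ - a * ψ) * (z * g)) + (τ - a * ψ) ^ 2 * (64 * g ^ 2) by ring,
        show 2 * τ ^ 2 * (l * τ) * (64 * g ^ 2) = τ * l * (128 * τ ^ 2 * g ^ 2) by ring]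
    have := nonneg_of_mul_nonneg_right h4 hτl
    linarith
  have h2 : ψ ^ 2 * g ^ 2 ≤ τ ^ 2 * g ^ 2 :=
    mul_le_mul_of_nonneg_right (pow_le_pow_left₀ hψ0 hψτ 2) (sq_nonneg g)
  have h3 : l * (a * z + ψ * g) ^ 2 ≤ 2 * (l * a ^ 2) * z ^ 2 + 2 * (l * ψ ^ 2) * g ^ 2 := by
    have := mul_nonneg hl.le (sq_nonneg (a * z - ψ * g))
    linarith [show 2 * (l * a ^ 2) * z ^ 2 + 2 * (l * ψ ^ 2) * g ^ 2 =
      l * (a * z - ψ * g) ^ 2 + l * (a * z + ψ * g) ^ 2 by ring]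
  have h4 := mul_le_mul_of_nonneg_left h3 (show 0 ≤ τ / 2 by linarith)
  have h5 := mul_le_mul_of_nonneg_right hla (sq_nonneg z)
  have h6 := mul_le_mul_of_nonneg_right hlψ (show 0 ≤ τ * g ^ 2 by positivity)
  linarith [show (a * z + ψ * g) ^ 2 = a ^ 2 * z ^ 2 + 2 * τ * (z * g) - 2 * (τ - a * ψ) * (z * g)
    + ψ ^ 2 * g ^ 2 by ring]

/-- For the first step only: no factor `l` multiplies `z²` on the right, since the initial value has
no `Ḣ¹` bound uniform in `N`. -/
theorem expStep_energy_crude {l τ : ℝ} (hl : 0 < l) (hτ : 0 < τ) (z g : ℝ) :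
    expStep l τ z g ^ 2 + τ / 2 * (l * expStep l τ z g ^ 2) ≤ 3 * z ^ 2 + 3 * τ ^ 2 * g ^ 2 := by
  obtain ⟨⟨ha0, ha1⟩, ⟨hψ0, hψτ⟩, hlψ, hla, -⟩ := mode_bounds hl hτ
  rw [expStep]
  set a := Real.exp (-(l * τ))
  set ψ := (1 - a) / l
  have h1 : (a * z + ψ * g) ^ 2 ≤ 2 * a ^ 2 * z ^ 2 + 2 * ψ ^ 2 * g ^ 2 := by
    linarith [sq_nonneg (a * z - ψ * g), show 2 * a ^ 2 * z ^ 2 + 2 * ψ ^ 2 * g ^ 2 =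
      (a * z - ψ * g) ^ 2 + (a * z + ψ * g) ^ 2 by ring]
  have h2 : ψ ^ 2 * g ^ 2 ≤ τ ^ 2 * g ^ 2 :=
    mul_le_mul_of_nonneg_right (pow_le_pow_left₀ hψ0 hψτ 2) (sq_nonneg g)
  have ha2 : a ^ 2 * z ^ 2 ≤ 1 * z ^ 2 :=
    mul_le_mul_of_nonneg_right (pow_le_one₀ ha0 ha1) (sq_nonneg z)
  have h4 := mul_le_mul_of_nonneg_left h1 (show 0 ≤ τ / 2 * l by positivity)
  have h5 := mul_le_mul_of_nonneg_right hla (sq_nonneg z)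
  have h6 := mul_le_mul_of_nonneg_right hlψ (show 0 ≤ τ * g ^ 2 by positivity)
  have h7 : 0 ≤ a ^ 2 * z ^ 2 := by positivity
  linarith

/-- The energy `‖z‖² + (τ/2) ‖z‖²_{Ḣ¹}`. -/
def energy (N : ℕ) (τ : ℝ) (z : ℕ → ℝ) : ℝ := normSq N z + τ / 2 * gradSq N z

variable (a₀ a₁ a₂ a₃ : ℝ)

/-- The coefficients of the tamed drift. -/
def tamedCoef (N : ℕ) (τ : ℝ) (y : ℕ → ℝ) (n : ℕ) : ℝ :=
  (1 + τ * driftNorm a₀ a₁ a₂ a₃ N y)⁻¹ * driftCoef a₀ a₁ a₂ a₃ N y n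

theorem driftNorm_nonneg (N : ℕ) (y : ℕ → ℝ) : 0 ≤ driftNorm a₀ a₁ a₂ a₃ N y := Real.sqrt_nonneg _

theorem taming_mem {N : ℕ} {τ : ℝ} (hτ : 0 < τ) (y : ℕ → ℝ) :
    0 ≤ (1 + τ * driftNorm a₀ a₁ a₂ a₃ N y)⁻¹ ∧ (1 + τ * driftNorm a₀ a₁ a₂ a₃ N y)⁻¹ ≤ 1 ∧
      τ * ((1 + τ * driftNorm a₀ a₁ a₂ a₃ N y)⁻¹ * driftNorm a₀ a₁ a₂ a₃ N y) ≤ 1 := by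
  have h : 0 ≤ τ * driftNorm a₀ a₁ a₂ a₃ N y := mul_nonneg hτ.le (driftNorm_nonneg _ _ _ _ _ _)
  refine ⟨by positivity, inv_le_one_of_one_le₀ (by linarith), ?_⟩
  rw [mul_left_comm, inv_mul_eq_div, div_le_one (by linarith)]
  linarith

theorem normSq_tamedCoef (N : ℕ) (τ : ℝ) (y : ℕ → ℝ) :
    normSq N (tamedCoef a₀ a₁ a₂ a₃ N τ y) =
      ((1 + τ * driftNorm a₀ a₁ a₂ a₃ N y)⁻¹ * driftNorm a₀ a₁ a₂ a₃ N y) ^ 2 := by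
  have h : driftNorm a₀ a₁ a₂ a₃ N y ^ 2 = normSq N (driftCoef a₀ a₁ a₂ a₃ N y) :=
    Real.sq_sqrt (normSq_nonneg _ _)
  rw [mul_pow, h, normSq, normSq, Finset.mul_sum]
  simp only [tamedCoef, mul_pow]

theorem energy_expStep_crude {N : ℕ} {τ : ℝ} (hτ : 0 < τ) (z y : ℕ → ℝ) :
    energy N τ (fun n => expStep (eigenvalue n) τ (z n) (tamedCoef a₀ a₁ a₂ a₃ N τ y n)) ≤
      3 * normSq N z + 3 := by
  have h1 : energy N τ (fun n => expStep (eigenvalue n) τ (z n) (tamedCoef a₀ a₁ a₂ a₃ N τ y n)) ≤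
      3 * normSq N z + 3 * τ ^ 2 * normSq N (tamedCoef a₀ a₁ a₂ a₃ N τ y) := by
    simp only [energy, normSq, gradSq, Finset.mul_sum, ← Finset.sum_add_distrib]
    exact Finset.sum_le_sum fun n _ => expStep_energy_crude (eigenvalue_pos n) hτ _ _
  obtain ⟨h2, -, h3⟩ := taming_mem a₀ a₁ a₂ a₃ (N := N) hτ y
  rw [normSq_tamedCoef] at h1
  have h4 := pow_le_one₀ (n := 2)
    (mul_nonneg hτ.le (mul_nonneg h2 (driftNorm_nonneg a₀ a₁ a₂ a₃ N y))) h3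
  rw [mul_pow] at h4
  linarith

/-- Since `τ θ ‖P_N F‖ ≤ 1` for the taming factor `θ`, the error `18τ²‖g‖²` is at most `18 τ θ ‖P_N
F‖`. It then carries the same prefactor `τθ` as the drift term, and `drift_coercive` with `K = 18`
and `ε = 1/8` handles both together. -/
theorem energy_expStep {a₃ : ℝ} (ha : a₃ < 0) : ∃ C, 0 ≤ C ∧
    ∀ (N : ℕ) (τ : ℝ) (_ : 0 < τ) (z o : ℕ → ℝ),
      energy N τ (fun n => expStep (eigenvalue n) τ (z n)
        (tamedCoef a₀ a₁ a₂ a₃ N τ (fun n => z n + o n) n)) + τ / 4 * gradSq N z ≤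
      energy N τ z + τ * (C * (1 + ∫ x, sinePoly N o x ^ 6 ∂μD)) := by
  obtain ⟨C, hC, h⟩ := drift_coercive a₀ a₁ a₂ ha (K := 18) (show (0 : ℝ) < 1 / 8 by norm_num)
  refine ⟨C, hC, fun N τ hτ z o => ?_⟩
  set y : ℕ → ℝ := fun n => z n + o n
  set g := tamedCoef a₀ a₁ a₂ a₃ N τ y
  set θ := (1 + τ * driftNorm a₀ a₁ a₂ a₃ N y)⁻¹
  set R := ∫ x, sinePoly N o x ^ 6 ∂μD
  have hR : 0 ≤ R := integral_nonneg fun x => by positivity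
  have h1 : energy N τ (fun n => expStep (eigenvalue n) τ (z n) (g n)) ≤ normSq N z +
      2 * τ * (∑ n ∈ Finset.range N, z n * g n) + τ / 8 * gradSq N z +
        18 * τ ^ 2 * normSq N g := by
    simp only [energy, normSq, gradSq, Finset.mul_sum, ← Finset.sum_add_distrib]
    exact Finset.sum_le_sum fun n _ => expStep_energy (eigenvalue_pos n) hτ _ _
  have h2 : ∑ n ∈ Finset.range N, z n * g n =
      θ * ∑ n ∈ Finset.range N, z n * driftCoef a₀ a₁ a₂ a₃ N y n := by
    rw [Finset.mul_sum]
    exact Finset.sum_congr rfl fun n _ => by simp only [g, tamedCoef]; ring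
  obtain ⟨hθ0, hθ1, hθ⟩ := taming_mem a₀ a₁ a₂ a₃ (N := N) hτ y
  have hd := driftNorm_nonneg a₀ a₁ a₂ a₃ N y
  have h3 : τ ^ 2 * normSq N g ≤ τ * (θ * driftNorm a₀ a₁ a₂ a₃ N y) := by
    rw [normSq_tamedCoef]
    calc τ ^ 2 * (θ * driftNorm a₀ a₁ a₂ a₃ N y) ^ 2
        = τ * (θ * driftNorm a₀ a₁ a₂ a₃ N y) * (τ * (θ * driftNorm a₀ a₁ a₂ a₃ N y)) := by ring
      _ ≤ τ * (θ * driftNorm a₀ a₁ a₂ a₃ N y) * 1 :=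
          mul_le_mul_of_nonneg_left hθ (mul_nonneg hτ.le (mul_nonneg hθ0 hd))
      _ = _ := mul_one _
  have h4 := mul_le_mul_of_nonneg_left (h N z o) (mul_nonneg hτ.le hθ0)
  have hnn : 0 ≤ 1 / 8 * gradSq N z + C * (1 + R) := by
    have := gradSq_nonneg N z; positivity
  have h5 : τ * θ * (1 / 8 * gradSq N z + C * (1 + R)) ≤
      τ * (1 / 8 * gradSq N z + C * (1 + R)) :=
    mul_le_mul_of_nonneg_right (mul_le_of_le_one_right hτ.le hθ1) hnn
  have h6 := h4.trans h5
  rw [h2] at h1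
  change τ * θ * (2 * (∑ n ∈ Finset.range N, z n * driftCoef a₀ a₁ a₂ a₃ N y n) +
    18 * driftNorm a₀ a₁ a₂ a₃ N y) ≤ _ at h6
  rw [energy]
  rw [energy] at h1
  rw [energy]
  linarith

/-- The sum of the energy and of the dissipation along a trajectory of the scheme. -/
theorem energy_trajectory {a₃ : ℝ} (ha : a₃ < 0) : ∃ C, 1 ≤ C ∧
    ∀ (N M : ℕ) (τ : ℝ) (_ : 0 < τ) (z o : ℕ → ℕ → ℝ)
      (_ : ∀ m n, z (m + 1) n = expStep (eigenvalue n) τ (z m n)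
        (tamedCoef a₀ a₁ a₂ a₃ N τ (fun n => z m n + o m n) n)) (m : ℕ) (_ : m < M),
      energy N τ (z (m + 1)) + ∑ j ∈ Finset.range m, τ / 4 * gradSq N (z (j + 1)) ≤
        C * (1 + normSq N (z 0) +
          ∑ j ∈ Finset.range M, τ * (1 + ∫ x, sinePoly N (o j) x ^ 6 ∂μD)) := by
  obtain ⟨C, hC, h⟩ := energy_expStep a₀ a₁ a₂ ha
  refine ⟨3 + C, by linarith, fun N M τ hτ z o hz m hm => ?_⟩
  set r : ℕ → ℝ := fun j => τ * (1 + ∫ x, sinePoly N (o j) x ^ 6 ∂μD) with hr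
  have hr0 : ∀ j, 0 ≤ r j := fun j =>
    mul_nonneg hτ.le (add_nonneg zero_le_one (integral_nonneg fun x => by positivity))
  -- The first step uses the crude bound, so the summed dissipation begins at `z 1` and the forcing
  -- at `r 1`.
  have key : ∀ m, energy N τ (z (m + 1)) + ∑ j ∈ Finset.range m, τ / 4 * gradSq N (z (j + 1)) ≤
      3 * normSq N (z 0) + 3 + ∑ j ∈ Finset.range m, C * r (j + 1) := by
    intro m
    induction m with
    | zero =>
      have := energy_expStep_crude a₀ a₁ a₂ a₃ (N := N) hτ (z 0) (fun n => z 0 n + o 0 n)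
      rw [← funext (hz 0)] at this
      simpa using this
    | succ m ih =>
      have := h N τ hτ (z (m + 1)) (o (m + 1))
      rw [← funext (hz (m + 1))] at this
      rw [Finset.sum_range_succ, Finset.sum_range_succ]
      have e : τ * (C * (1 + ∫ x, sinePoly N (o (m + 1)) x ^ 6 ∂μD)) = C * r (m + 1) := by
        simp only [hr]; ring
      linarith
  refine (key m).trans ?_
  have h1 : ∑ j ∈ Finset.range m, C * r (j + 1) ≤ C * ∑ j ∈ Finset.range M, r j := by
    rw [← Finset.mul_sum]
    refine mul_le_mul_of_nonneg_left ?_ hC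
    have h2 : ∑ j ∈ Finset.range (m + 1), r j ≤ ∑ j ∈ Finset.range M, r j :=
      Finset.sum_le_sum_of_subset_of_nonneg (Finset.range_mono hm) fun j _ _ => hr0 j
    rw [Finset.sum_range_succ'] at h2
    linarith [hr0 0]
  have h3 : 0 ≤ ∑ j ∈ Finset.range M, r j := Finset.sum_nonneg fun j _ => hr0 j
  have h4 := normSq_nonneg N (z 0)
  nlinarith

/-- `L¹` norm of the drift. -/
def driftL1 (N : ℕ) (y : ℕ → ℝ) : ℝ := ∫ x, |cubic a₀ a₁ a₂ a₃ (sinePoly N y x)| ∂μD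

/-- From `∫ |z|³ ≤ ‖z‖_∞ ‖z‖²` and `‖z‖²_∞ ≤ D gradSq`. The `L¹` norm keeps the square linear in
`gradSq`, which is what the summed dissipation controls. -/
theorem driftL1_sq_le : ∃ C, 0 ≤ C ∧ ∀ (N : ℕ) (z o : ℕ → ℝ),
    driftL1 a₀ a₁ a₂ a₃ N (fun n => z n + o n) ^ 2 ≤
      C * (1 + gradSq N z * normSq N z ^ 2 + ∫ x, sinePoly N o x ^ 6 ∂μD) := by
  obtain ⟨C, hC, h⟩ := abs_cubic_add_le a₀ a₁ a₂ a₃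
  obtain ⟨D, hD, hS⟩ := exists_sq_sum_abs_le_gradSq
  have hc := continuous_cubic a₀ a₁ a₂ a₃
  refine ⟨3 * C ^ 2 * (1 + D), by positivity, fun N z o => ?_⟩
  set U := ∫ x, |sinePoly N z x| ^ 3 ∂μD with hU
  set V := ∫ x, |sinePoly N o x| ^ 3 ∂μD with hV
  have hV2 : V ^ 2 ≤ ∫ x, sinePoly N o x ^ 6 ∂μD := by
    refine (sq_integral_le (by fun_prop)).trans (le_of_eq ?_)
    congr 1; ext x
    rw [← pow_mul, pow_mul _ 2 3, sq_abs]; ring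
  have hU0 : 0 ≤ U := integral_nonneg fun x => pow_nonneg (abs_nonneg _) 3
  have hU2 : U ^ 2 ≤ D * gradSq N z * normSq N z ^ 2 := by
    set S := 2 * (∑ n ∈ Finset.range N, |z n|) ^ 2 with hSd
    have hS0 : 0 ≤ S := by positivity
    have h1 : U ≤ √S * normSq N z := by
      rw [normSq, ← integral_sinePoly_sq, ← integral_const_mul]
      refine integral_mono (integrable_of_continuous (by fun_prop))
        (integrable_of_continuous (by fun_prop)) fun x => ?_
      have : |sinePoly N z x| ≤ √S := Real.abs_le_sqrt (sinePoly_sq_le N z x)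
      have h2 := mul_le_mul_of_nonneg_right this (sq_nonneg |sinePoly N z x|)
      dsimp only
      rw [sq_abs] at h2
      calc |sinePoly N z x| ^ 3 = |sinePoly N z x| * sinePoly N z x ^ 2 := by
            rw [← sq_abs (sinePoly N z x)]; ring
        _ ≤ _ := h2
    have h2 := pow_le_pow_left₀ hU0 h1 2
    rw [mul_pow, Real.sq_sqrt hS0] at h2
    exact h2.trans (mul_le_mul_of_nonneg_right (hS N z) (sq_nonneg _))
  have h1 : driftL1 a₀ a₁ a₂ a₃ N (fun n => z n + o n) ≤ C * (1 + U + V) := by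
    calc driftL1 a₀ a₁ a₂ a₃ N (fun n => z n + o n)
        ≤ ∫ x, C * (1 + |sinePoly N z x| ^ 3 + |sinePoly N o x| ^ 3) ∂μD := by
          refine integral_mono (integrable_of_continuous (by fun_prop))
            (integrable_of_continuous (by fun_prop)) fun x => ?_
          dsimp only
          rw [sinePoly_add]
          exact h _ _
      _ = C * (1 + U + V) := by
          rw [integral_const_mul, integral_add (integrable_of_continuous (by fun_prop))
            (integrable_of_continuous (by fun_prop)),
            integral_add (integrable_of_continuous (by fun_prop))
            (integrable_of_continuous (by fun_prop))]
          simp [hU, hV]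
  have h0 : 0 ≤ driftL1 a₀ a₁ a₂ a₃ N (fun n => z n + o n) :=
    integral_nonneg fun x => abs_nonneg _
  have h2 := pow_le_pow_left₀ h0 h1 2
  have h3 : (1 + U + V) ^ 2 ≤ 3 * (1 + U ^ 2 + V ^ 2) := by
    nlinarith [sq_nonneg (1 - U), sq_nonneg (1 - V), sq_nonneg (U - V)]
  rw [mul_pow] at h2
  refine h2.trans ?_
  set W := gradSq N z * normSq N z ^ 2 with hW
  have hW0 : 0 ≤ W := mul_nonneg (gradSq_nonneg N z) (sq_nonneg _)
  have h4 : (1 + U + V) ^ 2 ≤ 3 * (1 + D) * (1 + W + ∫ x, sinePoly N o x ^ 6 ∂μD) := by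
    have : 0 ≤ D * (1 + ∫ x, sinePoly N o x ^ 6 ∂μD) :=
      mul_nonneg hD (by linarith [sq_nonneg V])
    have e : D * gradSq N z * normSq N z ^ 2 = D * W := by rw [hW]; ring
    nlinarith
  calc C ^ 2 * (1 + U + V) ^ 2 ≤ C ^ 2 * (3 * (1 + D) * (1 + W + ∫ x, sinePoly N o x ^ 6 ∂μD)) :=
        mul_le_mul_of_nonneg_left h4 (sq_nonneg C)
    _ = _ := by ring

/-- A priori bound for the drift along a trajectory of the tamed scheme, uniform in the
discretization. -/
theorem sum_driftL1_sq_le {a₃ : ℝ} (ha : a₃ < 0) : ∃ C, 0 ≤ C ∧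
    ∀ (N M : ℕ) (τ : ℝ) (_ : 0 < τ) (z o : ℕ → ℕ → ℝ)
      (_ : ∀ m n, z (m + 1) n = expStep (eigenvalue n) τ (z m n)
        (tamedCoef a₀ a₁ a₂ a₃ N τ (fun n => z m n + o m n) n)),
      ∑ m ∈ Finset.range M, τ * driftL1 a₀ a₁ a₂ a₃ N (fun n => z m n + o m n) ^ 2 ≤
        τ * driftL1 a₀ a₁ a₂ a₃ N (fun n => z 0 n + o 0 n) ^ 2 +
        C * (1 + normSq N (z 0) +
          ∑ j ∈ Finset.range M, τ * (1 + ∫ x, sinePoly N (o j) x ^ 6 ∂μD)) ^ 3 := by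
  obtain ⟨A, hA, hE⟩ := energy_trajectory a₀ a₁ a₂ ha
  obtain ⟨D, hD, hL⟩ := driftL1_sq_le a₀ a₁ a₂ a₃
  refine ⟨D * (1 + 4 * A ^ 3), by positivity, fun N M τ hτ z o hz => ?_⟩
  set R : ℕ → ℝ := fun j => ∫ x, sinePoly N (o j) x ^ 6 ∂μD with hR
  have hR0 : ∀ j, 0 ≤ R j := fun j => integral_nonneg fun x => by positivity
  have hsum0 : 0 ≤ ∑ j ∈ Finset.range M, τ * (1 + R j) := Finset.sum_nonneg fun j _ =>
    mul_nonneg hτ.le (by linarith [hR0 j])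
  set Λ := 1 + normSq N (z 0) + ∑ j ∈ Finset.range M, τ * (1 + R j) with hΛ
  have hΛ1 : 1 ≤ Λ := by linarith [normSq_nonneg N (z 0)]
  rcases Nat.eq_zero_or_pos M with rfl | hM
  · simp only [Finset.range_zero, Finset.sum_empty]
    positivity
  obtain ⟨M, rfl⟩ := Nat.exists_eq_succ_of_ne_zero hM.ne'
  -- The term at time `0` is kept apart: `z 0` has no `Ḣ¹` control.
  rw [Finset.sum_range_succ', add_comm]
  refine add_le_add le_rfl ?_
  have hgn : ∀ j, 0 ≤ τ / 4 * gradSq N (z j) := fun j =>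
    mul_nonneg (by linarith) (gradSq_nonneg _ _)
  have hnorm : ∀ j ∈ Finset.range M, normSq N (z (j + 1)) ≤ A * Λ := fun j hj => by
    have h1 := hE N (M + 1) τ hτ z o hz j ((Finset.mem_range.1 hj).trans (Nat.lt_succ_self M))
    have h2 : 0 ≤ ∑ i ∈ Finset.range j, τ / 4 * gradSq N (z (i + 1)) :=
      Finset.sum_nonneg fun i _ => hgn _
    have h3 : 0 ≤ τ / 2 * gradSq N (z (j + 1)) := mul_nonneg (by linarith) (gradSq_nonneg _ _)
    rw [energy] at h1
    linarith
  have hgrad : ∑ j ∈ Finset.range M, τ / 4 * gradSq N (z (j + 1)) ≤ A * Λ := by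
    have h1 := hE N (M + 1) τ hτ z o hz M (Nat.lt_succ_self M)
    have h3 : 0 ≤ τ / 2 * gradSq N (z (M + 1)) := mul_nonneg (by linarith) (gradSq_nonneg _ _)
    rw [energy] at h1
    linarith [normSq_nonneg N (z (M + 1))]
  have hterm : ∀ j ∈ Finset.range M,
      τ * driftL1 a₀ a₁ a₂ a₃ N (fun n => z (j + 1) n + o (j + 1) n) ^ 2 ≤
        D * (τ * (1 + R (j + 1)) + 4 * (A * Λ) ^ 2 * (τ / 4 * gradSq N (z (j + 1)))) := by
    intro j hj
    have h1 := mul_le_mul_of_nonneg_left (hL N (z (j + 1)) (o (j + 1))) hτ.le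
    have h2 : normSq N (z (j + 1)) ^ 2 ≤ (A * Λ) ^ 2 :=
      pow_le_pow_left₀ (normSq_nonneg _ _) (hnorm j hj) 2
    have h3 := mul_le_mul_of_nonneg_left h2
      (mul_nonneg (mul_nonneg hτ.le hD) (gradSq_nonneg N (z (j + 1))))
    have e : τ * (D * (1 + gradSq N (z (j + 1)) * normSq N (z (j + 1)) ^ 2 + R (j + 1))) =
      D * (τ * (1 + R (j + 1))) + τ * D * gradSq N (z (j + 1)) * normSq N (z (j + 1)) ^ 2 := by ring
    calc _ ≤ _ := h1
      _ = _ := e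
      _ ≤ _ := by linarith
  refine (Finset.sum_le_sum hterm).trans ?_
  rw [← Finset.mul_sum, Finset.sum_add_distrib, ← Finset.mul_sum _ _ (4 * (A * Λ) ^ 2), mul_assoc D]
  refine mul_le_mul_of_nonneg_left ?_ hD
  have hr : ∑ j ∈ Finset.range M, τ * (1 + R (j + 1)) ≤ Λ := by
    rw [Finset.sum_range_succ'] at hΛ
    have : 0 ≤ τ * (1 + R 0) := mul_nonneg hτ.le (by linarith [hR0 0])
    linarith [normSq_nonneg N (z 0)]
  have hΛ3 : Λ ≤ Λ ^ 3 := le_self_pow₀ hΛ1 (by norm_num)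
  -- Squared supremum of `normSq` times the summed dissipation, hence the cube of `Λ`; the factor
  -- `4` undoes the `τ / 4`.
  have h4 := mul_le_mul_of_nonneg_left hgrad (show 0 ≤ 4 * (A * Λ) ^ 2 by positivity)
  linarith [show 4 * (A * Λ) ^ 2 * (A * Λ) = 4 * A ^ 3 * Λ ^ 3 by ring]

end EnergyStep

/-! ### Time integrals against the exponential kernel -/

section TimeIntegral

theorem sq_intervalIntegral_mul_le {u v : ℝ → ℝ} {a b : ℝ} (hab : a ≤ b)
    (huu : IntervalIntegrable (fun r => u r ^ 2) volume a b)
    (huv : IntervalIntegrable (fun r => u r * v r) volume a b)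
    (hvv : IntervalIntegrable (fun r => v r ^ 2) volume a b) :
    (∫ r in a..b, u r * v r) ^ 2 ≤ (∫ r in a..b, u r ^ 2) * ∫ r in a..b, v r ^ 2 := by
  have h : ∀ x : ℝ, 0 ≤ (∫ r in a..b, u r ^ 2) * (x * x) + 2 * (∫ r in a..b, u r * v r) * x +
      ∫ r in a..b, v r ^ 2 := by
    intro x
    have h0 : 0 ≤ ∫ r in a..b, (x * u r + v r) ^ 2 :=
      intervalIntegral.integral_nonneg hab fun r _ => sq_nonneg _
    have e : (fun r => (x * u r + v r) ^ 2) =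
        fun r => (x * x) * u r ^ 2 + (2 * x) * (u r * v r) + v r ^ 2 := by ext r; ring
    rw [e, intervalIntegral.integral_add ((huu.const_mul _).add (huv.const_mul _)) hvv,
      intervalIntegral.integral_add (huu.const_mul _) (huv.const_mul _),
      intervalIntegral.integral_const_mul, intervalIntegral.integral_const_mul] at h0
    linarith
  have := discrim_le_zero h
  rw [discrim] at this
  linarith

theorem integral_expKernel {l : ℝ} (hl : 0 < l) (a b : ℝ) :
    ∫ r in a..b, expKernel l b r = (1 - Real.exp (-(l * (b - a)))) / l := by
  have hd : ∀ r ∈ Set.uIcc a b, HasDerivAt (fun r => expKernel l b r / l) (expKernel l b r) r :=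
    fun r _ => by
      have := (hasDerivAt_expKernel l b r).div_const l
      rwa [mul_div_cancel_left₀ _ hl.ne'] at this
  rw [intervalIntegral.integral_eq_sub_of_hasDerivAt hd
    ((continuous_expKernel l b).intervalIntegrable _ _), ← sub_div]
  simp [expKernel]

theorem integral_expKernel_sq_le {l a b : ℝ} (hl : 0 < l) :
    ∫ r in a..b, expKernel l b r ^ 2 ≤ convVar l a b := by
  have e : ∀ r, expKernel l b r ^ 2 = expKernel (2 * l) b r := fun r => by
    unfold expKernel; rw [← Real.exp_nat_mul]; congr 1; push_cast; ring
  simp_rw [e]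
  rw [integral_expKernel (by positivity)]
  refine le_min ?_ ?_
  · gcongr
    linarith [Real.exp_pos (-(2 * l * (b - a)))]
  · rw [div_le_iff₀ (by positivity), mul_comm]
    exact one_sub_exp_neg_le

theorem intervalIntegrable_step (g : ℕ → ℝ) (τ : ℝ) (a b : ℝ) :
    IntervalIntegrable (fun r => g ⌊r / τ⌋₊) volume a b := by
  have hm : Measurable fun r : ℝ => g ⌊r / τ⌋₊ :=
    measurable_from_nat.comp (Nat.measurable_floor.comp (measurable_id.div_const τ))
  obtain ⟨K, hK⟩ : ∃ K : ℕ, ∀ r ∈ Set.uIoc a b, ⌊r / τ⌋₊ < K := by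
    obtain ⟨x, hx⟩ : ∃ x, ∀ r ∈ Set.uIcc a b, r / τ ≤ x := by
      obtain ⟨x, hx⟩ := (isCompact_uIcc (a := a) (b := b)).exists_bound_of_continuousOn
        (f := fun r => r / τ) (by fun_prop)
      exact ⟨x, fun r hr => (le_abs_self _).trans (hx r hr)⟩
    refine ⟨⌊x⌋₊ + 1, fun r hr => Nat.lt_succ_of_le (Nat.floor_mono (hx r ?_))⟩
    exact Set.uIoc_subset_uIcc hr
  rw [intervalIntegrable_iff]
  refine Measure.integrableOn_of_bounded (M := ∑ m ∈ Finset.range K, |g m|)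
    (by simp [Set.uIoc]) hm.aestronglyMeasurable ?_
  refine (ae_restrict_iff' measurableSet_uIoc).2 (ae_of_all _ fun r hr => ?_)
  exact Finset.single_le_sum (f := fun m => |g m|) (fun m _ => abs_nonneg _)
    (Finset.mem_range.2 (hK r hr))

theorem intervalIntegrable_mul_step {u : ℝ → ℝ} (hu : Continuous u) (g : ℕ → ℝ) (τ : ℝ) (a b : ℝ) :
    IntervalIntegrable (fun r => u r * g ⌊r / τ⌋₊) volume a b :=
  (intervalIntegrable_step g τ a b).continuousOn_mul hu.continuousOn

theorem integral_step {τ : ℝ} (hτ : 0 < τ) (g : ℕ → ℝ) (M : ℕ) :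
    ∫ r in (0 : ℝ)..(M * τ), g ⌊r / τ⌋₊ = ∑ m ∈ Finset.range M, τ * g m := by
  have h := intervalIntegral.sum_integral_adjacent_intervals (μ := volume)
    (f := fun r => g ⌊r / τ⌋₊) (a := fun m : ℕ => (m : ℝ) * τ) (n := M)
    fun k _ => intervalIntegrable_step g τ _ _
  simp only [Nat.cast_zero, zero_mul] at h
  rw [← h]
  refine Finset.sum_congr rfl fun m _ => ?_
  have hle : (m : ℝ) * τ ≤ ((m + 1 : ℕ) : ℝ) * τ := by push_cast; nlinarith
  rw [intervalIntegral.integral_congr_Ioo_of_le (g := fun _ => g m) hle fun r hr => ?_,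
    intervalIntegral.integral_const, smul_eq_mul]
  · push_cast; ring
  · have : ⌊r / τ⌋₊ = m := by
      rw [Nat.floor_eq_iff (div_nonneg ((by positivity : (0 : ℝ) ≤ m * τ).trans hr.1.le) hτ.le),
        le_div_iff₀ hτ, div_lt_iff₀ hτ]
      exact ⟨hr.1.le, by have := hr.2; push_cast at this; linarith⟩
    simp only [this]

/-- Cauchy-Schwarz in time produces the very factor `convVar` that bounds the noise variance, so
drift and noise are treated alike afterwards. The factor `2` in `hg` anticipates `e_n² ≤ 2`. -/
theorem sq_integral_expKernel_mul_step_le {l τ : ℝ} (hl : 0 < l) (hτ : 0 < τ) {g φ : ℕ → ℝ}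
    (hg : ∀ m, g m ^ 2 ≤ 2 * φ m ^ 2) (M : ℕ) {a b : ℝ} (ha : 0 ≤ a) (hab : a ≤ b)
    (hb : b ≤ M * τ) :
    (∫ r in a..b, expKernel l b r * g ⌊r / τ⌋₊) ^ 2 ≤
      convVar l a b * (2 * ∑ m ∈ Finset.range M, τ * φ m ^ 2) := by
  have hc := continuous_expKernel l b
  refine (sq_intervalIntegral_mul_le hab ((hc.pow 2).intervalIntegrable _ _)
    (intervalIntegrable_mul_step hc g τ a b)
    (intervalIntegrable_step (fun m => g m ^ 2) τ a b)).trans ?_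
  refine mul_le_mul (integral_expKernel_sq_le hl) ?_
    (intervalIntegral.integral_nonneg hab fun r _ => sq_nonneg _) (convVar_nonneg hl hab)
  calc ∫ r in a..b, g ⌊r / τ⌋₊ ^ 2 ≤ ∫ r in a..b, 2 * φ ⌊r / τ⌋₊ ^ 2 :=
        intervalIntegral.integral_mono_on hab (intervalIntegrable_step (fun m => g m ^ 2) τ a b)
          (intervalIntegrable_step (fun m => 2 * φ m ^ 2) τ a b) fun r _ => hg _
    _ ≤ ∫ r in (0 : ℝ)..(M * τ), 2 * φ ⌊r / τ⌋₊ ^ 2 :=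
        intervalIntegral.integral_mono_interval ha hab hb
          (Eventually.of_forall fun r => by positivity)
          (intervalIntegrable_step (fun m => 2 * φ m ^ 2) τ _ _)
    _ = 2 * ∑ m ∈ Finset.range M, τ * φ m ^ 2 := by
        rw [integral_step hτ (fun m => 2 * φ m ^ 2), Finset.mul_sum]
        exact Finset.sum_congr rfl fun m _ => by ring

/-- Variance bound for the increments over `[s,t]` of a convolution started at `0`. -/
def incVar (l s t : ℝ) : ℝ :=
  (1 - Real.exp (-(l * (t - s)))) ^ 2 * convVar l 0 s + convVar l s t

theorem min_one_le_rpow {x θ : ℝ} (hx : 0 < x) (h0 : 0 ≤ θ) (h1 : θ ≤ 1) : min 1 x ≤ x ^ θ := by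
  rcases le_total x 1 with h | h
  · rw [min_eq_right h]
    simpa using Real.rpow_le_rpow_of_exponent_ge hx h h1
  · rw [min_eq_left h]
    exact Real.one_le_rpow h h0

theorem sq_one_sub_exp_le {x θ : ℝ} (hx : 0 < x) (h0 : 0 ≤ θ) (h1 : θ ≤ 1) :
    (1 - Real.exp (-x)) ^ 2 ≤ x ^ θ := by
  have ha : 0 ≤ 1 - Real.exp (-x) := by
    linarith [Real.exp_le_one_iff.2 (show -x ≤ 0 by linarith)]
  have hb : 1 - Real.exp (-x) ≤ 1 := by linarith [Real.exp_pos (-x)]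
  refine le_trans ?_ (min_one_le_rpow hx h0 h1)
  refine le_min (pow_le_one₀ ha hb) ?_
  calc (1 - Real.exp (-x)) ^ 2 ≤ 1 - Real.exp (-x) := by nlinarith
    _ ≤ x := one_sub_exp_neg_le

/-- Each summand is `l⁻¹` times a quantity below `min 1 (l (t - s))`, and `min 1 x ≤ x^θ` for `θ ∈
[0,1]`. -/
theorem incVar_le {l s t θ : ℝ} (hl : 0 < l) (hst : s < t) (h0 : 0 ≤ θ) (h1 : θ ≤ 1) :
    incVar l s t ≤ 2 * (l⁻¹ * (l * (t - s)) ^ θ) := by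
  have hx : 0 < l * (t - s) := mul_pos hl (sub_pos.2 hst)
  have hli : 0 < l⁻¹ := inv_pos.2 hl
  have h2 : convVar l 0 s ≤ l⁻¹ := (min_le_left _ _).trans (by
    rw [one_div]; exact inv_anti₀ hl (by linarith))
  have h3 : convVar l s t ≤ l⁻¹ * (l * (t - s)) ^ θ := by
    refine le_trans ?_ (mul_le_mul_of_nonneg_left (min_one_le_rpow hx h0 h1) hli.le)
    rw [mul_min_of_nonneg _ _ hli.le, mul_one, inv_mul_cancel_left₀ hl.ne']
    refine min_le_min ?_ le_rfl
    rw [one_div]; exact inv_anti₀ hl (by linarith)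
  have h4 : (1 - Real.exp (-(l * (t - s)))) ^ 2 * convVar l 0 s ≤ l⁻¹ * (l * (t - s)) ^ θ := by
    rw [mul_comm l⁻¹]
    calc _ ≤ (1 - Real.exp (-(l * (t - s)))) ^ 2 * l⁻¹ :=
          mul_le_mul_of_nonneg_left h2 (sq_nonneg _)
      _ ≤ _ := mul_le_mul_of_nonneg_right (sq_one_sub_exp_le hx h0 h1) hli.le
  rw [incVar]; linarith

/-- Increments of the drift convolution of a step function. -/
theorem sq_integral_expKernel_mul_step_sub_le {l τ : ℝ} (hl : 0 < l) (hτ : 0 < τ) {g φ : ℕ → ℝ}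
    (hg : ∀ m, g m ^ 2 ≤ 2 * φ m ^ 2) (M : ℕ) {s t : ℝ} (hs : 0 ≤ s) (hst : s ≤ t)
    (ht : t ≤ M * τ) :
    ((∫ r in (0 : ℝ)..t, expKernel l t r * g ⌊r / τ⌋₊) -
      ∫ r in (0 : ℝ)..s, expKernel l s r * g ⌊r / τ⌋₊) ^ 2 ≤
      4 * incVar l s t * ∑ m ∈ Finset.range M, τ * φ m ^ 2 := by
  have hI : ∫ r in (0 : ℝ)..s, expKernel l t r * g ⌊r / τ⌋₊ =
      Real.exp (-(l * (t - s))) * ∫ r in (0 : ℝ)..s, expKernel l s r * g ⌊r / τ⌋₊ := by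
    rw [← intervalIntegral.integral_const_mul]
    congr 1; ext r; rw [expKernel_trans l s t r]; ring
  have h1 := sq_integral_expKernel_mul_step_le hl hτ hg M le_rfl hs (hst.trans ht)
  have h2 := sq_integral_expKernel_mul_step_le hl hτ hg M hs hst ht
  rw [← intervalIntegral.integral_add_adjacent_intervals (b := s)
    (intervalIntegrable_mul_step (continuous_expKernel l t) g τ _ _)
    (intervalIntegrable_mul_step (continuous_expKernel l t) g τ _ _), hI, incVar]
  set D := ∫ r in (0 : ℝ)..s, expKernel l s r * g ⌊r / τ⌋₊
  set J := ∫ r in s..t, expKernel l t r * g ⌊r / τ⌋₊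
  set a := Real.exp (-(l * (t - s)))
  have h3 := mul_le_mul_of_nonneg_left h1 (sq_nonneg (1 - a))
  -- The increment is `J - (1 - a) D`; the factor `2` of this splitting and the `2` of `hg` make up
  -- the constant `4`.
  have h4 : (a * D + J - D) ^ 2 ≤ 2 * ((1 - a) ^ 2 * D ^ 2) + 2 * J ^ 2 := by
    linarith [sq_nonneg ((1 - a) * D + J), show 2 * ((1 - a) ^ 2 * D ^ 2) + 2 * J ^ 2 =
      (a * D + J - D) ^ 2 + ((1 - a) * D + J) ^ 2 by ring]
  linarith

end TimeIntegral

/-! ### The scheme in coordinates -/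

section Coordinates

variable {Ω : Type*} {mΩ : MeasurableSpace Ω} (P : Measure Ω) (B : ℕ → ℝ → Ω → ℝ)
  (a₀ a₁ a₂ a₃ : ℝ)

/-- The element `∑_{n < N} c_n e_n` of `H`. -/
def combo (N : ℕ) (c : ℕ → ℝ) : H := ∑ n ∈ Finset.range N, c n • e n

theorem e_ae_eq (n : ℕ) : e n =ᵐ[μD] eigenfunction n := (memLp_eigenfunction n).coeFn_toLp

theorem inner_e_eq_integral (n : ℕ) {v : H} {f : ℝ → ℝ} (hv : v =ᵐ[μD] f) :
    inner ℝ (e n) v = ∫ x, f x * eigenfunction n x ∂μD := by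
  rw [L2.inner_def]
  refine integral_congr_ae ?_
  filter_upwards [hv, e_ae_eq n] with x h1 h2
  rw [h1, h2]
  simp

theorem inner_e_e (n m : ℕ) : inner ℝ (e n) (e m) = if n = m then 1 else 0 := by
  rw [inner_e_eq_integral n (e_ae_eq m), integral_eigenfunction_mul]
  exact if_congr eq_comm rfl rfl

theorem inner_e_combo (N : ℕ) (c : ℕ → ℝ) (n : ℕ) :
    inner ℝ (e n) (combo N c) = if n < N then c n else 0 := by
  simp [combo, inner_sum, inner_smul_right, inner_e_e]

theorem combo_congr {N : ℕ} {c d : ℕ → ℝ} (h : ∀ n < N, c n = d n) : combo N c = combo N d :=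
  Finset.sum_congr rfl fun n hn => by rw [h n (Finset.mem_range.1 hn)]

theorem combo_add (N : ℕ) (c d : ℕ → ℝ) :
    combo N c + combo N d = combo N fun n => c n + d n := by
  simp [combo, add_smul, Finset.sum_add_distrib]

theorem combo_sub (N : ℕ) (c d : ℕ → ℝ) :
    combo N c - combo N d = combo N fun n => c n - d n := by
  simp [combo, sub_smul, Finset.sum_sub_distrib]

theorem smul_combo (N : ℕ) (r : ℝ) (c : ℕ → ℝ) : r • combo N c = combo N fun n => r * c n := by
  simp [combo, Finset.smul_sum, smul_smul]

theorem norm_combo (N : ℕ) (c : ℕ → ℝ) : ‖combo N c‖ = √(normSq N c) := by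
  rw [norm_eq_sqrt_real_inner (combo N c)]
  congr 1
  conv_lhs => rw [show inner ℝ (combo N c) (combo N c) =
    inner ℝ (∑ n ∈ Finset.range N, c n • e n) (combo N c) from rfl]
  rw [sum_inner]
  refine Finset.sum_congr rfl fun n hn => ?_
  rw [inner_smul_left, inner_e_combo, if_pos (Finset.mem_range.1 hn), sq]
  rfl

theorem combo_ae_eq (N : ℕ) (c : ℕ → ℝ) : combo N c =ᵐ[μD] sinePoly N c := by
  induction N with
  | zero =>
    simp only [combo, Finset.range_zero, Finset.sum_empty]
    filter_upwards [Lp.coeFn_zero ℝ 2 μD] with x hx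
    rw [hx]; simp [sinePoly]
  | succ N ih =>
    have h : combo (N + 1) c = combo N c + c N • e N := Finset.sum_range_succ _ _
    rw [h]
    filter_upwards [ih, Lp.coeFn_add (combo N c) (c N • e N), Lp.coeFn_smul (c N) (e N),
      e_ae_eq N] with x h1 h2 h3 h4
    rw [h2, Pi.add_apply, h1, h3, Pi.smul_apply, h4, sinePoly, sinePoly, Finset.sum_range_succ,
      smul_eq_mul]

/-- A sine polynomial is bounded, hence in `L⁶`, so the default value `0` of `nemytskii` never
enters the scheme. -/
theorem nemytskii_combo (N : ℕ) (c : ℕ → ℝ) :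
    nemytskii a₀ a₁ a₂ a₃ (combo N c) =ᵐ[μD] fun x => cubic a₀ a₁ a₂ a₃ (sinePoly N c x) := by
  refine (nemytskii_of_memLp a₀ a₁ a₂ a₃ (combo N c) ?_).trans ?_
  · refine MemLp.ae_eq (combo_ae_eq N c).symm ?_
    refine MemLp.of_bound (C := √(2 * (∑ n ∈ Finset.range N, |c n|) ^ 2))
      (continuous_sinePoly N c).aestronglyMeasurable (ae_of_all _ fun x => ?_)
    exact Real.abs_le_sqrt (sinePoly_sq_le N c x)
  · filter_upwards [combo_ae_eq N c] with x hx
    rw [hx]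

theorem galerkinProj_eq (N : ℕ) (v : H) : galerkinProj N v = combo N fun n => inner ℝ (e n) v := rfl

theorem galerkinSemigroup_combo (N : ℕ) (t : ℝ) (c : ℕ → ℝ) :
    galerkinSemigroup N t (combo N c) = combo N fun n => Real.exp (-(eigenvalue n * t)) * c n := by
  refine Finset.sum_congr rfl fun n hn => ?_
  rw [inner_e_combo, if_pos (Finset.mem_range.1 hn)]

theorem tamedDrift_combo (N : ℕ) (τ : ℝ) (c : ℕ → ℝ) :
    tamedDrift a₀ a₁ a₂ a₃ N τ (combo N c) = combo N (tamedCoef a₀ a₁ a₂ a₃ N τ c) := by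
  have h : galerkinProj N (nemytskii a₀ a₁ a₂ a₃ (combo N c)) =
      combo N (driftCoef a₀ a₁ a₂ a₃ N c) := by
    rw [galerkinProj_eq]
    exact combo_congr fun n _ => inner_e_eq_integral n (nemytskii_combo a₀ a₁ a₂ a₃ N c)
  rw [tamedDrift, h, norm_combo, smul_combo]
  rfl

theorem stochConv_eq (N : ℕ) (a b : ℝ) (ω : Ω) :
    stochConv P B N a b ω = combo N fun n => noiseCoef P B n a b ω := rfl

theorem integral_combo (N : ℕ) {f : ℕ → ℝ → ℝ} {a b : ℝ}
    (hf : ∀ n, IntervalIntegrable (f n) volume a b) :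
    ∫ r in a..b, combo N (fun n => f n r) = combo N fun n => ∫ r in a..b, f n r := by
  simp only [combo]
  rw [intervalIntegral.integral_finsetSum fun n _ =>
    ⟨(hf n).1.smul_const _, (hf n).2.smul_const _⟩]
  exact Finset.sum_congr rfl fun n _ => intervalIntegral.integral_smul_const _ _

/-- The coordinates of the scheme. -/
def schemeCoef (X₀ : Ω → H) (N : ℕ) (τ : ℝ) : ℕ → Ω → ℕ → ℝ
  | 0, ω, n => inner ℝ (e n) (X₀ ω)
  | m + 1, ω, n => expStep (eigenvalue n) τ (schemeCoef X₀ N τ m ω n)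
      (tamedCoef a₀ a₁ a₂ a₃ N τ (schemeCoef X₀ N τ m ω) n) +
        noiseCoef P B n (m * τ) ((m + 1) * τ) ω

theorem scheme_eq (X₀ : Ω → H) (N : ℕ) (τ : ℝ) (m : ℕ) (ω : Ω) :
    scheme P B a₀ a₁ a₂ a₃ X₀ N τ m ω =
      combo N (schemeCoef P B a₀ a₁ a₂ a₃ X₀ N τ m ω) := by
  induction m with
  | zero => rfl
  | succ m ih =>
    rw [scheme, ih, tamedDrift_combo, stochConv_eq]
    simp only [galerkinSemigroup_combo]
    rw [integral_combo N fun n => Continuous.intervalIntegrable (by fun_prop) _ _, combo_add,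
      combo_add]
    refine combo_congr fun n _ => ?_
    rw [intervalIntegral.integral_mul_const]
    have h := integral_expKernel (eigenvalue_pos n) (m * τ) ((m + 1) * τ)
    simp only [expKernel] at h
    rw [h, schemeCoef, expStep, show ((m : ℝ) + 1) * τ - m * τ = τ by ring]

/-- The coordinates of the interpolant. -/
def interpCoef (X₀ : Ω → H) (N : ℕ) (τ t : ℝ) (ω : Ω) (n : ℕ) : ℝ :=
  Real.exp (-(eigenvalue n * t)) * inner ℝ (e n) (X₀ ω) +
    (∫ r in (0 : ℝ)..t, expKernel (eigenvalue n) t r *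
      tamedCoef a₀ a₁ a₂ a₃ N τ (schemeCoef P B a₀ a₁ a₂ a₃ X₀ N τ ⌊r / τ⌋₊ ω) n) +
    noiseCoef P B n 0 t ω

theorem interpolant_eq (X₀ : Ω → H) (N : ℕ) (τ t : ℝ) (ω : Ω) :
    interpolant P B a₀ a₁ a₂ a₃ X₀ N τ t ω =
      combo N (interpCoef P B a₀ a₁ a₂ a₃ X₀ N τ t ω) := by
  rw [interpolant, stochConv_eq]
  simp only [scheme_eq, tamedDrift_combo, galerkinSemigroup_combo]
  have he : ∀ n r, Real.exp (-(eigenvalue n * (t - r))) = expKernel (eigenvalue n) t r :=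
    fun _ _ => rfl
  simp only [he]
  rw [integral_combo N fun n => intervalIntegrable_mul_step
    (continuous_expKernel (eigenvalue n) t)
    (fun m => tamedCoef a₀ a₁ a₂ a₃ N τ (schemeCoef P B a₀ a₁ a₂ a₃ X₀ N τ m ω) n) τ 0 t,
    combo_add, combo_add]
  rfl

theorem sobolevENorm_combo (γ : ℝ) (N : ℕ) (c : ℕ → ℝ) :
    sobolevENorm γ (combo N c) =
      ENNReal.ofReal (∑ n ∈ Finset.range N, eigenvalue n ^ γ * c n ^ 2) ^ (1 / 2 : ℝ) := by
  have hnn : ∀ n, 0 ≤ eigenvalue n ^ γ * c n ^ 2 := fun n =>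
    mul_nonneg (Real.rpow_nonneg (eigenvalue_pos n).le _) (sq_nonneg _)
  rw [sobolevENorm, tsum_eq_sum (s := Finset.range N), ENNReal.ofReal_sum_of_nonneg
    fun n _ => hnn n]
  · congr 1
    refine Finset.sum_congr rfl fun n hn => ?_
    rw [inner_e_combo, if_pos (Finset.mem_range.1 hn)]
  · intro n hn
    rw [inner_e_combo, if_neg (by simpa using hn)]
    simp

/-- The accumulated noise of the scheme. -/
def noiseRec (τ : ℝ) : ℕ → Ω → ℕ → ℝ
  | 0, _, _ => 0
  | m + 1, ω, n => Real.exp (-(eigenvalue n * τ)) * noiseRec τ m ω n +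
      noiseCoef P B n (m * τ) ((m + 1) * τ) ω

/-- The noise enters additively and is propagated by the same semigroup, so it drops out of the
difference. The deterministic energy estimate then applies for each `ω`. -/
theorem schemeCoef_sub_noiseRec (X₀ : Ω → H) (N : ℕ) (τ : ℝ) (m : ℕ) (ω : Ω) (n : ℕ) :
    schemeCoef P B a₀ a₁ a₂ a₃ X₀ N τ (m + 1) ω n - noiseRec P B τ (m + 1) ω n =
      expStep (eigenvalue n) τ
        (schemeCoef P B a₀ a₁ a₂ a₃ X₀ N τ m ω n - noiseRec P B τ m ω n)
        (tamedCoef a₀ a₁ a₂ a₃ N τ (schemeCoef P B a₀ a₁ a₂ a₃ X₀ N τ m ω) n) := by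
  simp only [schemeCoef, noiseRec, expStep]
  ring

end Coordinates

/-! ### Measurability and moments -/

section Moments

variable {Ω : Type*} {mΩ : MeasurableSpace Ω} {P : Measure Ω} {B : ℕ → ℝ → Ω → ℝ}
  {T : ℝ} {ℱ : Filtration ℝ mΩ} (a₀ a₁ a₂ a₃ : ℝ)

theorem measurable_sinePoly_uncurry (N : ℕ) :
    Measurable fun p : (ℕ → ℝ) × ℝ => sinePoly N p.1 p.2 := by
  unfold sinePoly
  refine Finset.measurable_fun_sum _ fun n _ => Measurable.mul ?_ ?_
  · exact (measurable_pi_apply n).comp measurable_fst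
  · exact (continuous_eigenfunction n).measurable.comp measurable_snd

theorem measurable_driftCoef (N n : ℕ) : Measurable fun y => driftCoef a₀ a₁ a₂ a₃ N y n := by
  refine (StronglyMeasurable.integral_prod_right' (f := fun p : (ℕ → ℝ) × ℝ =>
    cubic a₀ a₁ a₂ a₃ (sinePoly N p.1 p.2) * eigenfunction n p.2) ?_).measurable
  exact (((continuous_cubic a₀ a₁ a₂ a₃).measurable.comp (measurable_sinePoly_uncurry N)).mul
    ((continuous_eigenfunction n).measurable.comp measurable_snd)).stronglyMeasurable

theorem measurable_driftL1 (N : ℕ) : Measurable fun y => driftL1 a₀ a₁ a₂ a₃ N y := by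
  refine (StronglyMeasurable.integral_prod_right' (f := fun p : (ℕ → ℝ) × ℝ =>
    |cubic a₀ a₁ a₂ a₃ (sinePoly N p.1 p.2)|) ?_).measurable
  exact (continuous_abs.measurable.comp ((continuous_cubic a₀ a₁ a₂ a₃).measurable.comp
    (measurable_sinePoly_uncurry N))).stronglyMeasurable

theorem measurable_integral_sinePoly_pow (N k : ℕ) :
    Measurable fun y => ∫ x, sinePoly N y x ^ k ∂μD :=
  (StronglyMeasurable.integral_prod_right' (f := fun p : (ℕ → ℝ) × ℝ => sinePoly N p.1 p.2 ^ k)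
    ((measurable_sinePoly_uncurry N).pow_const k).stronglyMeasurable).measurable

theorem measurable_tamedCoef (N : ℕ) (τ : ℝ) (n : ℕ) :
    Measurable fun y => tamedCoef a₀ a₁ a₂ a₃ N τ y n := by
  have h := measurable_driftCoef a₀ a₁ a₂ a₃ N
  unfold tamedCoef driftNorm normSq
  have h2 : Measurable fun y => ∑ n ∈ Finset.range N, driftCoef a₀ a₁ a₂ a₃ N y n ^ 2 :=
    Finset.measurable_fun_sum _ fun n _ => (h n).pow_const 2
  exact ((h2.sqrt.const_mul τ).const_add 1).inv.mul (h n)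

theorem aemeasurable_noiseRec (τ : ℝ) (m : ℕ) : AEMeasurable (noiseRec P B τ m) P := by
  induction m with
  | zero => exact measurable_const.aemeasurable
  | succ m ih =>
    refine aemeasurable_pi_iff.2 fun n => ?_
    exact ((aemeasurable_pi_iff.1 ih n).const_mul _).add
      (aestronglyMeasurable_noiseCoef n _ _).aemeasurable

variable {X₀ : Ω → H}

theorem aemeasurable_inner_e (hX : AEStronglyMeasurable X₀ P) (n : ℕ) :
    AEMeasurable (fun ω => inner ℝ (e n) (X₀ ω)) P :=
  (hX.const_inner (𝕜 := ℝ) (c := e n)).aemeasurable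

theorem aemeasurable_schemeCoef (hX : AEStronglyMeasurable X₀ P) (N : ℕ) (τ : ℝ) (m : ℕ) :
    AEMeasurable (schemeCoef P B a₀ a₁ a₂ a₃ X₀ N τ m) P := by
  induction m with
  | zero => exact aemeasurable_pi_iff.2 fun n => aemeasurable_inner_e hX n
  | succ m ih =>
    refine aemeasurable_pi_iff.2 fun n => ?_
    refine AEMeasurable.add ?_ (aestronglyMeasurable_noiseCoef n _ _).aemeasurable
    exact ((aemeasurable_pi_iff.1 ih n).const_mul _).add
      (((measurable_tamedCoef a₀ a₁ a₂ a₃ N τ n).comp_aemeasurable ih).const_mul _)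

/-- A finite combination of the `g m` with deterministic weights, through which measurability in `ω`
passes to the drift integral. -/
theorem integral_mul_step_eq_sum {u : ℝ → ℝ} (hu : Continuous u) {τ t : ℝ} (hτ : 0 < τ)
    (ht : 0 ≤ t) (g : ℕ → ℝ) :
    ∫ r in (0 : ℝ)..t, u r * g ⌊r / τ⌋₊ = ∑ m ∈ Finset.range (⌊t / τ⌋₊ + 1),
      (∫ r in (0 : ℝ)..t, u r * (fun j : ℕ => if j = m then (1 : ℝ) else 0) ⌊r / τ⌋₊) * g m := by
  have h : ∀ m, IntervalIntegrable
      (fun r => u r * (fun j : ℕ => if j = m then (1 : ℝ) else 0) ⌊r / τ⌋₊ * g m) volume 0 t :=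
    fun m => (intervalIntegrable_mul_step hu (fun j => if j = m then (1 : ℝ) else 0) τ 0 t).mul_const _
  simp_rw [← intervalIntegral.integral_mul_const]
  rw [← intervalIntegral.integral_finsetSum fun m _ => h m]
  refine intervalIntegral.integral_congr fun r hr => ?_
  rw [Set.uIcc_of_le ht] at hr
  have hm : ⌊r / τ⌋₊ < ⌊t / τ⌋₊ + 1 :=
    Nat.lt_succ_of_le (Nat.floor_mono (div_le_div_of_nonneg_right hr.2 hτ.le))
  simp [hm]

theorem aemeasurable_interpCoef (hX : AEStronglyMeasurable X₀ P) (N : ℕ) {τ t : ℝ} (hτ : 0 < τ)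
    (ht : 0 ≤ t) (n : ℕ) :
    AEMeasurable (fun ω => interpCoef P B a₀ a₁ a₂ a₃ X₀ N τ t ω n) P := by
  refine AEMeasurable.add (AEMeasurable.add ((aemeasurable_inner_e hX n).const_mul _) ?_)
    (aestronglyMeasurable_noiseCoef n _ _).aemeasurable
  have h : ∀ ω, _ := fun ω => integral_mul_step_eq_sum (continuous_expKernel (eigenvalue n) t) hτ ht
    fun m => tamedCoef a₀ a₁ a₂ a₃ N τ (schemeCoef P B a₀ a₁ a₂ a₃ X₀ N τ m ω) n
  simp only [h]
  exact Finset.aemeasurable_fun_sum _ fun m _ => AEMeasurable.const_mul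
    ((measurable_tamedCoef a₀ a₁ a₂ a₃ N τ n).comp_aemeasurable
      (aemeasurable_schemeCoef a₀ a₁ a₂ a₃ hX N τ m)) _

/-- Induction with the flow property. The accumulated noise is one convolution started at `0`, so
its variance is bounded by `1/(2λ)` whatever `τ` and `m`. -/
theorem noiseRec_ae_eq [IsProbabilityMeasure P] (hW : IsCylindricalWiener P T ℱ B) {τ : ℝ}
    (hτ : 0 < τ) (n m : ℕ) (hm : m * τ ≤ T) :
    ∀ᵐ ω ∂P, noiseRec P B τ m ω n = noiseCoef P B n 0 (m * τ) ω := by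
  induction m with
  | zero =>
    simp only [Nat.cast_zero, zero_mul] at hm ⊢
    filter_upwards [noiseCoef_ae_eq hW n le_rfl le_rfl hm] with ω h
    rw [h]
    simp [noiseRec, pathConv, pathIntegral]
  | succ m ih =>
    have h1 : (m : ℝ) * τ ≤ ((m + 1 : ℕ) : ℝ) * τ := by push_cast; nlinarith
    filter_upwards [ih (h1.trans hm), noiseCoef_trans hW n le_rfl (by positivity) h1 hm]
      with ω h2 h3
    rw [h3, noiseRec, h2]
    push_cast
    rw [show ((m : ℝ) + 1) * τ - m * τ = τ by ring]

theorem eLpNorm_pow {α : Type*} {mα : MeasurableSpace α} (μ : Measure α) (f : α → ℝ) (q : ℝ≥0∞)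
    {n : ℕ} (hn : 0 < n) :
    eLpNorm (fun x => f x ^ n) q μ = eLpNorm f (q * n) μ ^ n := by
  have h := eLpNorm_norm_rpow (p := q) (μ := μ) f (q := (n : ℝ)) (by exact_mod_cast hn)
  rw [ENNReal.ofReal_natCast, ENNReal.rpow_natCast] at h
  rw [← h, ← eLpNorm_norm (fun x => f x ^ n)]
  congr 1; ext x
  simp

theorem eLpNorm_le_of_enorm_le_pow {f : Ω → ℝ} {g : Ω → ℝ≥0∞} {n : ℕ} (hn : 0 < n)
    (h : ∀ ω, ‖f ω‖ₑ ≤ g ω ^ n) (q : ℝ≥0∞) : eLpNorm f q P ≤ eLpNorm g (q * n) P ^ n := by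
  have h1 := eLpNorm_enorm_rpow (p := q) (μ := P) g (q := (n : ℝ)) (by exact_mod_cast hn)
  rw [ENNReal.ofReal_natCast, ENNReal.rpow_natCast] at h1
  rw [← h1]
  exact eLpNorm_mono_enorm fun ω => by simpa using h ω

theorem enorm_integral_pow_le (N : ℕ) (c : ℕ → ℝ) :
    ‖∫ x, sinePoly N c x ^ 6 ∂μD‖ₑ ≤ eLpNorm (sinePoly N c) 6 μD ^ 6 := by
  refine (enorm_integral_le_lintegral_enorm _).trans (le_of_eq ?_)
  rw [← eLpNorm_one_eq_lintegral_enorm, eLpNorm_pow _ _ _ (by norm_num)]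
  norm_num

theorem eLpNorm_sinePoly_le_supENorm (N : ℕ) (c : ℕ → ℝ) :
    eLpNorm (sinePoly N c) 6 μD ≤ supENorm (combo N c) := by
  refine le_iInf fun g => le_iInf fun _ => le_iInf fun hg => ?_
  refine (eLpNorm_le_eLpNorm_of_exponent_le le_top
    (continuous_sinePoly N c).aestronglyMeasurable).trans ?_
  rw [eLpNorm_exponent_top]
  refine eLpNormEssSup_le_of_ae_enorm_bound ?_
  filter_upwards [hg, combo_ae_eq N c, ae_restrict_mem measurableSet_Ioo] with x h1 h2 h3
  rw [← h2, h1]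
  exact le_iSup₂ (f := fun x (_ : x ∈ Set.Ioo (0 : ℝ) 1) => ‖g x‖ₑ) x h3

theorem eLpNorm_natCast_pow {α ε : Type*} {mα : MeasurableSpace α} [TopologicalSpace ε]
    [ContinuousENorm ε] (μ : Measure α) (f : α → ε) {n : ℕ} (hn : n ≠ 0) :
    eLpNorm f n μ ^ n = ∫⁻ x, ‖f x‖ₑ ^ n ∂μ := by
  have h := eLpNorm_nnreal_pow_eq_lintegral (f := f) (μ := μ) (p := (n : ℝ≥0))
    (by exact_mod_cast hn)
  simpa using h

/-- The constant bounding the moments of the noise. -/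
def noiseMoment (q : ℕ) : ℝ≥0∞ :=
  (ENNReal.ofReal (√(∑' n, eigenvalue n ^ (-1 : ℝ))) * gaussianMoment ((6 * q : ℕ) : ℝ≥0∞)) ^ 6

theorem noiseMoment_lt_top (q : ℕ) : noiseMoment q < ∞ :=
  ENNReal.pow_lt_top (ENNReal.mul_lt_top ENNReal.ofReal_lt_top
    (gaussianMoment_lt_top (ENNReal.natCast_ne_top _)))

/-- Moments of the space integral of the sixth power of the noise, uniformly in the
discretization. -/
theorem eLpNorm_integral_noise_le [IsProbabilityMeasure P] (hW : IsCylindricalWiener P T ℱ B)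
    {q : ℕ} (hq : 0 < q) (N : ℕ) {τ : ℝ} (hτ : 0 < τ) (m : ℕ) (hm : m * τ ≤ T) :
    eLpNorm (fun ω => ∫ x, sinePoly N (noiseRec P B τ m ω) x ^ 6 ∂μD) q P ≤ noiseMoment q := by
  have hs := summable_eigenvalue_rpow (s := -1) (by norm_num)
  rw [noiseMoment]
  set A := ∑' n, eigenvalue n ^ (-1 : ℝ) with hA
  set K := ENNReal.ofReal (√A) * gaussianMoment ((6 * q : ℕ) : ℝ≥0∞) with hK
  have h6q : 6 * q ≠ 0 := by omega
  -- For fixed `x` the Gaussian bound applies with coefficients `e_n(x)`; since `e_n(x)² ≤ 2`, the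
  -- variance is at most `∑ 2/(2λ_n) = ∑ λ_n⁻¹`, independently of `x`, `N`, `τ` and `m`.
  have hpt : ∀ x, ∫⁻ ω, ‖sinePoly N (noiseRec P B τ m ω) x‖ₑ ^ (6 * q) ∂P ≤ K ^ (6 * q) := by
    intro x
    rw [← eLpNorm_natCast_pow _ _ h6q]
    refine pow_le_pow_left' ?_ (6 * q)
    refine le_of_eq_of_le (eLpNorm_congr_ae ?_) ((eLpNorm_sum_noiseCoef_le hW
      (fun n => eigenfunction n x) N le_rfl (by positivity) hm (6 * q : ℕ)).trans ?_)
    · filter_upwards [ae_all_iff.2 fun n => noiseRec_ae_eq hW hτ n m hm] with ω h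
      exact Finset.sum_congr rfl fun n _ => by rw [h n, mul_comm]
    · rw [hK]
      gcongr
      refine (Finset.sum_le_sum fun n _ => ?_).trans
        (hs.sum_le_tsum (Finset.range N) fun n _ => Real.rpow_nonneg (eigenvalue_pos n).le _)
      have h2 : convVar (eigenvalue n) 0 (m * τ) ≤ 1 / (2 * eigenvalue n) := min_le_left _ _
      calc eigenfunction n x ^ 2 * convVar (eigenvalue n) 0 (m * τ)
          ≤ 2 * (1 / (2 * eigenvalue n)) := mul_le_mul (eigenfunction_sq_le n x) h2
            (convVar_nonneg (eigenvalue_pos n) (by positivity)) (by norm_num)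
        _ = eigenvalue n ^ (-1 : ℝ) := by
            rw [Real.rpow_neg_one]; have := (eigenvalue_pos n).ne'; field_simp
  have hmeas : AEMeasurable (fun p : Ω × ℝ =>
      ‖sinePoly N (noiseRec P B τ m p.1) p.2‖ₑ ^ (6 * q)) (P.prod μD) := by
    refine (AEMeasurable.enorm ?_).pow_const _
    exact (measurable_sinePoly_uncurry N).comp_aemeasurable
      ((aemeasurable_noiseRec τ m).comp_fst.prodMk measurable_snd.aemeasurable)
  refine (ENNReal.pow_right_strictMono hq.ne').le_iff_le.1 ?_
  rw [eLpNorm_natCast_pow _ _ hq.ne', ← pow_mul]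
  -- Monotonicity of `L^q` norms on the unit interval, then Tonelli, reduces to the pointwise bound.
  calc ∫⁻ ω, ‖∫ x, sinePoly N (noiseRec P B τ m ω) x ^ 6 ∂μD‖ₑ ^ q ∂P
      ≤ ∫⁻ ω, ∫⁻ x, ‖sinePoly N (noiseRec P B τ m ω) x‖ₑ ^ (6 * q) ∂μD ∂P := by
        refine lintegral_mono fun ω => ?_
        refine (pow_le_pow_left' (enorm_integral_pow_le N _) q).trans ?_
        rw [← eLpNorm_natCast_pow _ _ h6q, ← pow_mul]
        refine pow_le_pow_left' (eLpNorm_le_eLpNorm_of_exponent_le ?_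
          (continuous_sinePoly N _).aestronglyMeasurable) _
        exact_mod_cast (show 6 ≤ 6 * q by omega)
    _ = ∫⁻ x, ∫⁻ ω, ‖sinePoly N (noiseRec P B τ m ω) x‖ₑ ^ (6 * q) ∂P ∂μD :=
        lintegral_lintegral_swap hmeas
    _ ≤ ∫⁻ _, K ^ (6 * q) ∂μD := lintegral_mono fun x => hpt x
    _ = K ^ (6 * q) := by simp

end Moments

/-! ### Moments of the noise increments and of the drift along the scheme. -/

section Regularity

variable {Ω : Type*} {mΩ : MeasurableSpace Ω} {P : Measure Ω} {B : ℕ → ℝ → Ω → ℝ}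
  {T : ℝ} {ℱ : Filtration ℝ mΩ} {X₀ : Ω → H}

theorem eLpNorm_const_mul_real (c : ℝ) (f : Ω → ℝ) (q : ℝ≥0∞) :
    eLpNorm (fun ω => c * f ω) q P = ‖c‖ₑ * eLpNorm f q P :=
  eLpNorm_const_smul c f q P

theorem eLpNorm_one_le [IsProbabilityMeasure P] (q : ℝ≥0∞) :
    eLpNorm (fun _ : Ω => (1 : ℝ)) q P ≤ 1 := by
  rcases eq_or_ne q 0 with rfl | hq
  · simp
  · rw [eLpNorm_const _ hq (IsProbabilityMeasure.ne_zero P)]; simp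

/-- By the flow property the increment is `-(1 - a)` times the convolution over `[0,s]` plus the one
over `[s,t]`. Minkowski's inequality and `√u + √v ≤ √(2(u + v))` give the bound. -/
theorem eLpNorm_noiseCoef_sub_le [IsProbabilityMeasure P] (hW : IsCylindricalWiener P T ℱ B)
    (n : ℕ) {s t : ℝ} (hs : 0 ≤ s) (hst : s ≤ t) (ht : t ≤ T) {q : ℝ≥0∞} (hq : 1 ≤ q) :
    eLpNorm (fun ω => noiseCoef P B n 0 t ω - noiseCoef P B n 0 s ω) q P ≤
      ENNReal.ofReal (√(2 * incVar (eigenvalue n) s t)) * gaussianMoment q := by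
  set l := eigenvalue n
  have hl : 0 < l := eigenvalue_pos n
  set a := Real.exp (-(l * (t - s))) with ha
  have ha1 : a ≤ 1 := Real.exp_le_one_iff.2 (by nlinarith)
  have h1 : (fun ω => noiseCoef P B n 0 t ω - noiseCoef P B n 0 s ω) =ᵐ[P]
      fun ω => (a - 1) * noiseCoef P B n 0 s ω + noiseCoef P B n s t ω := by
    filter_upwards [noiseCoef_trans hW n le_rfl hs hst ht] with ω h
    rw [h]; ring
  have hm := fun a b => aestronglyMeasurable_noiseCoef (P := P) (B := B) n a b
  have h2 : (1 - a) * √(convVar l 0 s) + √(convVar l s t) ≤ √(2 * incVar l s t) := by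
    refine Real.le_sqrt_of_sq_le ?_
    have v0 := Real.sq_sqrt (convVar_nonneg hl hs)
    have v1 := Real.sq_sqrt (convVar_nonneg hl hst)
    rw [incVar, ← ha]
    nlinarith [sq_nonneg ((1 - a) * √(convVar l 0 s) - √(convVar l s t))]
  calc eLpNorm (fun ω => noiseCoef P B n 0 t ω - noiseCoef P B n 0 s ω) q P
      = eLpNorm (fun ω => (a - 1) * noiseCoef P B n 0 s ω + noiseCoef P B n s t ω) q P :=
        eLpNorm_congr_ae h1
    _ ≤ eLpNorm (fun ω => (a - 1) * noiseCoef P B n 0 s ω) q P +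
          eLpNorm (noiseCoef P B n s t) q P :=
        eLpNorm_add_le ((hm _ _).const_mul _) (hm _ _) hq
    _ ≤ ENNReal.ofReal (1 - a) * (ENNReal.ofReal (√(convVar l 0 s)) * gaussianMoment q) +
          ENNReal.ofReal (√(convVar l s t)) * gaussianMoment q := by
        rw [eLpNorm_const_mul_real, ← enorm_neg, neg_sub, Real.enorm_eq_ofReal (by linarith)]
        gcongr
        · exact eLpNorm_noiseCoef_le hW n le_rfl hs (hst.trans ht) q
        · exact eLpNorm_noiseCoef_le hW n hs hst ht q
    _ = ENNReal.ofReal ((1 - a) * √(convVar l 0 s) + √(convVar l s t)) * gaussianMoment q := by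
        rw [← mul_assoc, ← add_mul, ← ENNReal.ofReal_mul (by linarith),
          ← ENNReal.ofReal_add (mul_nonneg (by linarith) (Real.sqrt_nonneg _))
            (Real.sqrt_nonneg _)]
    _ ≤ _ := by gcongr

theorem enorm_sum_le_sobolevENorm_sq (γ : ℝ) (N : ℕ) (v : H) :
    ‖∑ n ∈ Finset.range N, eigenvalue n ^ γ * (inner ℝ (e n) v) ^ 2‖ₑ ≤ sobolevENorm γ v ^ 2 := by
  have hnn : ∀ n, 0 ≤ eigenvalue n ^ γ * (inner ℝ (e n) v) ^ 2 := fun n =>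
    mul_nonneg (Real.rpow_nonneg (eigenvalue_pos n).le _) (sq_nonneg _)
  rw [Real.enorm_eq_ofReal (Finset.sum_nonneg fun n _ => hnn n),
    ENNReal.ofReal_sum_of_nonneg fun n _ => hnn n, sobolevENorm, ← ENNReal.rpow_natCast,
    ← ENNReal.rpow_mul]
  norm_num
  exact ENNReal.sum_le_tsum _

theorem eLpNorm_sum_inner_sq_le (γ : ℝ) (N : ℕ) (q : ℝ≥0∞) :
    eLpNorm (fun ω => ∑ n ∈ Finset.range N, eigenvalue n ^ γ * (inner ℝ (e n) (X₀ ω)) ^ 2) q P ≤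
      eLpNorm (fun ω => sobolevENorm γ (X₀ ω)) (q * (2 : ℕ)) P ^ 2 :=
  eLpNorm_le_of_enorm_le_pow two_pos (fun ω => enorm_sum_le_sobolevENorm_sq γ N (X₀ ω)) q

theorem eLpNorm_integral_initial_le (N : ℕ) (q : ℝ≥0∞) :
    eLpNorm (fun ω => ∫ x, sinePoly N (fun n => inner ℝ (e n) (X₀ ω)) x ^ 6 ∂μD) q P ≤
      eLpNorm (fun ω => supENorm (galerkinProj N (X₀ ω))) (q * (6 : ℕ)) P ^ 6 :=
  eLpNorm_le_of_enorm_le_pow (by norm_num) (fun ω => (enorm_integral_pow_le N _).trans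
    (pow_le_pow_left' (eLpNorm_sinePoly_le_supENorm N _) 6)) q

/-- The deterministic bound with `o` the accumulated noise and `z` the rest. -/
theorem exists_sum_driftL1_sq_scheme_le (P : Measure Ω) (B : ℕ → ℝ → Ω → ℝ) (X₀ : Ω → H)
    (hT : 0 < T) (a₀ a₁ a₂ : ℝ) {a₃ : ℝ} (ha : a₃ < 0) : ∃ C₁ C₂ : ℝ, 0 ≤ C₁ ∧ 0 ≤ C₂ ∧
      ∀ M N : ℕ, 1 ≤ M → ∀ ω, ∑ m ∈ Finset.range M, T / M * driftL1 a₀ a₁ a₂ a₃ N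
        (schemeCoef P B a₀ a₁ a₂ a₃ X₀ N (T / M) m ω) ^ 2 ≤
      T * C₁ * (1 + ∫ y, sinePoly N (fun n => inner ℝ (e n) (X₀ ω)) y ^ 6 ∂μD) +
        C₂ * (1 + normSq N (fun n => inner ℝ (e n) (X₀ ω)) + ∑ j ∈ Finset.range M,
          T / M * (1 + ∫ x, sinePoly N (noiseRec P B (T / M) j ω) x ^ 6 ∂μD)) ^ 3 := by
  obtain ⟨C₁, hC₁, h₁⟩ := driftL1_sq_le a₀ a₁ a₂ a₃
  obtain ⟨C₂, hC₂, h₂⟩ := sum_driftL1_sq_le a₀ a₁ a₂ ha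
  refine ⟨C₁, C₂, hC₁, hC₂, fun M N hM ω => ?_⟩
  have hMpos : (0 : ℝ) < M := by exact_mod_cast hM
  have hτ : 0 < T / M := div_pos hT hMpos
  have hτT : T / M ≤ T := div_le_self hT.le (by exact_mod_cast hM)
  generalize T / M = τ at *
  have h := h₂ N M τ hτ
    (fun m n => schemeCoef P B a₀ a₁ a₂ a₃ X₀ N τ m ω n - noiseRec P B τ m ω n)
    (fun m n => noiseRec P B τ m ω n) fun m n => by
      simp only [sub_add_cancel]
      exact schemeCoef_sub_noiseRec P B a₀ a₁ a₂ a₃ X₀ N τ m ω n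
  simp only [sub_add_cancel] at h
  have h0 : (fun n => schemeCoef P B a₀ a₁ a₂ a₃ X₀ N τ 0 ω n - noiseRec P B τ 0 ω n) =
      fun n => inner ℝ (e n) (X₀ ω) := by
    ext n; simp [noiseRec, schemeCoef]
  rw [h0] at h
  refine h.trans (add_le_add ?_ le_rfl)
  -- At time `0` the roles are exchanged: with `z = 0` and the initial value as `o`, the `Ḣ¹` term
  -- vanishes and only the sixth power of `P_N X₀` remains.
  have h3 := h₁ N (fun _ => 0) (fun n => inner ℝ (e n) (X₀ ω))
  simp only [zero_add] at h3
  have e0 : gradSq N (fun _ => 0) = 0 := by simp [gradSq]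
  rw [e0, zero_mul, add_zero] at h3
  rw [mul_assoc]
  exact mul_le_mul hτT h3 (sq_nonneg _) hT.le

/-- Minkowski's inequality: the cube sends `L^k` to `L^{3k}`, and the `M` summands of weight `τ`
have total weight `T`, so the bound does not depend on `M`. -/
theorem eLpNorm_le_of_le_add_cube [IsProbabilityMeasure P] {k M : ℕ} (hk : 0 < k)
    {τ C₁ C₂ : ℝ} (hT : 0 ≤ T) (hτ : 0 ≤ τ) (hMτ : M * τ = T) (hC₁ : 0 ≤ C₁) (hC₂ : 0 ≤ C₂)
    {F U n : Ω → ℝ} {R : ℕ → Ω → ℝ} {V S Q : ℝ≥0∞} (hF : ∀ ω, 0 ≤ F ω)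
    (hFle : ∀ ω, F ω ≤ T * C₁ * (1 + U ω) +
      C₂ * (1 + n ω + ∑ j ∈ Finset.range M, τ * (1 + R j ω)) ^ 3)
    (hUm : AEStronglyMeasurable U P) (hnm : AEStronglyMeasurable n P)
    (hRm : ∀ j, AEStronglyMeasurable (R j) P) (hU : eLpNorm U k P ≤ V)
    (hn : eLpNorm n (3 * k : ℕ) P ≤ S) (hR : ∀ j < M, eLpNorm (R j) (3 * k : ℕ) P ≤ Q) :
    eLpNorm F k P ≤ ENNReal.ofReal (T * C₁) * (1 + V) +
      ENNReal.ofReal C₂ * (1 + S + ENNReal.ofReal T * (1 + Q)) ^ 3 := by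
  have h1m : AEStronglyMeasurable (fun _ : Ω => (1 : ℝ)) P := aestronglyMeasurable_const
  have hsm : ∀ j, AEStronglyMeasurable (fun ω => τ * (1 + R j ω)) P := fun j =>
    (h1m.add (hRm j)).const_mul τ
  have hSm : AEStronglyMeasurable (fun ω => ∑ j ∈ Finset.range M, τ * (1 + R j ω)) P :=
    Finset.aestronglyMeasurable_fun_sum _ fun j _ => hsm j
  have hGm : AEStronglyMeasurable
      (fun ω => 1 + n ω + ∑ j ∈ Finset.range M, τ * (1 + R j ω)) P := (h1m.add hnm).add hSm
  have hk1 : (1 : ℝ≥0∞) ≤ (k : ℕ) := by exact_mod_cast hk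
  have h3k1 : (1 : ℝ≥0∞) ≤ (3 * k : ℕ) := by exact_mod_cast (show 1 ≤ 3 * k by omega)
  have hsum : eLpNorm (fun ω => ∑ j ∈ Finset.range M, τ * (1 + R j ω)) (3 * k : ℕ) P ≤
      ENNReal.ofReal T * (1 + Q) := by
    have e1 : (fun ω => ∑ j ∈ Finset.range M, τ * (1 + R j ω)) =
        ∑ j ∈ Finset.range M, fun ω => τ * (1 + R j ω) := by ext; simp
    rw [e1]
    refine (eLpNorm_sum_le (fun j _ => hsm j) h3k1).trans ?_
    have hj : ∀ j ∈ Finset.range M, eLpNorm (fun ω => τ * (1 + R j ω)) (3 * k : ℕ) P ≤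
        ENNReal.ofReal τ * (1 + Q) := by
      intro j hj
      rw [eLpNorm_const_mul_real, Real.enorm_eq_ofReal hτ]
      gcongr
      exact (eLpNorm_add_le h1m (hRm j) h3k1).trans
        (add_le_add (eLpNorm_one_le _) (hR j (Finset.mem_range.1 hj)))
    refine (Finset.sum_le_sum hj).trans (le_of_eq ?_)
    rw [Finset.sum_const, Finset.card_range, nsmul_eq_mul, ← mul_assoc, ← hMτ,
      ENNReal.ofReal_mul (Nat.cast_nonneg M), ENNReal.ofReal_natCast]
  have hG : eLpNorm (fun ω => 1 + n ω + ∑ j ∈ Finset.range M, τ * (1 + R j ω)) (3 * k : ℕ) P ≤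
      1 + S + ENNReal.ofReal T * (1 + Q) := by
    refine (eLpNorm_add_le (h1m.add hnm) hSm h3k1).trans (add_le_add ?_ hsum)
    exact (eLpNorm_add_le h1m hnm h3k1).trans (add_le_add (eLpNorm_one_le _) hn)
  generalize hGd : (fun ω => 1 + n ω + ∑ j ∈ Finset.range M, τ * (1 + R j ω)) = G at hG hGm
  have hFle' : ∀ ω, F ω ≤ T * C₁ * (1 + U ω) + C₂ * G ω ^ 3 := fun ω => by
    rw [← hGd]; exact hFle ω
  have hA : AEStronglyMeasurable (fun ω => T * C₁ * (1 + U ω)) P := (h1m.add hUm).const_mul _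
  have hB : AEStronglyMeasurable (fun ω => C₂ * G ω ^ 3) P :=
    ((continuous_pow 3).comp_aestronglyMeasurable hGm).const_mul C₂
  have hA' : eLpNorm (fun ω => T * C₁ * (1 + U ω)) k P ≤ ENNReal.ofReal (T * C₁) * (1 + V) := by
    rw [eLpNorm_const_mul_real, Real.enorm_eq_ofReal (mul_nonneg hT hC₁)]
    gcongr
    exact (eLpNorm_add_le h1m hUm hk1).trans (add_le_add (eLpNorm_one_le _) hU)
  have hB' : eLpNorm (fun ω => C₂ * G ω ^ 3) k P ≤
      ENNReal.ofReal C₂ * (1 + S + ENNReal.ofReal T * (1 + Q)) ^ 3 := by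
    have e3 := eLpNorm_pow P G k (n := 3) (by norm_num)
    have ek : (k : ℝ≥0∞) * ((3 : ℕ) : ℝ≥0∞) = ((3 * k : ℕ) : ℝ≥0∞) := by
      rw [Nat.cast_mul, mul_comm]
    rw [ek] at e3
    rw [eLpNorm_const_mul_real, Real.enorm_eq_ofReal hC₂, e3]
    gcongr
  exact (eLpNorm_mono_real fun ω => (Real.norm_of_nonneg (hF ω)).trans_le (hFle' ω)).trans
    ((eLpNorm_add_le hA hB hk1).trans (add_le_add hA' hB'))

/-- Moment bound for the drift of the tamed scheme, uniform in the discretization. -/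
theorem exists_eLpNorm_sum_driftL1_sq_le [IsProbabilityMeasure P]
    (hW : IsCylindricalWiener P T ℱ B) (hT : 0 < T) (hX : AEStronglyMeasurable X₀ P)
    (a₀ a₁ a₂ : ℝ) {a₃ : ℝ} (ha : a₃ < 0) {k : ℕ} (hk : 0 < k)
    (hX0 : eLpNorm (fun ω => sobolevENorm 0 (X₀ ω)) (6 * k : ℕ) P < ∞)
    (hXV : (⨆ N : ℕ, eLpNorm (fun ω => supENorm (galerkinProj N (X₀ ω))) (6 * k : ℕ) P) < ∞) :
    ∃ C : ℝ≥0∞, C < ∞ ∧ ∀ M N : ℕ, 1 ≤ M →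
      eLpNorm (fun ω => ∑ m ∈ Finset.range M, T / M * driftL1 a₀ a₁ a₂ a₃ N
        (schemeCoef P B a₀ a₁ a₂ a₃ X₀ N (T / M) m ω) ^ 2) k P ≤ C := by
  obtain ⟨C₁, C₂, hC₁, hC₂, hP⟩ := exists_sum_driftL1_sq_scheme_le P B X₀ hT a₀ a₁ a₂ ha
  set S := eLpNorm (fun ω => sobolevENorm 0 (X₀ ω)) (6 * k : ℕ) P
  set V := ⨆ N : ℕ, eLpNorm (fun ω => supENorm (galerkinProj N (X₀ ω))) (6 * k : ℕ) P
  refine ⟨ENNReal.ofReal (T * C₁) * (1 + V ^ 6) +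
    ENNReal.ofReal C₂ * (1 + S ^ 2 + ENNReal.ofReal T * (1 + noiseMoment (3 * k))) ^ 3, ?_, ?_⟩
  · have := noiseMoment_lt_top (3 * k)
    refine ENNReal.add_lt_top.2 ⟨ENNReal.mul_lt_top ENNReal.ofReal_lt_top
      (ENNReal.add_lt_top.2 ⟨ENNReal.one_lt_top, ENNReal.pow_lt_top hXV⟩),
      ENNReal.mul_lt_top ENNReal.ofReal_lt_top (ENNReal.pow_lt_top (ENNReal.add_lt_top.2
      ⟨ENNReal.add_lt_top.2 ⟨ENNReal.one_lt_top, ENNReal.pow_lt_top hX0⟩,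
        ENNReal.mul_lt_top ENNReal.ofReal_lt_top (ENNReal.add_lt_top.2
        ⟨ENNReal.one_lt_top, this⟩)⟩))⟩
  intro M N hM
  have hMpos : (0 : ℝ) < M := by exact_mod_cast hM
  have hτ : 0 < T / M := div_pos hT hMpos
  have hMτ : M * (T / M) = T := by field_simp
  have hP' := hP M N hM
  generalize T / M = τ at *
  have hx : AEMeasurable (fun ω n => inner ℝ (e n) (X₀ ω)) P :=
    aemeasurable_pi_iff.2 fun n => aemeasurable_inner_e hX n
  refine eLpNorm_le_of_le_add_cube (k := k) hk hT.le hτ.le hMτ hC₁ hC₂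
    (fun ω => Finset.sum_nonneg fun m _ => mul_nonneg hτ.le (sq_nonneg _)) hP'
    ((measurable_integral_sinePoly_pow N 6).comp_aemeasurable hx).aestronglyMeasurable
    (Finset.aemeasurable_fun_sum _ fun n _ =>
      (aemeasurable_inner_e hX n).pow_const 2).aestronglyMeasurable
    (fun j => ((measurable_integral_sinePoly_pow N 6).comp_aemeasurable
      (aemeasurable_noiseRec τ j)).aestronglyMeasurable) ?_ ?_ fun j hj => ?_
  · refine (eLpNorm_integral_initial_le N k).trans (pow_le_pow_left' ?_ 6)
    rw [show ((k : ℝ≥0∞) * (6 : ℕ)) = ((6 * k : ℕ) : ℝ≥0∞) by push_cast; ring]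
    exact le_iSup (fun N => eLpNorm (fun ω => supENorm (galerkinProj N (X₀ ω))) (6 * k : ℕ) P) N
  · have h := eLpNorm_sum_inner_sq_le (P := P) (X₀ := X₀) 0 N (3 * k : ℕ)
    rw [show (((3 * k : ℕ) : ℝ≥0∞) * (2 : ℕ)) = ((6 * k : ℕ) : ℝ≥0∞) by push_cast; ring] at h
    simp only [Real.rpow_zero, one_mul] at h
    exact h
  · refine eLpNorm_integral_noise_le hW (by omega) N hτ j ?_
    rw [← hMτ]
    exact mul_le_mul_of_nonneg_right (by exact_mod_cast hj.le) hτ.le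

/-- The eigenfunctions are bounded by `√2` and the taming factor by `1`, so the bound is the same
for all modes. -/
theorem tamedCoef_sq_le (a₀ a₁ a₂ a₃ : ℝ) (N : ℕ) {τ : ℝ} (hτ : 0 < τ) (y : ℕ → ℝ) (n : ℕ) :
    tamedCoef a₀ a₁ a₂ a₃ N τ y n ^ 2 ≤ 2 * driftL1 a₀ a₁ a₂ a₃ N y ^ 2 := by
  have hc := (continuous_cubic a₀ a₁ a₂ a₃).comp (continuous_sinePoly N y)
  have hc' := continuous_cubic a₀ a₁ a₂ a₃
  obtain ⟨h0, h1, -⟩ := taming_mem a₀ a₁ a₂ a₃ (N := N) hτ y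
  have hL : 0 ≤ driftL1 a₀ a₁ a₂ a₃ N y := integral_nonneg fun x => abs_nonneg _
  have hd : |driftCoef a₀ a₁ a₂ a₃ N y n| ≤ √2 * driftL1 a₀ a₁ a₂ a₃ N y := by
    rw [driftCoef, driftL1, ← integral_const_mul]
    refine (abs_integral_le_integral_abs).trans (integral_mono
      (integrable_of_continuous (by fun_prop)) (integrable_of_continuous (by fun_prop)) fun x => ?_)
    dsimp only
    rw [abs_mul, mul_comm]
    exact mul_le_mul_of_nonneg_right (abs_eigenfunction_le n x) (abs_nonneg _)
  have hg : |tamedCoef a₀ a₁ a₂ a₃ N τ y n| ≤ √2 * driftL1 a₀ a₁ a₂ a₃ N y := by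
    rw [tamedCoef, abs_mul, abs_of_nonneg h0]
    exact (mul_le_of_le_one_left (abs_nonneg _) h1).trans hd
  have := pow_le_pow_left₀ (abs_nonneg _) hg 2
  rwa [sq_abs, mul_pow, Real.sq_sqrt (by norm_num)] at this

end Regularity

/-! ### Increments of the interpolant in `Ḣ^{-β}`. -/

section MainResult

variable {Ω : Type*} {mΩ : MeasurableSpace Ω} {P : Measure Ω} {B : ℕ → ℝ → Ω → ℝ}
  {T : ℝ} {ℱ : Filtration ℝ mΩ} {X₀ : Ω → H}

/-- The exponent `θ = |β| + β` serves both signs: it is `2β` for `β ≥ 0` and `0` for `β ≤ 0`, and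
the eigenvalue weight becomes `|β|` in either case. -/
theorem rpow_weight_eq (l δ β θ : ℝ) (hl : 0 < l) (hδ : 0 < δ) (hθ : θ = |β| + β) :
    l ^ (-β) * (l * δ) ^ θ = l ^ |β| * δ ^ θ := by
  rw [Real.mul_rpow hl.le hδ.le, ← mul_assoc, ← Real.rpow_add hl]
  congr 2
  rw [hθ]; ring

/-- Pathwise bound for the increments of the interpolant in `Ḣ^{-β}`, up to the noise. -/
theorem sum_interpCoef_sub_sq_le (a₀ a₁ a₂ a₃ : ℝ) {M N : ℕ} {τ : ℝ} (hτ : 0 < τ) {s t β θ : ℝ}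
    (hs : 0 ≤ s) (hst : s < t) (ht : t ≤ M * τ) (hθ : θ = |β| + β) (hθ0 : 0 ≤ θ) (hθ1 : θ ≤ 1)
    (hA : Summable fun n => eigenvalue n ^ (|β| - 1)) (ω : Ω) :
    ∑ n ∈ Finset.range N, eigenvalue n ^ (-β) *
        (interpCoef P B a₀ a₁ a₂ a₃ X₀ N τ t ω n - interpCoef P B a₀ a₁ a₂ a₃ X₀ N τ s ω n) ^ 2 ≤
      3 * (t - s) ^ θ *
          ∑ n ∈ Finset.range N, eigenvalue n ^ |β| * (inner ℝ (e n) (X₀ ω)) ^ 2 +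
        24 * (t - s) ^ θ * (∑' n, eigenvalue n ^ (|β| - 1)) *
          (∑ m ∈ Finset.range M, τ * driftL1 a₀ a₁ a₂ a₃ N
            (schemeCoef P B a₀ a₁ a₂ a₃ X₀ N τ m ω) ^ 2) +
        ∑ n ∈ Finset.range N, 3 * eigenvalue n ^ (-β) *
          (noiseCoef P B n 0 t ω - noiseCoef P B n 0 s ω) ^ 2 := by
  set δ := t - s with hδd
  have hδ : 0 < δ := sub_pos.2 hst
  set Φ := ∑ m ∈ Finset.range M, τ * driftL1 a₀ a₁ a₂ a₃ N
    (schemeCoef P B a₀ a₁ a₂ a₃ X₀ N τ m ω) ^ 2 with hΦ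
  have hΦ0 : 0 ≤ Φ := Finset.sum_nonneg fun m _ => mul_nonneg hτ.le (sq_nonneg _)
  have hδθ : 0 ≤ δ ^ θ := Real.rpow_nonneg hδ.le _
  -- The constant is `24 = 3 · 4 · 2`: splitting into three terms, increments of the drift
  -- convolution, and `incVar_le`.
  have hterm : ∀ n, eigenvalue n ^ (-β) * (interpCoef P B a₀ a₁ a₂ a₃ X₀ N τ t ω n -
        interpCoef P B a₀ a₁ a₂ a₃ X₀ N τ s ω n) ^ 2 ≤
      3 * δ ^ θ * (eigenvalue n ^ |β| * (inner ℝ (e n) (X₀ ω)) ^ 2) +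
      24 * δ ^ θ * Φ * eigenvalue n ^ (|β| - 1) +
      3 * eigenvalue n ^ (-β) * (noiseCoef P B n 0 t ω - noiseCoef P B n 0 s ω) ^ 2 := by
    intro n
    have hl := eigenvalue_pos n
    have hdrift := sq_integral_expKernel_mul_step_sub_le hl hτ
      (g := fun m => tamedCoef a₀ a₁ a₂ a₃ N τ (schemeCoef P B a₀ a₁ a₂ a₃ X₀ N τ m ω) n)
      (φ := fun m => driftL1 a₀ a₁ a₂ a₃ N (schemeCoef P B a₀ a₁ a₂ a₃ X₀ N τ m ω))
      (fun m => tamedCoef_sq_le a₀ a₁ a₂ a₃ N hτ _ n) M hs hst.le ht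
    have hinc := incVar_le (s := s) hl hst hθ0 hθ1
    have hw := rpow_weight_eq (eigenvalue n) δ β θ hl hδ hθ
    have hw' : eigenvalue n ^ (-β) * ((eigenvalue n)⁻¹ * (eigenvalue n * δ) ^ θ) =
        δ ^ θ * eigenvalue n ^ (|β| - 1) := by
      rw [Real.rpow_sub_one hl.ne', mul_left_comm, hw, div_eq_mul_inv]; ring
    have hexp : (Real.exp (-(eigenvalue n * t)) - Real.exp (-(eigenvalue n * s))) ^ 2 ≤
        (eigenvalue n * δ) ^ θ := by
      have h1 : Real.exp (-(eigenvalue n * t)) - Real.exp (-(eigenvalue n * s)) =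
          -(Real.exp (-(eigenvalue n * s)) * (1 - Real.exp (-(eigenvalue n * δ)))) := by
        rw [mul_sub, mul_one, ← Real.exp_add, hδd]; ring_nf
      have h2 : Real.exp (-(eigenvalue n * s)) ^ 2 ≤ 1 :=
        pow_le_one₀ (Real.exp_pos _).le
          (Real.exp_le_one_iff.2 (by nlinarith [mul_nonneg hl.le hs]))
      rw [h1, neg_sq, mul_pow]
      exact (mul_le_of_le_one_left (sq_nonneg _) h2).trans
        (sq_one_sub_exp_le (mul_pos hl hδ) hθ0 hθ1)
    have hlβ : 0 ≤ eigenvalue n ^ (-β) := Real.rpow_nonneg hl.le _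
    have b1 := mul_le_mul_of_nonneg_left hexp
      (mul_nonneg hlβ (sq_nonneg (inner ℝ (e n) (X₀ ω))))
    have b2 := mul_le_mul_of_nonneg_left hdrift hlβ
    have b3 := mul_le_mul_of_nonneg_left hinc (mul_nonneg hlβ hΦ0)
    simp only [interpCoef]
    set x : ℝ := inner ℝ (e n) (X₀ ω)
    set D : ℝ → ℝ := fun t => ∫ r in (0 : ℝ)..t, expKernel (eigenvalue n) t r *
      tamedCoef a₀ a₁ a₂ a₃ N τ (schemeCoef P B a₀ a₁ a₂ a₃ X₀ N τ ⌊r / τ⌋₊ ω) n with hD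
    change eigenvalue n ^ (-β) * (D t - D s) ^ 2 ≤ _ at b2
    set w := noiseCoef P B n 0 t ω - noiseCoef P B n 0 s ω with hwd
    set E := Real.exp (-(eigenvalue n * t)) - Real.exp (-(eigenvalue n * s)) with hE
    have hsq : (Real.exp (-(eigenvalue n * t)) * x + D t + noiseCoef P B n 0 t ω -
        (Real.exp (-(eigenvalue n * s)) * x + D s + noiseCoef P B n 0 s ω)) ^ 2 ≤
        3 * (E ^ 2 * x ^ 2) + 3 * (D t - D s) ^ 2 + 3 * w ^ 2 := by
      have e1 : Real.exp (-(eigenvalue n * t)) * x + D t + noiseCoef P B n 0 t ω -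
        (Real.exp (-(eigenvalue n * s)) * x + D s + noiseCoef P B n 0 s ω) =
          E * x + (D t - D s) + w := by rw [hE, hwd]; ring
      rw [e1]
      nlinarith [sq_nonneg (E * x - (D t - D s)), sq_nonneg (E * x - w),
        sq_nonneg ((D t - D s) - w)]
    have b0 := mul_le_mul_of_nonneg_left hsq hlβ
    have e2 : eigenvalue n ^ (-β) * x ^ 2 * (eigenvalue n * δ) ^ θ =
        δ ^ θ * (eigenvalue n ^ |β| * x ^ 2) := by
      linear_combination x ^ 2 * hw
    have e3 : eigenvalue n ^ (-β) * Φ * (2 * ((eigenvalue n)⁻¹ * (eigenvalue n * δ) ^ θ)) =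
        2 * δ ^ θ * Φ * eigenvalue n ^ (|β| - 1) := by
      linear_combination 2 * Φ * hw'
    rw [e2] at b1
    rw [e3] at b3
    linarith
  refine (Finset.sum_le_sum fun n _ => hterm n).trans ?_
  rw [Finset.sum_add_distrib, Finset.sum_add_distrib, ← Finset.mul_sum, ← Finset.mul_sum]
  have hAN : ∑ n ∈ Finset.range N, eigenvalue n ^ (|β| - 1) ≤
      ∑' n, eigenvalue n ^ (|β| - 1) :=
    hA.sum_le_tsum _ fun n _ => Real.rpow_nonneg (eigenvalue_pos n).le _
  have := mul_le_mul_of_nonneg_left hAN (show 0 ≤ 24 * δ ^ θ * Φ by positivity)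
  linarith

/-- Moments of the increments of the stochastic convolution in `Ḣ^{-β}`. -/
theorem eLpNorm_sum_noiseCoef_sub_sq_le [IsProbabilityMeasure P]
    (hW : IsCylindricalWiener P T ℱ B) {N k : ℕ} (hk : 0 < k) {s t β θ : ℝ}
    (hs : 0 ≤ s) (hst : s < t) (ht : t ≤ T) (hθ : θ = |β| + β) (hθ0 : 0 ≤ θ) (hθ1 : θ ≤ 1)
    (hA : Summable fun n => eigenvalue n ^ (|β| - 1)) :
    eLpNorm (fun ω => ∑ n ∈ Finset.range N, 3 * eigenvalue n ^ (-β) *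
      (noiseCoef P B n 0 t ω - noiseCoef P B n 0 s ω) ^ 2) k P ≤
      ENNReal.ofReal ((t - s) ^ θ) * (ENNReal.ofReal (12 * ∑' n, eigenvalue n ^ (|β| - 1)) *
        gaussianMoment (k * (2 : ℕ)) ^ 2) := by
  set δ := t - s with hδd
  have hδ : 0 < δ := sub_pos.2 hst
  have hδθ : 0 ≤ δ ^ θ := Real.rpow_nonneg hδ.le _
  have hk1 : (1 : ℝ≥0∞) ≤ (k : ℕ) := by exact_mod_cast hk
  have hk2 : (1 : ℝ≥0∞) ≤ (k : ℝ≥0∞) * (2 : ℕ) := by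
    rw [← Nat.cast_mul]; exact_mod_cast (show 1 ≤ k * 2 by omega)
  have hwm : ∀ n, AEStronglyMeasurable
      (fun ω => noiseCoef P B n 0 t ω - noiseCoef P B n 0 s ω) P := fun n =>
    (aestronglyMeasurable_noiseCoef n _ _).sub (aestronglyMeasurable_noiseCoef n _ _)
  have hm : ∀ n, AEStronglyMeasurable (fun ω => 3 * eigenvalue n ^ (-β) *
      (noiseCoef P B n 0 t ω - noiseCoef P B n 0 s ω) ^ 2) P := fun n =>
    ((continuous_pow 2).comp_aestronglyMeasurable (hwm n)).const_mul _
  have e1 : (fun ω => ∑ n ∈ Finset.range N, 3 * eigenvalue n ^ (-β) *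
      (noiseCoef P B n 0 t ω - noiseCoef P B n 0 s ω) ^ 2) =
      ∑ n ∈ Finset.range N, fun ω => 3 * eigenvalue n ^ (-β) *
      (noiseCoef P B n 0 t ω - noiseCoef P B n 0 s ω) ^ 2 := by ext; simp
  rw [e1]
  refine (eLpNorm_sum_le (fun n _ => hm n) hk1).trans ?_
  -- The constant is `12 = 3 · 2 · 2`: the prefactor, the `2` of `eLpNorm_noiseCoef_sub_le` and that
  -- of `incVar_le`.
  have hterm : ∀ n ∈ Finset.range N, eLpNorm (fun ω => 3 * eigenvalue n ^ (-β) *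
      (noiseCoef P B n 0 t ω - noiseCoef P B n 0 s ω) ^ 2) k P ≤
      ENNReal.ofReal (12 * δ ^ θ * eigenvalue n ^ (|β| - 1)) *
        gaussianMoment (k * (2 : ℕ)) ^ 2 := by
    intro n _
    have hl := eigenvalue_pos n
    have hlβ : 0 ≤ eigenvalue n ^ (-β) := Real.rpow_nonneg hl.le _
    have hv := incVar_le (s := s) hl hst hθ0 hθ1
    have hv0 : 0 ≤ incVar (eigenvalue n) s t :=
      add_nonneg (mul_nonneg (sq_nonneg _) (convVar_nonneg hl hs)) (convVar_nonneg hl hst.le)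
    have hw := rpow_weight_eq (eigenvalue n) δ β θ hl hδ hθ
    have hw' : eigenvalue n ^ (-β) * ((eigenvalue n)⁻¹ * (eigenvalue n * δ) ^ θ) =
        δ ^ θ * eigenvalue n ^ (|β| - 1) := by
      rw [Real.rpow_sub_one hl.ne', mul_left_comm, hw, div_eq_mul_inv]; ring
    have h1 := eLpNorm_noiseCoef_sub_le hW n hs hst.le ht hk2
    have h2 := pow_le_pow_left' h1 2
    rw [mul_pow, ← ENNReal.ofReal_pow (Real.sqrt_nonneg _),
      Real.sq_sqrt (mul_nonneg zero_le_two hv0)] at h2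
    rw [eLpNorm_const_mul_real, eLpNorm_pow P _ _ two_pos,
      Real.enorm_eq_ofReal (mul_nonneg (by norm_num) hlβ)]
    calc _ ≤ ENNReal.ofReal (3 * eigenvalue n ^ (-β)) *
          (ENNReal.ofReal (2 * incVar (eigenvalue n) s t) * gaussianMoment (k * (2 : ℕ)) ^ 2) := by
          gcongr
      _ = ENNReal.ofReal (3 * eigenvalue n ^ (-β) * (2 * incVar (eigenvalue n) s t)) *
          gaussianMoment (k * (2 : ℕ)) ^ 2 := by
          rw [← mul_assoc, ← ENNReal.ofReal_mul (mul_nonneg (by norm_num) hlβ)]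
      _ ≤ _ := by
          refine mul_le_mul' (ENNReal.ofReal_le_ofReal ?_) le_rfl
          have := mul_le_mul_of_nonneg_left hv hlβ
          rw [← hδd, mul_left_comm, hw'] at this
          linarith
  refine (Finset.sum_le_sum hterm).trans ?_
  rw [← Finset.sum_mul, ← ENNReal.ofReal_sum_of_nonneg fun n _ => mul_nonneg (by positivity)
    (Real.rpow_nonneg (eigenvalue_pos n).le _), ← Finset.mul_sum, ← mul_assoc,
    ← ENNReal.ofReal_mul hδθ]
  refine mul_le_mul' (ENNReal.ofReal_le_ofReal ?_) le_rfl
  have hAN : ∑ n ∈ Finset.range N, eigenvalue n ^ (|β| - 1) ≤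
      ∑' n, eigenvalue n ^ (|β| - 1) :=
    hA.sum_le_tsum _ fun n _ => Real.rpow_nonneg (eigenvalue_pos n).le _
  have := mul_le_mul_of_nonneg_left hAN (show 0 ≤ 12 * δ ^ θ by positivity)
  linarith

theorem eLpNorm_le_of_le_add_add {q : ℝ≥0∞} (hq : 1 ≤ q) {F f₁ f₂ f₃ : Ω → ℝ} {c₁ c₂ : ℝ}
    {b₁ b₂ b₃ : ℝ≥0∞} (hc₁ : 0 ≤ c₁) (hc₂ : 0 ≤ c₂) (hF : ∀ ω, 0 ≤ F ω)
    (hle : ∀ ω, F ω ≤ c₁ * f₁ ω + c₂ * f₂ ω + f₃ ω) (m₁ : AEStronglyMeasurable f₁ P)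
    (m₂ : AEStronglyMeasurable f₂ P) (m₃ : AEStronglyMeasurable f₃ P) (h₁ : eLpNorm f₁ q P ≤ b₁)
    (h₂ : eLpNorm f₂ q P ≤ b₂) (h₃ : eLpNorm f₃ q P ≤ b₃) :
    eLpNorm F q P ≤ ENNReal.ofReal c₁ * b₁ + ENNReal.ofReal c₂ * b₂ + b₃ := by
  have n₁ : AEStronglyMeasurable (fun ω => c₁ * f₁ ω) P := m₁.const_mul c₁
  have n₂ : AEStronglyMeasurable (fun ω => c₂ * f₂ ω) P := m₂.const_mul c₂
  refine (eLpNorm_mono_real fun ω => ?_).trans ((eLpNorm_add_le (n₁.add n₂) m₃ hq).trans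
    (add_le_add ((eLpNorm_add_le n₁ n₂ hq).trans (add_le_add ?_ ?_)) h₃))
  · rw [Real.norm_of_nonneg (hF ω)]
    exact hle ω
  · rw [eLpNorm_const_mul_real, Real.enorm_eq_ofReal hc₁]
    exact mul_le_mul' le_rfl h₁
  · rw [eLpNorm_const_mul_real, Real.enorm_eq_ofReal hc₂]
    exact mul_le_mul' le_rfl h₂

/-- Temporal regularity of the interpolant, in terms of the squared `Ḣ^{-β}` norm. -/
theorem exists_eLpNorm_sum_interpCoef_sub_sq_le [IsProbabilityMeasure P]
    (hW : IsCylindricalWiener P T ℱ B) (hT : 0 < T) (hX : AEStronglyMeasurable X₀ P)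
    (a₀ a₁ a₂ : ℝ) {a₃ : ℝ} (ha : a₃ < 0) {k : ℕ} (hk : 0 < k) {β : ℝ} (hβ : |β| < 1 / 2)
    (hX0 : ∀ γ < (1 / 2 : ℝ), eLpNorm (fun ω => sobolevENorm γ (X₀ ω)) (6 * k : ℕ) P < ∞)
    (hXV : (⨆ N : ℕ, eLpNorm (fun ω => supENorm (galerkinProj N (X₀ ω))) (6 * k : ℕ) P) < ∞) :
    ∃ K : ℝ, 0 ≤ K ∧ ∀ M N : ℕ, 1 ≤ M → ∀ s t : ℝ, 0 ≤ s → s < t → t ≤ T →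
      eLpNorm (fun ω => ∑ n ∈ Finset.range N, eigenvalue n ^ (-β) *
        (interpCoef P B a₀ a₁ a₂ a₃ X₀ N (T / M) t ω n -
          interpCoef P B a₀ a₁ a₂ a₃ X₀ N (T / M) s ω n) ^ 2) k P ≤
      ENNReal.ofReal (K * (t - s) ^ (2 * β)) := by
  obtain ⟨CΦ, hCΦ, hΦ⟩ := exists_eLpNorm_sum_driftL1_sq_le hW hT hX a₀ a₁ a₂ ha hk
    (hX0 0 (by norm_num)) hXV
  have hA := summable_eigenvalue_rpow (s := |β| - 1) (by linarith)
  set A := ∑' n, eigenvalue n ^ (|β| - 1) with hAd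
  have hA0 : 0 ≤ A := tsum_nonneg fun n => Real.rpow_nonneg (eigenvalue_pos n).le _
  set S := eLpNorm (fun ω => sobolevENorm |β| (X₀ ω)) (6 * k : ℕ) P
  have hS : S < ∞ := hX0 |β| hβ
  set g := gaussianMoment (k * (2 : ℕ))
  have hg : g < ∞ := gaussianMoment_lt_top (by
    rw [← Nat.cast_mul]; exact ENNReal.natCast_ne_top _)
  obtain ⟨θ, hθ⟩ : ∃ θ, θ = |β| + β := ⟨_, rfl⟩
  have hθ0 : 0 ≤ θ := by linarith [neg_abs_le β]
  have hθ1 : θ ≤ 1 := by linarith [le_abs_self β]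
  set K₀ := 3 * S ^ 2 + ENNReal.ofReal (24 * A) * CΦ + ENNReal.ofReal (12 * A) * g ^ 2 with hK₀
  have hK₀fin : K₀ ≠ ∞ := (ENNReal.add_lt_top.2 ⟨ENNReal.add_lt_top.2
    ⟨ENNReal.mul_lt_top (by norm_num) (ENNReal.pow_lt_top hS),
      ENNReal.mul_lt_top ENNReal.ofReal_lt_top hCΦ⟩,
    ENNReal.mul_lt_top ENNReal.ofReal_lt_top (ENNReal.pow_lt_top hg)⟩).ne
  -- The factor `T^{|β| - β}` converts `δ^θ` into `δ^{2β}`: `θ - 2β = |β| - β ≥ 0` and `δ ≤ T`. For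
  -- `β < 0` this is where boundedness becomes the singular rate.
  refine ⟨T ^ (|β| - β) * K₀.toReal, mul_nonneg (Real.rpow_nonneg hT.le _) ENNReal.toReal_nonneg,
    fun M N hM s t hs hst ht => ?_⟩
  have hMpos : (0 : ℝ) < M := by exact_mod_cast hM
  have hτ : 0 < T / M := div_pos hT hMpos
  have hMτ : M * (T / M) = T := by field_simp
  have hΦ' := hΦ M N hM
  generalize T / M = τ at *
  set δ := t - s with hδd
  have hδ : 0 < δ := sub_pos.2 hst
  have hδθ : 0 ≤ δ ^ θ := Real.rpow_nonneg hδ.le _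
  have hpt := fun ω => sum_interpCoef_sub_sq_le (P := P) (B := B) (X₀ := X₀) (N := N) a₀ a₁ a₂ a₃
    hτ hs hst (ht.trans_eq hMτ.symm) hθ hθ0 hθ1 hA ω
  have hnoise := eLpNorm_sum_noiseCoef_sub_sq_le (N := N) hW hk hs hst ht hθ hθ0 hθ1 hA
  have hini := eLpNorm_sum_inner_sq_le (P := P) (X₀ := X₀) |β| N (3 * k : ℕ)
  rw [show (((3 * k : ℕ) : ℝ≥0∞) * (2 : ℕ)) = ((6 * k : ℕ) : ℝ≥0∞) by push_cast; ring] at hini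
  have hk1 : (1 : ℝ≥0∞) ≤ (k : ℕ) := by exact_mod_cast hk
  have m1 : AEStronglyMeasurable (fun ω =>
      ∑ n ∈ Finset.range N, eigenvalue n ^ |β| * (inner ℝ (e n) (X₀ ω)) ^ 2) P :=
    (Finset.aemeasurable_fun_sum _ fun n _ =>
      ((aemeasurable_inner_e hX n).pow_const 2).const_mul _).aestronglyMeasurable
  have m2 : AEStronglyMeasurable (fun ω => ∑ m ∈ Finset.range M, τ * driftL1 a₀ a₁ a₂ a₃ N
      (schemeCoef P B a₀ a₁ a₂ a₃ X₀ N τ m ω) ^ 2) P :=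
    (Finset.aemeasurable_fun_sum _ fun m _ => ((((measurable_driftL1 a₀ a₁ a₂ a₃ N).comp_aemeasurable
      (aemeasurable_schemeCoef a₀ a₁ a₂ a₃ hX N τ m)).pow_const 2).const_mul
        _)).aestronglyMeasurable
  have m3 : AEStronglyMeasurable (fun ω => ∑ n ∈ Finset.range N, 3 * eigenvalue n ^ (-β) *
      (noiseCoef P B n 0 t ω - noiseCoef P B n 0 s ω) ^ 2) P :=
    (Finset.aemeasurable_fun_sum _ fun n _ =>
      ((((aestronglyMeasurable_noiseCoef n _ _).sub
        (aestronglyMeasurable_noiseCoef n _ _)).aemeasurable).pow_const 2).const_mul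
          _).aestronglyMeasurable
  have hini' := (eLpNorm_le_eLpNorm_of_exponent_le (p := (k : ℝ≥0∞)) (q := (3 * k : ℕ))
    (by exact_mod_cast (show k ≤ 3 * k by omega)) m1).trans hini
  have hnn : ∀ ω, 0 ≤ ∑ n ∈ Finset.range N, eigenvalue n ^ (-β) *
      (interpCoef P B a₀ a₁ a₂ a₃ X₀ N τ t ω n -
        interpCoef P B a₀ a₁ a₂ a₃ X₀ N τ s ω n) ^ 2 := fun ω =>
    Finset.sum_nonneg fun n _ =>
      mul_nonneg (Real.rpow_nonneg (eigenvalue_pos n).le _) (sq_nonneg _)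
  refine (eLpNorm_le_of_le_add_add hk1 (by positivity) (by positivity) hnn hpt m1 m2 m3 hini' hΦ'
    hnoise).trans ?_
  have hθ2 : δ ^ θ ≤ T ^ (|β| - β) * δ ^ (2 * β) := by
    rw [show θ = (|β| - β) + 2 * β by rw [hθ]; ring, Real.rpow_add hδ]
    exact mul_le_mul_of_nonneg_right (Real.rpow_le_rpow hδ.le (by linarith)
      (by linarith [le_abs_self β])) (Real.rpow_nonneg hδ.le _)
  calc _ = ENNReal.ofReal (δ ^ θ) * K₀ := by
        rw [hK₀, mul_right_comm 24, mul_comm 3 (δ ^ θ), mul_comm (24 * A) (δ ^ θ),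
          ENNReal.ofReal_mul hδθ, ENNReal.ofReal_mul hδθ,
          show ENNReal.ofReal 3 = 3 by norm_num]
        ring
    _ ≤ ENNReal.ofReal (T ^ (|β| - β) * δ ^ (2 * β)) * ENNReal.ofReal K₀.toReal := by
        rw [ENNReal.ofReal_toReal hK₀fin]
        exact mul_le_mul' (ENNReal.ofReal_le_ofReal hθ2) le_rfl
    _ = _ := by
        rw [← ENNReal.ofReal_mul' ENNReal.toReal_nonneg]
        congr 1; ring

/-- Passage from the squared to the unsquared `Ḣ^{-β}` norm. -/
theorem eLpNorm_sobolevENorm_combo_le [IsProbabilityMeasure P] {N k : ℕ} {c : Ω → ℕ → ℝ}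
    (hc : ∀ n, AEMeasurable (fun ω => c ω n) P) {p β K δ : ℝ} (hpk : p ≤ k)
    (hK : 0 ≤ K) (hδ : 0 < δ)
    (h : eLpNorm (fun ω => ∑ n ∈ Finset.range N, eigenvalue n ^ (-β) * c ω n ^ 2) k P ≤
      ENNReal.ofReal (K * δ ^ (2 * β))) :
    eLpNorm (fun ω => sobolevENorm (-β) (combo N (c ω))) (ENNReal.ofReal p) P ≤
      ENNReal.ofReal (√K * δ ^ β) := by
  have hnn : ∀ ω, 0 ≤ ∑ n ∈ Finset.range N, eigenvalue n ^ (-β) * c ω n ^ 2 := fun ω =>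
    Finset.sum_nonneg fun n _ =>
      mul_nonneg (Real.rpow_nonneg (eigenvalue_pos n).le _) (sq_nonneg _)
  have hQm : AEStronglyMeasurable
      (fun ω => √(∑ n ∈ Finset.range N, eigenvalue n ^ (-β) * c ω n ^ 2)) P :=
    (Finset.aemeasurable_fun_sum _ fun n _ =>
      ((hc n).pow_const 2).const_mul _).sqrt.aestronglyMeasurable
  have hnorm : ∀ ω, sobolevENorm (-β) (combo N (c ω)) =
      ‖√(∑ n ∈ Finset.range N, eigenvalue n ^ (-β) * c ω n ^ 2)‖ₑ := fun ω => by
    rw [sobolevENorm_combo, Real.enorm_eq_ofReal (Real.sqrt_nonneg _), Real.sqrt_eq_rpow,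
      ENNReal.ofReal_rpow_of_nonneg (hnn ω) (by norm_num)]
  simp only [hnorm, eLpNorm_enorm]
  -- On a probability space `L^p` is dominated by `L^{2k}`, and the square of the `L^{2k}` norm of
  -- the root is the `L^k` norm of the sum.
  refine (eLpNorm_le_eLpNorm_of_exponent_le (q := (k : ℝ≥0∞) * (2 : ℕ)) ?_ hQm).trans ?_
  · rw [← Nat.cast_mul, ← ENNReal.ofReal_natCast]
    refine ENNReal.ofReal_le_ofReal ?_
    push_cast
    linarith
  · have h2 := eLpNorm_pow P
      (fun ω => √(∑ n ∈ Finset.range N, eigenvalue n ^ (-β) * c ω n ^ 2)) k two_pos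
    simp only [Real.sq_sqrt (hnn _)] at h2
    have hδβ : 0 ≤ δ ^ β := Real.rpow_nonneg hδ.le _
    rw [h2, two_mul β, Real.rpow_add hδ, ← Real.sq_sqrt hK,
      show √K ^ 2 * (δ ^ β * δ ^ β) = (√K * δ ^ β) ^ 2 by ring,
      ENNReal.ofReal_pow (by positivity)] at h
    exact (ENNReal.pow_le_pow_left_iff two_ne_zero).1 h

end MainResult

end AllenCahn

end

open AllenCahn in
theorem mainTheorem5 (p β : ℝ) (hp : 2 ≤ p) (hβ : -(1 / 2) < β) (hβ' : β < 1 / 2) :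
    ∃ p₀ : ℕ, ∀ (T : ℝ) (_ : 0 < T) (a₀ a₁ a₂ a₃ : ℝ) (_ : a₃ < 0)
      (Ω : Type*) (mΩ : MeasurableSpace Ω) (P : Measure Ω) (_ : IsProbabilityMeasure P)
      (ℱ : Filtration ℝ mΩ) (B : ℕ → ℝ → Ω → ℝ) (X₀ : Ω → H)
      (_ : IsNormalFiltration P T ℱ)
      (_ : IsCylindricalWiener P T ℱ B)
      (_ : StronglyMeasurable[ℱ 0] X₀)
      (_ : ∀ γ < (1 / 2 : ℝ), eLpNorm (fun ω => sobolevENorm γ (X₀ ω)) p₀ P < ∞)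
      (_ : eLpNorm (fun ω => supENorm (X₀ ω)) p₀ P < ∞)
      (_ : (⨆ N : ℕ, eLpNorm (fun ω => supENorm (galerkinProj N (X₀ ω))) p₀ P) < ∞),
      ∃ C : ℝ, ∀ M N : ℕ, 1 ≤ M → 1 ≤ N → ∀ s t : ℝ, 0 ≤ s → s < t → t ≤ T →
        AEStronglyMeasurable (fun ω => interpolant P B a₀ a₁ a₂ a₃ X₀ N (T / M) t ω
          - interpolant P B a₀ a₁ a₂ a₃ X₀ N (T / M) s ω) P ∧
        eLpNorm (fun ω => sobolevENorm (-β) (interpolant P B a₀ a₁ a₂ a₃ X₀ N (T / M) t ω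
          - interpolant P B a₀ a₁ a₂ a₃ X₀ N (T / M) s ω)) (ENNReal.ofReal p) P
          ≤ ENNReal.ofReal (C * (t - s) ^ β) := by
  obtain ⟨k, hkp⟩ := exists_nat_ge p
  have hk : 0 < k := by
    have : (0 : ℝ) < k := by linarith
    exact_mod_cast this
  -- The order `6k` is what `L^k` moments require: the `L^k` norm of `‖P_N X₀‖_V⁶` and the `L^{3k}`
  -- norm of `‖X₀‖²` both call for it.
  refine ⟨6 * k, fun T hT a₀ a₁ a₂ a₃ ha Ω mΩ P hP ℱ B X₀ _ hW hX0m hXγ _ hXV => ?_⟩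
  have hX : AEStronglyMeasurable X₀ P := (hX0m.mono (ℱ.le 0)).aestronglyMeasurable
  obtain ⟨K, hK0, hK⟩ := exists_eLpNorm_sum_interpCoef_sub_sq_le hW hT hX a₀ a₁ a₂ ha hk
    (abs_lt.2 ⟨hβ, hβ'⟩) hXγ hXV
  refine ⟨√K, fun M N hM _ s t hs hst ht => ?_⟩
  have hτ : 0 < T / M := div_pos hT (by exact_mod_cast hM)
  have hm : ∀ n, AEMeasurable (fun ω => interpCoef P B a₀ a₁ a₂ a₃ X₀ N (T / M) t ω n -
      interpCoef P B a₀ a₁ a₂ a₃ X₀ N (T / M) s ω n) P := fun n =>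
    (aemeasurable_interpCoef a₀ a₁ a₂ a₃ hX N hτ (hs.trans hst.le) n).sub
      (aemeasurable_interpCoef a₀ a₁ a₂ a₃ hX N hτ hs n)
  simp only [interpolant_eq, combo_sub]
  refine ⟨Finset.aestronglyMeasurable_fun_sum _ fun n _ =>
    (hm n).aestronglyMeasurable.smul_const (e n), ?_⟩
  exact eLpNorm_sobolevENorm_combo_le hm hkp hK0 (sub_pos.2 hst)
    (hK M N hM s t hs hst ht)
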